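/- **Theorem (forced Cauchy estimates).** Write $\mathcal F\{f\}(k)=\int_{\mathbb R}e^{-ikx}f(x)\,dx$ for the Fourier transform on tempered distributions, $\|f\|_{H^s(\mathbb R)}=\|(1+k^2)^{s/2}\mathcal F\{f\}\|_{L^2(\mathbb R)}$, and let $H^m(0,T)$ consist of the restrictions to $(0,T)$ of elements of $H^m(\mathbb R)$, with $\|g\|_{H^m(0,T)}=\inf\{\|G\|_{H^m(\mathbb R)}: G|_{(0,T)}=g\}$. Let $\omega(k)=|k|\sqrt{1+k^2}$, let $T>0$, and let $F$ be a forcing term on $\mathbb R\times(0,T)$ in one of the spaces named below. Let $Z=S[0,0;F]$ be the solution of $$Z_{tt}-Z_{xx}+Z_{xxxx}=F,\quad x\in\mathbb R,\ t\in(0,T),\qquad Z(x,0)=Z_t(x,0)=0,$$ given, for $t\in[0,T]$, by $$Z(x,t)=\frac1{2\pi}\int_{\mathbb R}\frac{e^{ikx}}{2i\omega}\Big\{e^{i\omega t}\int_0^te^{-i\omega t'}\mathcal F\{F\}(k,t')\,dt'-e^{-i\omega t}\int_0^te^{i\omega t'}\mathcal F\{F\}(k,t')\,dt'\Big\}dk,$$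 that is, $Z(t)$ is the tempered distribution in $x$ whose Fourier transform is $\frac1{2i\omega}\{\cdots\}$; $\partial_tZ$ is its derivative in $t$ as a tempered distribution in $x$. 1. *Space estimate.* There is a constant $c(T)$, depending only on $T$, such that for all $s\in\mathbb R$ and $F\in L^1_t((0,T);H^{s-2}_x(\mathbb R))$, $$\|Z(t)\|_{H^s_x(\mathbb R)}+\|\partial_tZ(t)\|_{H^{s-2}_x(\mathbb R)}\le c(T)\,\|F\|_{L^1_t((0,T);H^{s-2}_x(\mathbb R))},\qquad t\in[0,T].$$ 2. *Time estimates.* For every $j\in\mathbb N_0$ and $s\in\mathbb R$ there is a constant $c_j(s,T)$, depending only on $j,s,T$, such that for all $x\in\mathbb R$ $$\|\partial_x^jZ(x,\cdot)\|_{H_t^{\frac{2s-2j+1}4}(0,T)}\le c_j(s,T)\begin{cases}\|F\|_{L^1_t((0,T);H^{s-2}_x(\mathbb R))},&-\tfrac12+j\le s\le\tfrac32+j,\\[2pt]\|F\|_{L^2_t((0,T);H^{s-2}_x(\mathbb R))},&\tfrac32+j\le s\le\tfrac72+j,\end{cases}$$ for all $F$ in the space on the right-hand side. Here $x\mapsto\partial_x^jZ(x,\cdot)$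 is the family of distributions on $(0,T)$, continuous in $x\in\mathbb R$, that represents the distribution $\partial_x^jZ$ on $\mathbb R\times(0,T)$; in the stated ranges of $s$ it exists, is unique, and consists of locally integrable functions. -/

import Mathlib

open MeasureTheory Set Complex
open scoped ENNReal NNReal SchwartzMap FourierTransform

noncomputable section

namespace Boussinesq

/-! ### Fourier transform and Sobolev spaces on the line -/

/-- The Fourier transform `(𝓕 φ)(k) = ∫ e^{-ikx} φ(x) dx` on Schwartz functions, obtained from
Mathlib's one (which has `e^{-2πikx}`) by rescaling the frequency; see `fourierSchwartz_apply`. -/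
def fourierSchwartz : 𝓢(ℝ, ℂ) →L[ℂ] 𝓢(ℝ, ℂ) :=
  (SchwartzMap.compCLMOfContinuousLinearEquiv ℂ
    (ContinuousLinearEquiv.smulLeft (R₁ := ℝ) (M₁ := ℝ)
      (Units.mk0 ((2 * Real.pi)⁻¹) (inv_ne_zero Real.two_pi_pos.ne')))).comp
    (FourierTransform.fourierCLM ℂ 𝓢(ℝ, ℂ))

theorem fourierSchwartz_apply (φ : 𝓢(ℝ, ℂ)) (k : ℝ) :
    fourierSchwartz φ k = ∫ x : ℝ, cexp (-(I * k * x)) * φ x := by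
  have h : fourierSchwartz φ k = (𝓕 φ : 𝓢(ℝ, ℂ)) ((2 * Real.pi)⁻¹ * k) := rfl
  rw [h, SchwartzMap.fourier_coe, Real.fourier_real_eq_integral_exp_smul]
  refine integral_congr_ae (Filter.Eventually.of_forall fun x => ?_)
  simp only [smul_eq_mul]
  congr 2
  push_cast
  have : (Real.pi : ℂ) ≠ 0 := by exact_mod_cast Real.pi_ne_zero
  field_simp

/-- The Fourier transform of tempered distributions, `⟨𝓕 f, φ⟩ = ⟨f, 𝓕 φ⟩`. -/
def fourierDist (f : 𝓢'(ℝ, ℂ)) : 𝓢'(ℝ, ℂ) :=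
  PointwiseConvergenceCLM.precomp ℂ fourierSchwartz f

/-- `𝓕 f` is (the tempered distribution given by) the function `g`. -/
def IsFourierDensity (f : 𝓢'(ℝ, ℂ)) (g : ℝ → ℂ) : Prop :=
  ∀ φ : 𝓢(ℝ, ℂ), Integrable (fun k => g k * φ k) ∧ fourierDist f φ = ∫ k, g k * φ k

/-- The norm `‖(1 + k²)^{s/2} 𝓕 f‖_{L²(ℝ)}` of `H^s(ℝ)`, with value `∞` when `f ∉ H^s(ℝ)`.
The density `g` of `𝓕 f` is unique almost everywhere when it exists, so the infimum is the
value at that density, or `∞` when `𝓕 f` is not a function. -/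
def sobolevENorm (s : ℝ) (f : 𝓢'(ℝ, ℂ)) : ℝ≥0∞ :=
  ⨅ (g : ℝ → ℂ) (_ : IsFourierDensity f g),
    eLpNorm (fun k : ℝ => (((1 + k ^ 2) ^ (s / 2) : ℝ) : ℂ) * g k) 2 volume

/-- `φ` is a test function on the open interval `(0, T)`. -/
def IsTestOn (T : ℝ) (φ : 𝓢(ℝ, ℂ)) : Prop :=
  tsupport (φ : ℝ → ℂ) ⊆ Ioo 0 T

/-- The restriction of the tempered distribution `G` to the interval `(0, T)`, as a
distribution there, is the function `v`. -/
def RestrictsTo (T : ℝ) (G : 𝓢'(ℝ, ℂ)) (v : ℝ → ℂ) : Prop :=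
  ∀ φ : 𝓢(ℝ, ℂ), IsTestOn T φ →
    IntegrableOn (fun t => v t * φ t) (Ioo 0 T) ∧ G φ = ∫ t in Ioo 0 T, v t * φ t

/-- The norm of `H^m(0, T)`: the infimum of the `H^m(ℝ)` norms of all extensions, with value `∞`
when there is no extension in `H^m(ℝ)`. It is written for distributions on `(0, T)` that are
functions; for `m ≥ 0` every element of `H^m(0, T)` is one. -/
def sobolevENormOn (m T : ℝ) (v : ℝ → ℂ) : ℝ≥0∞ :=
  ⨅ (G : 𝓢'(ℝ, ℂ)) (_ : RestrictsTo T G v), sobolevENorm m G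

/-! ### Forcing terms: the spaces `L^p((0, T); H^σ(ℝ))` -/

/-- `Fhat k t` is a jointly measurable version of the Fourier transform in `x` of `F(·, t)`,
for almost every `t ∈ (0, T)`. -/
def IsSpatialFourier (T : ℝ) (F : ℝ → 𝓢'(ℝ, ℂ)) (Fhat : ℝ → ℝ → ℂ) : Prop :=
  Measurable (Function.uncurry Fhat) ∧
    ∀ᵐ t ∂(volume.restrict (Ioo 0 T)), IsFourierDensity (F t) (fun k => Fhat k t)

/-- The norm of `L^p((0, T); H^σ(ℝ))`. -/
def bochnerENorm (p : ℝ≥0∞) (σ T : ℝ) (F : ℝ → 𝓢'(ℝ, ℂ)) : ℝ≥0∞ :=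
  eLpNorm (fun t => sobolevENorm σ (F t)) p (volume.restrict (Ioo 0 T))

/-- `F ∈ L^p((0, T); H^σ(ℝ))`. As `H^σ(ℝ)` is isometric, through the Fourier transform, to a
separable weighted `L²` space, strong measurability of `t ↦ F t` is the same as the existence of
a jointly measurable version of the Fourier transform. -/
def MemBochner (p : ℝ≥0∞) (σ T : ℝ) (F : ℝ → 𝓢'(ℝ, ℂ)) : Prop :=
  (∃ Fhat : ℝ → ℝ → ℂ, IsSpatialFourier T F Fhat) ∧ bochnerENorm p σ T F < ∞

/-! ### The forced Cauchy problem with zero data -/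

/-- The dispersion relation `ω(k) = |k| (1 + k²)^{1/2}` for real `k`. -/
def omega (k : ℝ) : ℝ := |k| * Real.sqrt (1 + k ^ 2)

/-- The Fourier transform in `x`, at `k` and at time `t`, of the solution of
`Z_tt - Z_xx + Z_xxxx = F`, `Z(·, 0) = Z_t(·, 0) = 0`:
`(1 / 2iω) { e^{iωt} ∫₀ᵗ e^{-iωt'} 𝓕F(k, t') dt' - e^{-iωt} ∫₀ᵗ e^{iωt'} 𝓕F(k, t') dt' }`.
The value at the single frequency `k = 0` is immaterial. -/
def solutionHat (Fhat : ℝ → ℝ → ℂ) (t k : ℝ) : ℂ :=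
  1 / (2 * I * omega k) *
    (cexp (I * omega k * t) * (∫ t' in (0 : ℝ)..t, cexp (-(I * omega k * t')) * Fhat k t')
      - cexp (-(I * omega k * t)) * ∫ t' in (0 : ℝ)..t, cexp (I * omega k * t') * Fhat k t')

/-- `Z = S[0, 0; F]` on `[0, T]`: for every `t ∈ [0, T]`, `Z t` is the inverse Fourier transform
of `solutionHat`. -/
def IsForcedSolution (T : ℝ) (F Z : ℝ → 𝓢'(ℝ, ℂ)) : Prop :=
  ∃ Fhat : ℝ → ℝ → ℂ, IsSpatialFourier T F Fhat ∧
    ∀ t ∈ Icc 0 T, IsFourierDensity (Z t) (solutionHat Fhat t)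

/-- `Z' = ∂_t Z` on `[0, T]` (one-sided at the end points), as tempered distributions in `x`. -/
def IsTimeDerivative (T : ℝ) (Z Z' : ℝ → 𝓢'(ℝ, ℂ)) : Prop :=
  ∀ t ∈ Icc 0 T, ∀ ψ : 𝓢(ℝ, ℂ),
    HasDerivWithinAt (fun τ => Z τ ψ) (Z' t ψ) (Icc 0 T) t

/-- `v x` is the function `t ↦ ∂_x^j Z(x, t)` on `(0, T)`, for every `x`. The distribution
`∂_x^j Z` on `ℝ × (0, T)` is `v`, where `x ↦ v x` is continuous as a map into the distributions
on `(0, T)`; this determines each `v x` almost everywhere in `(0, T)`, for every single `x`. -/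
def IsTimeTrace (j : ℕ) (T : ℝ) (Z : ℝ → 𝓢'(ℝ, ℂ)) (v : ℝ → ℝ → ℂ) : Prop :=
  (∀ x, LocallyIntegrableOn (v x) (Ioo 0 T)) ∧
  ∀ η : 𝓢(ℝ, ℂ), IsTestOn T η →
    Continuous (fun x => ∫ t in Ioo 0 T, v x t * η t) ∧
    ∀ ψ : 𝓢(ℝ, ℂ), HasCompactSupport (ψ : ℝ → ℂ) →
      ∫ x, (∫ t in Ioo 0 T, v x t * η t) * ψ x =
        (-1) ^ j * ∫ t in Ioo 0 T, Z t ((SchwartzMap.derivCLM ℂ ℂ)^[j] ψ) * η t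

end Boussinesq

end

/-!
The time estimates are proved by duality. Pairing `∂_x^j Z(x, ·)` with a test function
`η = hat f` supported in `(0, T)` and moving the Duhamel operator onto `η` gives the integral of
`e^{ikx} (ik)^j ℱ{F}(k, a)` against `∫_a^T sin(ω(t - a)) / ω η(t) dt`. By the change of variables
`τ = ω(k)` and Plancherel in `t`, the latter has a weighted `L²` norm in `k`, bounded uniformly
in `a` by the `L²` norm of `η`. Writing `η` as `ψ + ψ'` or as `ψ - ψ''` and integrating by parts in
`t` trades derivatives of the test function for powers of `ω`; this gives the bounds by the norms
of `H^{-m}`, `m = 0, 1, 2`, and quadratic interpolation those for the real `m` in between. For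
`m = 2` a boundary term `ψ(a)` is left over, which is controlled only in `L²` in `a`: this is why
the upper range of `s` requires forcing in `L²` in time. The trace functional is thus bounded on
`H^{-m}`, and the Riesz representation theorem provides both the trace and an extension of it in
`H^m(ℝ)`.

The space estimate follows from `(1 + k²) |sin(ωτ) / ω| ≤ 2T + 2` for `|τ| ≤ T` and Minkowski's
integral inequality.
-/

noncomputable section

namespace Boussinesq

/-! ### The Fourier transform on Schwartz functions and on `L¹ ∩ L²` -/

/-- The Fourier integral `∫ e^{-itx} f(x) dx`, normalized as in `fourierSchwartz`. -/
def hat (f : ℝ → ℂ) (t : ℝ) : ℂ := ∫ x : ℝ, cexp (-(I * t * x)) * f x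

theorem fourierSchwartz_eq_hat (φ : 𝓢(ℝ, ℂ)) : ⇑(fourierSchwartz φ) = hat φ :=
  funext (fourierSchwartz_apply φ)

/-- The dilation `φ ↦ φ(c ·)` of Schwartz functions. -/
def dilation (c : ℝˣ) : 𝓢(ℝ, ℂ) →L[ℂ] 𝓢(ℝ, ℂ) :=
  SchwartzMap.compCLMOfContinuousLinearEquiv ℂ
    (ContinuousLinearEquiv.smulLeft (R₁ := ℝ) (M₁ := ℝ) c)

theorem dilation_apply (c : ℝˣ) (φ : 𝓢(ℝ, ℂ)) (x : ℝ) : dilation c φ x = φ (c * x) := rfl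

/-- The inverse of `fourierSchwartz`. -/
def fourierSchwartzInv : 𝓢(ℝ, ℂ) →L[ℂ] 𝓢(ℝ, ℂ) :=
  (FourierTransform.fourierCLE ℂ 𝓢(ℝ, ℂ)).symm.toContinuousLinearMap.comp
    (dilation (Units.mk0 (2 * Real.pi) Real.two_pi_pos.ne'))

theorem fourierSchwartz_fourierSchwartzInv (φ : 𝓢(ℝ, ℂ)) :
    fourierSchwartz (fourierSchwartzInv φ) = φ := by
  have h : 𝓕 (fourierSchwartzInv φ) = dilation (Units.mk0 (2 * Real.pi) Real.two_pi_pos.ne') φ :=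
    (FourierTransform.fourierCLE ℂ 𝓢(ℝ, ℂ)).apply_symm_apply _
  ext k
  change (𝓕 (fourierSchwartzInv φ) : 𝓢(ℝ, ℂ)) ((2 * Real.pi)⁻¹ * k) = φ k
  rw [h, dilation_apply, Units.val_mk0, mul_inv_cancel_left₀ Real.two_pi_pos.ne']

theorem fourierSchwartzInv_fourierSchwartz (φ : 𝓢(ℝ, ℂ)) :
    fourierSchwartzInv (fourierSchwartz φ) = φ := by
  have h : dilation (Units.mk0 (2 * Real.pi) Real.two_pi_pos.ne') (fourierSchwartz φ)
      = FourierTransform.fourierCLE ℂ 𝓢(ℝ, ℂ) φ := by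
    ext k
    change (𝓕 φ : 𝓢(ℝ, ℂ)) ((2 * Real.pi)⁻¹ * (2 * Real.pi * k)) = (𝓕 φ : 𝓢(ℝ, ℂ)) k
    rw [inv_mul_cancel_left₀ Real.two_pi_pos.ne']
  rw [fourierSchwartzInv, ContinuousLinearMap.comp_apply, h]
  exact (FourierTransform.fourierCLE ℂ 𝓢(ℝ, ℂ)).symm_apply_apply _

theorem fourierSchwartzInv_apply (ψ : 𝓢(ℝ, ℂ)) (k : ℝ) :
    fourierSchwartzInv ψ k = (2 * Real.pi : ℂ)⁻¹ * ∫ x : ℝ, cexp (I * k * x) * ψ x := by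
  have h : fourierSchwartzInv ψ k =
      (𝓕⁻ (dilation (Units.mk0 (2 * Real.pi) Real.two_pi_pos.ne') ψ) : 𝓢(ℝ, ℂ)) k := rfl
  have dilate := Measure.integral_comp_mul_left (fun x : ℝ => cexp (I * k * x) * ψ x) (2 * Real.pi)
  rw [abs_of_pos (inv_pos.2 Real.two_pi_pos), Complex.real_smul, Complex.ofReal_inv,
    Complex.ofReal_mul, Complex.ofReal_ofNat] at dilate
  rw [h, SchwartzMap.fourierInv_coe, Real.fourierInv_eq', ← dilate]
  refine integral_congr_ae (Filter.Eventually.of_forall fun x => ?_)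
  simp only [smul_eq_mul, dilation_apply, Units.val_mk0, RCLike.inner_apply, conj_trivial]
  congr 2
  push_cast
  ring

theorem hat_eq_fourier (f : ℝ → ℂ) (t : ℝ) : hat f t = 𝓕 f ((2 * Real.pi)⁻¹ * t) := by
  rw [hat, Real.fourier_real_eq_integral_exp_smul]
  refine integral_congr_ae (Filter.Eventually.of_forall fun x => ?_)
  simp only [smul_eq_mul]
  congr 2
  push_cast
  have : (Real.pi : ℂ) ≠ 0 := by exact_mod_cast Real.pi_ne_zero
  field_simp

theorem rpow_half_sq (a : ℝ≥0∞) : (a ^ (1 / 2 : ℝ)) ^ 2 = a := by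
  rw [← ENNReal.rpow_natCast, ← ENNReal.rpow_mul]
  norm_num

theorem sq_rpow_half (a : ℝ≥0∞) : (a ^ 2) ^ (1 / 2 : ℝ) = a := by
  rw [← ENNReal.rpow_natCast, ← ENNReal.rpow_mul]
  norm_num

theorem eLpNorm_two_sq {α ε : Type*} [MeasurableSpace α] {μ : Measure α} [ENorm ε] (f : α → ε) :
    eLpNorm f 2 μ ^ 2 = ∫⁻ x, ‖f x‖ₑ ^ 2 ∂μ := by
  simpa using eLpNorm_nnreal_pow_eq_lintegral (μ := μ) (f := f) (p := 2) two_ne_zero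

theorem eLpNorm_two_eq {α ε : Type*} [MeasurableSpace α] {μ : Measure α} [ENorm ε] (f : α → ε) :
    eLpNorm f 2 μ = (∫⁻ x, ‖f x‖ₑ ^ 2 ∂μ) ^ (1 / 2 : ℝ) := by
  rw [← eLpNorm_two_sq, sq_rpow_half]

section Plancherel

variable {E F : Type*} [NormedAddCommGroup E] [InnerProductSpace ℝ E] [FiniteDimensional ℝ E]
  [MeasurableSpace E] [BorelSpace E] [NormedAddCommGroup F]

section NormedSpace

variable [NormedSpace ℂ F]

theorem continuous_fourier {f : E → F} (hf : Integrable f) : Continuous (𝓕 f) :=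
  VectorFourier.fourierIntegral_continuous Real.continuous_fourierChar continuous_inner hf

theorem integral_fourier_smul_schwartz [CompleteSpace F] {f : E → F} (hf : Integrable f)
    (φ : 𝓢(E, ℂ)) :
    ∫ x, φ x • 𝓕 f x = ∫ x, (𝓕 φ : 𝓢(E, ℂ)) x • f x := by
  have flip : (innerₗ E).flip = innerₗ E := by ext; simp
  have := VectorFourier.integral_fourierIntegral_smul_eq_flip (L := innerₗ E) (μ := volume)
    (ν := volume) (f := φ) (g := f) Real.continuous_fourierChar continuous_inner φ.integrable hf
  rw [flip] at this
  rw [SchwartzMap.fourier_coe]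
  exact this.symm

end NormedSpace

variable [InnerProductSpace ℂ F] [CompleteSpace F]

theorem fourier_ae_eq_Lp_fourier {f : E → F} (hf : Integrable f) (hf2 : MemLp f 2) :
    𝓕 f =ᵐ[volume] (𝓕 (hf2.toLp f) : Lp F 2 (volume : Measure E)) := by
  refine ae_eq_of_integral_contDiff_smul_eq (continuous_fourier hf).locallyIntegrable
    ((Lp.memLp _).locallyIntegrable one_le_two) fun g hg hgs => ?_
  let G : 𝓢(E, ℂ) := HasCompactSupport.toSchwartzMap (f := fun x => (g x : ℂ))
    (hgs.comp_left (g := fun x : ℝ => (x : ℂ)) Complex.ofReal_zero)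
    (Complex.ofRealCLM.contDiff.comp hg)
  have test (v : E → F) : ∫ x, g x • v x = ∫ x, G x • v x :=
    integral_congr_ae (Filter.Eventually.of_forall fun x => (Complex.coe_smul (g x) (v x)).symm)
  have hLp := congrArg (fun D : 𝓢'(E, F) => D G)
    (Lp.fourier_toTemperedDistribution_eq (hf2.toLp f))
  simp only [TemperedDistribution.fourier_apply, Lp.toTemperedDistribution_apply] at hLp
  rw [test, test, integral_fourier_smul_schwartz hf, ← hLp]
  refine integral_congr_ae ?_
  filter_upwards [hf2.coeFn_toLp] with x hx
  rw [hx]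

theorem lintegral_fourier_sq {f : E → F} (hf : Integrable f) (hf2 : MemLp f 2) :
    ∫⁻ t, ‖𝓕 f t‖ₑ ^ 2 = ∫⁻ x, ‖f x‖ₑ ^ 2 := by
  rw [← eLpNorm_two_sq, ← eLpNorm_two_sq, eLpNorm_congr_ae (fourier_ae_eq_Lp_fourier hf hf2),
    ← Lp.enorm_def, ← Lp.enorm_toLp (hf := hf2), ← ofReal_norm, ← ofReal_norm, Lp.norm_fourier_eq]

end Plancherel

theorem lintegral_comp_mul_left_real {c : ℝ} (hc : 0 < c) (f : ℝ → ℝ≥0∞) :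
    ∫⁻ x, f (c * x) = ENNReal.ofReal c⁻¹ * ∫⁻ x, f x := by
  have e : MeasurableEmbedding (fun x : ℝ => c * x) :=
    (Homeomorph.mulLeft₀ c hc.ne').measurableEmbedding
  rw [← e.lintegral_map, Real.map_volume_mul_left hc.ne', lintegral_smul_measure,
    abs_of_pos (inv_pos.2 hc), smul_eq_mul]

theorem lintegral_hat_sq {f : ℝ → ℂ} (hf : Integrable f) (hf2 : MemLp f 2) :
    ∫⁻ t, ‖hat f t‖ₑ ^ 2 = ENNReal.ofReal (2 * Real.pi) * ∫⁻ x, ‖f x‖ₑ ^ 2 := by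
  simp_rw [hat_eq_fourier]
  rw [lintegral_comp_mul_left_real (inv_pos.2 Real.two_pi_pos) (fun t => ‖𝓕 f t‖ₑ ^ 2), inv_inv,
    lintegral_fourier_sq hf hf2]

theorem continuous_hat {f : ℝ → ℂ} (hf : Integrable f) : Continuous (hat f) := by
  rw [funext (hat_eq_fourier f)]
  exact (continuous_fourier hf).comp (continuous_const_mul _)

/-! ### Distributions whose Fourier transform is a function -/

theorem exists_schwartz_of_contDiff {g : ℝ → ℝ} (hg : ContDiff ℝ (⊤ : ℕ∞) g)
    (hgs : HasCompactSupport g) :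
    ∃ G : 𝓢(ℝ, ℂ), (∀ x, G x = (g x : ℂ)) ∧ HasCompactSupport (G : ℝ → ℂ) :=
  have h := hgs.comp_left (g := fun x : ℝ => (x : ℂ)) Complex.ofReal_zero
  ⟨HasCompactSupport.toSchwartzMap (f := fun x => (g x : ℂ)) h
    (Complex.ofRealCLM.contDiff.comp hg), fun _ => rfl, h⟩

theorem exists_schwartz_one_on {K : Set ℝ} (hK : IsCompact K) :
    ∃ G : 𝓢(ℝ, ℂ), ∀ x ∈ K, G x = 1 := by
  obtain ⟨r, hr, hKr⟩ := hK.isBounded.subset_ball_lt 0 0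
  let f : ContDiffBump (0 : ℝ) := ⟨r, r + 1, hr, lt_add_one r⟩
  obtain ⟨G, hG, -⟩ := exists_schwartz_of_contDiff (g := f) f.contDiff f.hasCompactSupport
  refine ⟨G, fun x hx => ?_⟩
  rw [hG, f.one_of_mem_closedBall (Metric.ball_subset_closedBall (hKr hx)), Complex.ofReal_one]

theorem locallyIntegrable_of_integrable_mul_schwartz {g : ℝ → ℂ}
    (h : ∀ φ : 𝓢(ℝ, ℂ), Integrable (fun k => g k * φ k)) : LocallyIntegrable g := by
  rw [locallyIntegrable_iff]
  intro K hK
  obtain ⟨G, hG⟩ := exists_schwartz_one_on hK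
  refine ((h G).integrableOn (s := K)).congr_fun (fun x hx => ?_) hK.measurableSet
  simp only [hG x hx, mul_one]

theorem ae_eq_of_integral_mul_schwartz_eq {f g : ℝ → ℂ} (hf : LocallyIntegrable f)
    (hg : LocallyIntegrable g)
    (h : ∀ ψ : 𝓢(ℝ, ℂ), HasCompactSupport (ψ : ℝ → ℂ) → ∫ x, f x * ψ x = ∫ x, g x * ψ x) :
    f =ᵐ[volume] g := by
  refine ae_eq_of_integral_contDiff_smul_eq hf hg fun u hu hus => ?_
  obtain ⟨G, hG, hGs⟩ := exists_schwartz_of_contDiff hu hus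
  have test (v : ℝ → ℂ) : ∫ x, u x • v x = ∫ x, v x * G x :=
    integral_congr_ae (Filter.Eventually.of_forall fun x => by
      simp only [hG, Complex.real_smul, mul_comm])
  rw [test, test, h G hGs]

theorem IsFourierDensity.ae_eq {f : 𝓢'(ℝ, ℂ)} {g h : ℝ → ℂ} (hg : IsFourierDensity f g)
    (hh : IsFourierDensity f h) : g =ᵐ[volume] h :=
  ae_eq_of_integral_mul_schwartz_eq
    (locallyIntegrable_of_integrable_mul_schwartz fun φ => (hg φ).1)
    (locallyIntegrable_of_integrable_mul_schwartz fun φ => (hh φ).1)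
    fun ψ _ => (hg ψ).2.symm.trans (hh ψ).2

theorem IsFourierDensity.congr_ae {f : 𝓢'(ℝ, ℂ)} {g h : ℝ → ℂ} (hg : IsFourierDensity f g)
    (hgh : g =ᵐ[volume] h) : IsFourierDensity f h := fun φ => by
  have e : (fun k => g k * φ k) =ᵐ[volume] fun k => h k * φ k := by
    filter_upwards [hgh] with k hk
    rw [hk]
  exact ⟨(hg φ).1.congr e, (hg φ).2.trans (integral_congr_ae e)⟩

theorem IsFourierDensity.apply_eq {f : 𝓢'(ℝ, ℂ)} {g : ℝ → ℂ} (hg : IsFourierDensity f g)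
    (ψ : 𝓢(ℝ, ℂ)) : f ψ = ∫ k, g k * fourierSchwartzInv ψ k := by
  rw [← (hg _).2]
  change f ψ = f (fourierSchwartz (fourierSchwartzInv ψ))
  rw [fourierSchwartz_fourierSchwartzInv]

/-! ### Bessel weights -/

/-- The Bessel weight `(1 + k²)^a`. -/
def weight (a k : ℝ) : ℝ := (1 + k ^ 2) ^ a

theorem weight_pos (a k : ℝ) : 0 < weight a k := Real.rpow_pos_of_pos (by positivity) _

theorem weight_add (a b k : ℝ) : weight (a + b) k = weight a k * weight b k :=
  Real.rpow_add (by positivity) _ _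

theorem weight_rpow (a θ k : ℝ) : weight a k ^ θ = weight (a * θ) k := by
  rw [weight, weight, ← Real.rpow_mul (by positivity)]

theorem weight_zero (k : ℝ) : weight 0 k = 1 := Real.rpow_zero _

theorem weight_one (k : ℝ) : weight 1 k = 1 + k ^ 2 := Real.rpow_one _

theorem weight_mono {a b : ℝ} (h : a ≤ b) (k : ℝ) : weight a k ≤ weight b k :=
  Real.rpow_le_rpow_of_exponent_le (by nlinarith [sq_nonneg k]) h

@[fun_prop]
theorem continuous_weight (a : ℝ) : Continuous (weight a) := by
  unfold weight
  exact Continuous.rpow_const (by fun_prop) fun x => Or.inl (by positivity)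

theorem hasTemperateGrowth_weight (a : ℝ) :
    Function.HasTemperateGrowth (fun k : ℝ => (weight a k : ℂ)) := by
  convert Complex.ofRealCLM.hasTemperateGrowth.comp
    (Function.hasTemperateGrowth_one_add_norm_sq_rpow (H := ℝ) a) using 1
  ext k
  simp [weight]

theorem enorm_sq_eq_ofReal {E : Type*} [SeminormedAddGroup E] (z : E) :
    ‖z‖ₑ ^ 2 = ENNReal.ofReal (‖z‖ ^ 2) := by
  rw [← ofReal_norm, ENNReal.ofReal_pow (norm_nonneg z)]

theorem ofReal_weight_mul_weight (a b k : ℝ) (x : ℝ≥0∞) :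
    ENNReal.ofReal (weight a k) * (ENNReal.ofReal (weight b k) * x)
      = ENNReal.ofReal (weight (a + b) k) * x := by
  rw [← mul_assoc, ← ENNReal.ofReal_mul (weight_pos _ _).le, weight_add]

theorem enorm_weight_mul (a k : ℝ) (z : ℂ) :
    ‖(weight a k : ℂ) * z‖ₑ = ENNReal.ofReal (weight a k) * ‖z‖ₑ := by
  rw [enorm_mul, ← ofReal_norm (weight a k : ℂ), Complex.norm_of_nonneg (weight_pos a k).le]

theorem enorm_weight_mul_sq (a k : ℝ) (z : ℂ) :
    ‖(weight a k : ℂ) * z‖ₑ ^ 2 = ENNReal.ofReal (weight (2 * a) k) * ‖z‖ₑ ^ 2 := by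
  rw [enorm_weight_mul, mul_pow, sq (ENNReal.ofReal _), mul_assoc, ofReal_weight_mul_weight,
    two_mul]

/-- Multiplication of Schwartz functions by the weight. -/
def weightMul (a : ℝ) : 𝓢(ℝ, ℂ) →L[ℂ] 𝓢(ℝ, ℂ) :=
  SchwartzMap.smulLeftCLM ℂ (fun k : ℝ => (weight a k : ℂ))

theorem weightMul_apply (a : ℝ) (φ : 𝓢(ℝ, ℂ)) (k : ℝ) :
    weightMul a φ k = weight a k * φ k := by
  rw [weightMul, SchwartzMap.smulLeftCLM_apply_apply (hasTemperateGrowth_weight a), smul_eq_mul]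

theorem weightMul_neg_mul_weight_mul (a : ℝ) (g : ℝ → ℂ) (φ : 𝓢(ℝ, ℂ)) (k : ℝ) :
    weightMul (-a) φ k * (weight a k * g k) = g k * φ k := by
  have : (weight (-a) k : ℂ) * weight a k = 1 := by
    rw [← Complex.ofReal_mul, ← weight_add, neg_add_cancel, weight_zero, Complex.ofReal_one]
  rw [weightMul_apply]
  linear_combination (g k * φ k) * this

theorem exists_isFourierDensity {a : ℝ} {g : ℝ → ℂ}
    (hg : MemLp (fun k => (weight a k : ℂ) * g k) 2) :
    ∃ f : 𝓢'(ℝ, ℂ), IsFourierDensity f g := by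
  refine ⟨PointwiseConvergenceCLM.precomp ℂ ((weightMul (-a)).comp fourierSchwartzInv)
    (Lp.toTemperedDistribution (hg.toLp _)), fun φ => ⟨?_, ?_⟩⟩
  · simp_rw [← weightMul_neg_mul_weight_mul a]
    exact MemLp.integrable_mul (p := 2) (q := 2) ((weightMul (-a) φ).memLp 2) hg
  · change (Lp.toTemperedDistribution (hg.toLp _))
      (weightMul (-a) (fourierSchwartzInv (fourierSchwartz φ))) = _
    rw [fourierSchwartzInv_fourierSchwartz, Lp.toTemperedDistribution_apply]
    refine integral_congr_ae ?_
    filter_upwards [hg.coeFn_toLp] with k hk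
    rw [hk, smul_eq_mul, weightMul_neg_mul_weight_mul]

/-- The squared norm of `L²((1 + k²)^a dk)`. -/
def energy (a : ℝ) (u : ℝ → ℂ) : ℝ≥0∞ := ∫⁻ k, ENNReal.ofReal (weight a k) * ‖u k‖ₑ ^ 2

/-- The norm of `H^σ(ℝ)`, as a function of the Fourier transform. -/
def hatENorm (σ : ℝ) (u : ℝ → ℂ) : ℝ≥0∞ := energy σ u ^ (1 / 2 : ℝ)

theorem energy_zero (u : ℝ → ℂ) : energy 0 u = ∫⁻ k, ‖u k‖ₑ ^ 2 := by
  simp only [energy, weight_zero, ENNReal.ofReal_one, one_mul]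

theorem energy_mono {a b : ℝ} (h : a ≤ b) (u : ℝ → ℂ) : energy a u ≤ energy b u :=
  lintegral_mono fun k => mul_le_mul_left (ENNReal.ofReal_le_ofReal (weight_mono h k)) _

theorem energy_weight_mul (a b : ℝ) (u : ℝ → ℂ) :
    energy a (fun k => weight b k * u k) = energy (a + 2 * b) u := by
  simp only [energy, enorm_weight_mul_sq, ofReal_weight_mul_weight]

theorem energy_eq_eLpNorm_sq (σ : ℝ) (u : ℝ → ℂ) :
    energy σ u = eLpNorm (fun k => (weight (σ / 2) k : ℂ) * u k) 2 volume ^ 2 := by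
  rw [eLpNorm_two_sq, ← energy_zero, energy_weight_mul, zero_add, mul_div_cancel₀ σ two_ne_zero]

theorem hatENorm_sq (σ : ℝ) (u : ℝ → ℂ) : hatENorm σ u ^ 2 = energy σ u :=
  rpow_half_sq _

theorem hatENorm_eq_eLpNorm (σ : ℝ) (u : ℝ → ℂ) :
    hatENorm σ u = eLpNorm (fun k => (weight (σ / 2) k : ℂ) * u k) 2 volume := by
  rw [hatENorm, energy_eq_eLpNorm_sq, sq_rpow_half]

theorem hatENorm_mono {a b : ℝ} (h : a ≤ b) (u : ℝ → ℂ) : hatENorm a u ≤ hatENorm b u :=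
  ENNReal.rpow_le_rpow (energy_mono h u) (by norm_num)

theorem sobolevENorm_eq_hatENorm {f : 𝓢'(ℝ, ℂ)} {g : ℝ → ℂ} (hg : IsFourierDensity f g) (s : ℝ) :
    sobolevENorm s f = hatENorm s g := by
  rw [hatENorm_eq_eLpNorm]
  refine le_antisymm (iInf₂_le g hg) (le_iInf₂ fun h hh => le_of_eq (eLpNorm_congr_ae ?_))
  filter_upwards [hg.ae_eq hh] with k hk
  rw [hk, weight]

/-! ### Duality, Cauchy–Schwarz and Minkowski inequalities -/

theorem exists_strongDual_of_norm_le {𝕜 V E : Type*} [RCLike 𝕜] [AddCommGroup V] [Module 𝕜 V]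
    [NormedAddCommGroup E] [NormedSpace 𝕜 E] (J : V →ₗ[𝕜] E) (L : V →ₗ[𝕜] 𝕜) (C : ℝ≥0)
    (hL : ∀ φ, ‖L φ‖ ≤ C * ‖J φ‖) :
    ∃ Λ : StrongDual 𝕜 E, ‖Λ‖ ≤ C ∧ ∀ φ, Λ (J φ) = L φ := by
  obtain ⟨σ, hσ⟩ := J.rangeRestrict.exists_rightInverse_of_surjective J.range_rangeRestrict
  have hJσ (y : LinearMap.range J) : J (σ y) = y := congrArg Subtype.val (LinearMap.congr_fun hσ y)
  obtain ⟨Λ, hΛ, hnorm⟩ := exists_extension_norm_eq _ ((L.comp σ).mkContinuous C fun y =>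
    (hL _).trans_eq (by rw [hJσ, Submodule.coe_norm]))
  refine ⟨Λ, hnorm.trans_le (LinearMap.mkContinuous_norm_le _ C.coe_nonneg _), fun φ => ?_⟩
  have hker : L (σ (J.rangeRestrict φ) - φ) = 0 := norm_le_zero_iff.1 <|
    (hL _).trans_eq (by
      rw [map_sub, hJσ, LinearMap.codRestrict_apply, sub_self, norm_zero, mul_zero])
  rw [map_sub, sub_eq_zero] at hker
  exact (hΛ (J.rangeRestrict φ)).trans hker

section Measure

variable {α β : Type*} [MeasurableSpace α] [MeasurableSpace β] {μ : Measure α} {ν : Measure β}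

theorem exists_memLp_repr {𝕜 V : Type*} [RCLike 𝕜] [AddCommGroup V] [Module 𝕜 V]
    (ι : V →ₗ[𝕜] α → 𝕜) (hι : ∀ φ, MemLp (ι φ) 2 μ) (L : V →ₗ[𝕜] 𝕜) (C : ℝ≥0)
    (hL : ∀ φ, ‖L φ‖ₑ ≤ C * eLpNorm (ι φ) 2 μ) :
    ∃ h : α → 𝕜, MemLp h 2 μ ∧ eLpNorm h 2 μ ≤ C ∧ ∀ φ, L φ = ∫ x, h x * ι φ x ∂μ := by
  let J : V →ₗ[𝕜] Lp 𝕜 2 μ :=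
    { toFun := fun φ => (hι φ).toLp
      map_add' := fun φ ψ => by
        rw [← MemLp.toLp_add]
        exact MemLp.toLp_congr _ _ (by rw [map_add])
      map_smul' := fun c φ => by
        rw [RingHom.id_apply, ← MemLp.toLp_const_smul]
        exact MemLp.toLp_congr _ _ (by rw [map_smul]) }
  have hJ (φ : V) : ‖L φ‖ ≤ C * ‖J φ‖ := by
    have h := hL φ
    rw [← Lp.enorm_toLp (hf := hι φ), ← ofReal_norm, ← ofReal_norm, ← ENNReal.ofReal_coe_nnreal,
      ← ENNReal.ofReal_mul C.coe_nonneg] at h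
    exact (ENNReal.ofReal_le_ofReal_iff (by positivity)).1 h
  obtain ⟨Λ, hΛ, hL⟩ := exists_strongDual_of_norm_le J L C hJ
  let y : Lp 𝕜 2 μ := (InnerProductSpace.toDual 𝕜 _).symm Λ
  have hy : ‖y‖ ≤ C := (LinearIsometryEquiv.norm_map _ _).trans_le hΛ
  refine ⟨fun x => (starRingEnd 𝕜) (y x), (Lp.memLp y).star, ?_, fun φ => ?_⟩
  · have e : eLpNorm (fun x => (starRingEnd 𝕜) (y x)) 2 μ = eLpNorm y 2 μ :=
      eLpNorm_congr_norm_ae (Filter.Eventually.of_forall fun x => RCLike.norm_conj (y x))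
    rw [e, ← Lp.enorm_def, ← ofReal_norm, ← ENNReal.ofReal_coe_nnreal]
    exact ENNReal.ofReal_le_ofReal hy
  · rw [← hL, ← InnerProductSpace.toDual_symm_apply (𝕜 := 𝕜), L2.inner_def]
    refine integral_congr_ae ?_
    filter_upwards [(hι φ).coeFn_toLp] with x hx
    rw [show (J φ) x = ι φ x from hx, RCLike.inner_apply, mul_comm]

theorem lintegral_mul_le_sqrt {f g : α → ℝ≥0∞} (hf : AEMeasurable f μ) (hg : AEMeasurable g μ) :
    ∫⁻ a, f a * g a ∂μ
      ≤ (∫⁻ a, f a ^ 2 ∂μ) ^ (1 / 2 : ℝ) * (∫⁻ a, g a ^ 2 ∂μ) ^ (1 / 2 : ℝ) := by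
  simpa using ENNReal.lintegral_mul_le_Lp_mul_Lq μ Real.HolderConjugate.two_two hf hg

theorem sq_lintegral_mul_le {f g : α → ℝ≥0∞} (hf : AEMeasurable f μ) (hg : AEMeasurable g μ) :
    (∫⁻ a, f a * g a ∂μ) ^ 2 ≤ (∫⁻ a, f a ^ 2 ∂μ) * ∫⁻ a, g a ^ 2 ∂μ := by
  refine (pow_le_pow_left' (lintegral_mul_le_sqrt hf hg) 2).trans_eq ?_
  rw [mul_pow, rpow_half_sq, rpow_half_sq]

theorem sq_lintegral_eq_lintegral_lintegral {f : α → ℝ≥0∞} (hf : Measurable f) :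
    (∫⁻ a, f a ∂μ) ^ 2 = ∫⁻ a, ∫⁻ b, f a * f b ∂μ ∂μ := by
  rw [sq, ← lintegral_mul_const _ hf]
  exact lintegral_congr fun a => (lintegral_const_mul _ hf).symm

theorem lintegral_sq_lintegral_le [SFinite μ] [SFinite ν] {h : α → β → ℝ≥0∞}
    (hh : Measurable (Function.uncurry h)) :
    ∫⁻ a, (∫⁻ b, h a b ∂ν) ^ 2 ∂μ ≤ (∫⁻ b, (∫⁻ a, h a b ^ 2 ∂μ) ^ (1 / 2 : ℝ) ∂ν) ^ 2 := by
  have hm : Measurable fun p : α × β => h p.1 p.2 := hh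
  have h_left (a : α) : Measurable (h a) := hh.of_uncurry_left
  have h_right (b : β) : Measurable fun a => h a b := hh.of_uncurry_right
  set H : β → ℝ≥0∞ := fun b => (∫⁻ a, h a b ^ 2 ∂μ) ^ (1 / 2 : ℝ)
  have hHm : Measurable H :=
    (Measurable.lintegral_prod_left' (f := fun p : α × β => h p.1 p.2 ^ 2)
      (hm.pow_const 2)).pow_const _
  calc ∫⁻ a, (∫⁻ b, h a b ∂ν) ^ 2 ∂μ
      = ∫⁻ a, ∫⁻ b, ∫⁻ c, h a b * h a c ∂ν ∂ν ∂μ :=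
        lintegral_congr fun a => sq_lintegral_eq_lintegral_lintegral (h_left a)
    _ = ∫⁻ b, ∫⁻ a, ∫⁻ c, h a b * h a c ∂ν ∂μ ∂ν := by
        refine lintegral_lintegral_swap (Measurable.aemeasurable ?_)
        refine Measurable.lintegral_prod_right' (f := fun q : (α × β) × β =>
          h q.1.1 q.1.2 * h q.1.1 q.2) ?_
        exact (hm.comp measurable_fst).mul
          (hm.comp ((measurable_fst.comp measurable_fst).prodMk measurable_snd))
    _ = ∫⁻ b, ∫⁻ c, ∫⁻ a, h a b * h a c ∂μ ∂ν ∂ν :=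
        lintegral_congr fun b => lintegral_lintegral_swap
          (((h_right b).comp measurable_fst).mul hm).aemeasurable
    _ ≤ ∫⁻ b, ∫⁻ c, H b * H c ∂ν ∂ν :=
        lintegral_mono fun b => lintegral_mono fun c =>
          lintegral_mul_le_sqrt (h_right b).aemeasurable (h_right c).aemeasurable
    _ = (∫⁻ b, H b ∂ν) ^ 2 := (sq_lintegral_eq_lintegral_lintegral hHm).symm

/-! ### Quadratic interpolation -/

theorem exists_rpow_eq_lintegral {θ : ℝ} (hθ : θ ∈ Ioo (0 : ℝ) 1) :
    ∃ c : ℝ≥0∞, ∀ x : ℝ, 0 ≤ x → ENNReal.ofReal (x ^ θ)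
      = c * ∫⁻ t in Ioi (0 : ℝ), ENNReal.ofReal (t ^ (θ - 1)) * ENNReal.ofReal (x / (x + t)) := by
  refine ⟨ENNReal.ofReal (∫ t in Ioi 0, Real.rpowIntegrand₀₁ θ t 1)⁻¹, fun x hx => ?_⟩
  have hpos := Real.integral_rpowIntegrand₀₁_one_pos hθ
  rw [Real.rpow_eq_const_mul_integral hθ hx, ENNReal.ofReal_mul (by positivity),
    ofReal_integral_eq_lintegral_ofReal (Real.integrableOn_rpowIntegrand₀₁_Ioi hθ hx)]
  · congr 1
    refine setLIntegral_congr_fun measurableSet_Ioi fun t ht => ?_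
    have ht' : (0 : ℝ) < t := ht
    rw [Real.rpowIntegrand₀₁_eq_pow_div hθ ht'.le hx, ← ENNReal.ofReal_mul (by positivity),
      mul_div_assoc, add_comm x t]
  · filter_upwards [ae_restrict_mem measurableSet_Ioi] with t ht
    exact Real.rpowIntegrand₀₁_nonneg hθ.1 (le_of_lt ht) hx

theorem measurable_div_add_mul_sq {R : α → ℝ} {u : α → ℂ} (hR : Measurable R)
    (hu : Measurable u) :
    Measurable fun p : ℝ × α => ENNReal.ofReal (R p.2 / (R p.2 + p.1)) * ‖u p.2‖ₑ ^ 2 := by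
  fun_prop

theorem lintegral_rpow_mul_sq_eq [SFinite μ] {θ : ℝ} {c : ℝ≥0∞}
    (hc : ∀ x : ℝ, 0 ≤ x → ENNReal.ofReal (x ^ θ)
      = c * ∫⁻ t in Ioi (0 : ℝ), ENNReal.ofReal (t ^ (θ - 1)) * ENNReal.ofReal (x / (x + t)))
    {R : α → ℝ} {u : α → ℂ} (hR : Measurable R) (hR0 : ∀ x, 0 < R x) (hu : Measurable u) :
    ∫⁻ a, ENNReal.ofReal (R a ^ θ) * ‖u a‖ₑ ^ 2 ∂μ
      = c * ∫⁻ t in Ioi (0 : ℝ), ENNReal.ofReal (t ^ (θ - 1)) *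
        ∫⁻ a, ENNReal.ofReal (R a / (R a + t)) * ‖u a‖ₑ ^ 2 ∂μ := by
  have hm : Measurable fun p : ℝ × α => ENNReal.ofReal (p.1 ^ (θ - 1)) *
      (ENNReal.ofReal (R p.2 / (R p.2 + p.1)) * ‖u p.2‖ₑ ^ 2) :=
    ((measurable_fst.pow_const _).ennreal_ofReal).mul (measurable_div_add_mul_sq hR hu)
  have pointwise (a : α) : ENNReal.ofReal (R a ^ θ) * ‖u a‖ₑ ^ 2
      = c * ∫⁻ t in Ioi (0 : ℝ), ENNReal.ofReal (t ^ (θ - 1)) *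
        (ENNReal.ofReal (R a / (R a + t)) * ‖u a‖ₑ ^ 2) := by
    rw [hc _ (hR0 a).le, mul_assoc, ← lintegral_mul_const _ (by fun_prop)]
    simp_rw [mul_assoc]
  simp_rw [pointwise]
  rw [lintegral_const_mul, lintegral_lintegral_swap]
  · congr 1
    exact lintegral_congr fun t => lintegral_const_mul' _ _ ENNReal.ofReal_ne_top
  · exact (hm.comp measurable_swap).aemeasurable
  · exact Measurable.lintegral_prod_left' (μ := volume.restrict (Ioi (0 : ℝ))) hm

theorem lintegral_rpow_mul_sq_le_of_div_add [SFinite μ] [SFinite ν] {θ : ℝ}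
    (hθ : θ ∈ Ioo (0 : ℝ) 1) {P : α → ℝ} {Q : β → ℝ} (hPm : Measurable P) (hQm : Measurable Q)
    (hP : ∀ a, 0 < P a) (hQ : ∀ b, 0 < Q b) {U : α → ℂ} (hU : Measurable U) {f : β → ℂ}
    (hf : Measurable f) {K : ℝ≥0∞}
    (h : ∀ t : ℝ, 0 < t → ∫⁻ a, ENNReal.ofReal (P a / (P a + t)) * ‖U a‖ₑ ^ 2 ∂μ
      ≤ K * ∫⁻ b, ENNReal.ofReal (Q b / (Q b + t)) * ‖f b‖ₑ ^ 2 ∂ν) :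
    ∫⁻ a, ENNReal.ofReal (P a ^ θ) * ‖U a‖ₑ ^ 2 ∂μ
      ≤ K * ∫⁻ b, ENNReal.ofReal (Q b ^ θ) * ‖f b‖ₑ ^ 2 ∂ν := by
  obtain ⟨c, hc⟩ := exists_rpow_eq_lintegral hθ
  have hm : Measurable fun t : ℝ => ∫⁻ b, ENNReal.ofReal (Q b / (Q b + t)) * ‖f b‖ₑ ^ 2 ∂ν :=
    (measurable_div_add_mul_sq hQm hf).lintegral_prod_right'
  rw [lintegral_rpow_mul_sq_eq hc hPm hP hU, lintegral_rpow_mul_sq_eq hc hQm hQ hf,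
    mul_left_comm K, ← lintegral_const_mul _ (Measurable.fun_mul (by fun_prop) hm)]
  refine mul_le_mul_right (lintegral_mono_ae ?_) c
  filter_upwards [ae_restrict_mem measurableSet_Ioi] with t ht
  rw [mul_left_comm]
  exact mul_le_mul_right (h t ht) _

theorem div_add_mul_enorm_add_sq_le {E : Type*} [SeminormedAddGroup E] {a b : E} {P t : ℝ}
    (hP : 0 < P) (ht : 0 < t) :
    ENNReal.ofReal (P / (P + t)) * ‖a + b‖ₑ ^ 2
      ≤ ‖a‖ₑ ^ 2 + ENNReal.ofReal t⁻¹ * (ENNReal.ofReal P * ‖b‖ₑ ^ 2) := by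
  simp only [enorm_sq_eq_ofReal]
  rw [← ENNReal.ofReal_mul (by positivity), ← ENNReal.ofReal_mul (by positivity),
    ← ENNReal.ofReal_mul (by positivity), ← ENNReal.ofReal_add (by positivity) (by positivity)]
  refine ENNReal.ofReal_le_ofReal ?_
  calc P / (P + t) * ‖a + b‖ ^ 2 ≤ P / (P + t) * (‖a‖ + ‖b‖) ^ 2 := by
        gcongr
        exact norm_add_le a b
    _ ≤ ‖a‖ ^ 2 + t⁻¹ * (P * ‖b‖ ^ 2) := by
        rw [div_mul_eq_mul_div, div_le_iff₀ (by positivity)]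
        have : (‖a‖ ^ 2 + t⁻¹ * (P * ‖b‖ ^ 2)) * (P + t) - P * (‖a‖ + ‖b‖) ^ 2
            = t⁻¹ * (t * ‖a‖ - P * ‖b‖) ^ 2 := by
          field_simp
          ring
        nlinarith [mul_nonneg (inv_nonneg.2 ht.le) (sq_nonneg (t * ‖a‖ - P * ‖b‖))]

theorem enorm_div_add_mul_sq_add {q t : ℝ} (hq : 0 < q) (ht : 0 < t) (z : ℂ) :
    ‖((q / (q + t) : ℝ) : ℂ) * z‖ₑ ^ 2
        + ENNReal.ofReal t⁻¹ * (ENNReal.ofReal q * ‖((t / (q + t) : ℝ) : ℂ) * z‖ₑ ^ 2)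
      = ENNReal.ofReal (q / (q + t)) * ‖z‖ₑ ^ 2 := by
  simp only [enorm_sq_eq_ofReal, norm_mul, mul_pow, Complex.norm_real, Real.norm_eq_abs, sq_abs]
  rw [← ENNReal.ofReal_mul (by positivity), ← ENNReal.ofReal_mul (by positivity),
    ← ENNReal.ofReal_mul (by positivity), ← ENNReal.ofReal_add (by positivity) (by positivity)]
  congr 1
  field_simp

theorem lintegral_div_add_mul_sq_le_of_decomposition {P : α → ℝ} {Q : β → ℝ} (hQm : Measurable Q)
    (hP : ∀ a, 0 < P a) (hQ : ∀ b, 0 < Q b) {U U₀ U₁ : α → ℂ} (hU₀ : Measurable U₀)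
    (hU : ∀ᵐ a ∂μ, U a = U₀ a + U₁ a) {f : β → ℂ} (hf : Measurable f) {K : ℝ≥0∞} {t : ℝ}
    (ht : 0 < t)
    (h₀ : ∫⁻ a, ‖U₀ a‖ₑ ^ 2 ∂μ ≤ K * ∫⁻ b, ‖((Q b / (Q b + t) : ℝ) : ℂ) * f b‖ₑ ^ 2 ∂ν)
    (h₁ : ∫⁻ a, ENNReal.ofReal (P a) * ‖U₁ a‖ₑ ^ 2 ∂μ
      ≤ K * ∫⁻ b, ENNReal.ofReal (Q b) * ‖((t / (Q b + t) : ℝ) : ℂ) * f b‖ₑ ^ 2 ∂ν) :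
    ∫⁻ a, ENNReal.ofReal (P a / (P a + t)) * ‖U a‖ₑ ^ 2 ∂μ
      ≤ K * ∫⁻ b, ENNReal.ofReal (Q b / (Q b + t)) * ‖f b‖ₑ ^ 2 ∂ν :=
  calc ∫⁻ a, ENNReal.ofReal (P a / (P a + t)) * ‖U a‖ₑ ^ 2 ∂μ
      ≤ ∫⁻ a, ‖U₀ a‖ₑ ^ 2 + ENNReal.ofReal t⁻¹ * (ENNReal.ofReal (P a) * ‖U₁ a‖ₑ ^ 2) ∂μ := by
        refine lintegral_mono_ae ?_
        filter_upwards [hU] with a ha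
        rw [ha]
        exact div_add_mul_enorm_add_sq_le (hP a) ht
    _ = ∫⁻ a, ‖U₀ a‖ₑ ^ 2 ∂μ
        + ENNReal.ofReal t⁻¹ * ∫⁻ a, ENNReal.ofReal (P a) * ‖U₁ a‖ₑ ^ 2 ∂μ := by
        rw [lintegral_add_left (by fun_prop), lintegral_const_mul' _ _ ENNReal.ofReal_ne_top]
    _ ≤ K * ∫⁻ b, ‖((Q b / (Q b + t) : ℝ) : ℂ) * f b‖ₑ ^ 2 ∂ν + ENNReal.ofReal t⁻¹ *
        (K * ∫⁻ b, ENNReal.ofReal (Q b) * ‖((t / (Q b + t) : ℝ) : ℂ) * f b‖ₑ ^ 2 ∂ν) := by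
        gcongr
    _ = K * ∫⁻ b, ‖((Q b / (Q b + t) : ℝ) : ℂ) * f b‖ₑ ^ 2 + ENNReal.ofReal t⁻¹ *
        (ENNReal.ofReal (Q b) * ‖((t / (Q b + t) : ℝ) : ℂ) * f b‖ₑ ^ 2) ∂ν := by
        rw [lintegral_add_left (by fun_prop), lintegral_const_mul' _ _ ENNReal.ofReal_ne_top]
        ring
    _ = K * ∫⁻ b, ENNReal.ofReal (Q b / (Q b + t)) * ‖f b‖ₑ ^ 2 ∂ν := by
        simp_rw [enorm_div_add_mul_sq_add (hQ _) ht]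

/-- `U = U₀ + U₁` stands for the image under a linear operator, bounded from `L²(ν)` to `L²(μ)` and
from `L²(Q ν)` to `L²(P μ)`, of the decomposition `f = Q / (Q + t) f + t / (Q + t) f`. -/
theorem lintegral_rpow_mul_sq_le_of_decomposition [SFinite μ] [SFinite ν] {θ : ℝ}
    (hθ : θ ∈ Ioo (0 : ℝ) 1) {P : α → ℝ} {Q : β → ℝ} (hPm : Measurable P) (hQm : Measurable Q)
    (hP : ∀ a, 0 < P a) (hQ : ∀ b, 0 < Q b) {U : α → ℂ} (hU : Measurable U) {f : β → ℂ}
    (hf : Measurable f) {K : ℝ≥0∞}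
    (h : ∀ t : ℝ, 0 < t → ∃ U₀ U₁ : α → ℂ, Measurable U₀ ∧ (∀ᵐ a ∂μ, U a = U₀ a + U₁ a) ∧
      ∫⁻ a, ‖U₀ a‖ₑ ^ 2 ∂μ ≤ K * ∫⁻ b, ‖((Q b / (Q b + t) : ℝ) : ℂ) * f b‖ₑ ^ 2 ∂ν ∧
      ∫⁻ a, ENNReal.ofReal (P a) * ‖U₁ a‖ₑ ^ 2 ∂μ
        ≤ K * ∫⁻ b, ENNReal.ofReal (Q b) * ‖((t / (Q b + t) : ℝ) : ℂ) * f b‖ₑ ^ 2 ∂ν) :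
    ∫⁻ a, ENNReal.ofReal (P a ^ θ) * ‖U a‖ₑ ^ 2 ∂μ
      ≤ K * ∫⁻ b, ENNReal.ofReal (Q b ^ θ) * ‖f b‖ₑ ^ 2 ∂ν := by
  refine lintegral_rpow_mul_sq_le_of_div_add hθ hPm hQm hP hQ hU hf fun t ht => ?_
  obtain ⟨U₀, U₁, hU₀, hU, h₀, h₁⟩ := h t ht
  exact lintegral_div_add_mul_sq_le_of_decomposition hQm hP hQ hU₀ hU hf ht h₀ h₁

end Measure

/-! ### The dispersion relation as a change of variables -/

theorem omega_nonneg (k : ℝ) : 0 ≤ omega k := by unfold omega; positivity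

theorem omega_pos {k : ℝ} (hk : k ≠ 0) : 0 < omega k := by
  have := abs_pos.2 hk
  unfold omega
  positivity

theorem omega_sq (k : ℝ) : omega k ^ 2 = k ^ 2 * (1 + k ^ 2) := by
  rw [omega, mul_pow, sq_abs, Real.sq_sqrt (by positivity)]

theorem omega_neg (k : ℝ) : omega (-k) = omega k := by simp [omega]

@[fun_prop]
theorem continuous_omega : Continuous omega := by unfold omega; fun_prop

theorem weight_half (k : ℝ) : weight (1 / 2) k = Real.sqrt (1 + k ^ 2) := by
  rw [weight, Real.sqrt_eq_rpow]

theorem weight_neg_right (a k : ℝ) : weight a (-k) = weight a k := by simp [weight]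

theorem hasDerivAt_omega {k : ℝ} (hk : 0 < k) :
    HasDerivAt omega (Real.sqrt (1 + k ^ 2) + k * (k / Real.sqrt (1 + k ^ 2))) k := by
  have h_one_add_sq : HasDerivAt (fun x : ℝ => 1 + x ^ 2) (2 * k) k := by
    simpa using (hasDerivAt_pow 2 k).const_add 1
  have h_eq : omega =ᶠ[nhds k] fun x : ℝ => x * Real.sqrt (1 + x ^ 2) := by
    filter_upwards [lt_mem_nhds hk] with x hx
    rw [omega, abs_of_pos hx]
  refine (((hasDerivAt_id k).mul (h_one_add_sq.sqrt (by positivity))).congr_of_eventuallyEq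
    h_eq).congr_deriv ?_
  simp only [id_eq, one_mul]
  congr 2
  field_simp

theorem weight_half_le_deriv_omega {k : ℝ} (hk : 0 < k) : weight (1 / 2) k ≤ deriv omega k := by
  rw [weight_half, (hasDerivAt_omega hk).deriv]
  exact le_add_of_nonneg_right (by positivity)

theorem strictMonoOn_omega : StrictMonoOn omega (Ioi 0) :=
  strictMonoOn_of_deriv_pos (convex_Ioi 0) continuous_omega.continuousOn fun _ hk =>
    (weight_pos _ _).trans_le (weight_half_le_deriv_omega (interior_subset hk))

theorem setLIntegral_Ioi_comp_omega_le (G : ℝ → ℝ≥0∞) :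
    ∫⁻ k in Ioi 0, ENNReal.ofReal (weight (1 / 2) k) * G (omega k) ≤ ∫⁻ τ, G τ :=
  calc ∫⁻ k in Ioi 0, ENNReal.ofReal (weight (1 / 2) k) * G (omega k)
      ≤ ∫⁻ k in Ioi 0, ENNReal.ofReal |deriv omega k| * G (omega k) :=
        setLIntegral_mono' measurableSet_Ioi fun _ hk => mul_le_mul_left
          (ENNReal.ofReal_le_ofReal ((weight_half_le_deriv_omega hk).trans (le_abs_self _))) _
    _ = ∫⁻ τ in omega '' Ioi 0, G τ :=
        (lintegral_image_eq_lintegral_abs_deriv_mul measurableSet_Ioi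
          (fun _ hk => (hasDerivAt_omega hk).differentiableAt.hasDerivAt.hasDerivWithinAt)
          strictMonoOn_omega.injOn G).symm
    _ ≤ ∫⁻ τ, G τ := setLIntegral_le_lintegral _ _

theorem lintegral_comp_omega_le (G : ℝ → ℝ≥0∞) :
    ∫⁻ k, ENNReal.ofReal (weight (1 / 2) k) * G (omega k) ≤ 2 * ∫⁻ τ, G τ := by
  have hneg : ∫⁻ k in Iic 0, ENNReal.ofReal (weight (1 / 2) k) * G (omega k) ≤ ∫⁻ τ, G τ := by
    rw [← (Measure.measurePreserving_neg (volume : Measure ℝ)).setLIntegral_comp_preimage_emb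
      (MeasurableEquiv.neg ℝ).measurableEmbedding]
    simp only [weight_neg_right, omega_neg, Set.neg_preimage, Set.neg_Iic, neg_zero]
    rw [setLIntegral_congr Ioi_ae_eq_Ici.symm]
    exact setLIntegral_Ioi_comp_omega_le G
  rw [← lintegral_add_compl _ (measurableSet_Ioi (a := (0 : ℝ))), compl_Ioi, two_mul]
  exact add_le_add (setLIntegral_Ioi_comp_omega_le G) hneg

theorem enorm_add_sq_le {E : Type*} [SeminormedAddGroup E] (z w : E) :
    ‖z + w‖ₑ ^ 2 ≤ 2 * (‖z‖ₑ ^ 2 + ‖w‖ₑ ^ 2) := by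
  simp only [enorm_sq_eq_ofReal]
  rw [← ENNReal.ofReal_add (by positivity) (by positivity), ← ENNReal.ofReal_ofNat,
    ← ENNReal.ofReal_mul (by positivity)]
  refine ENNReal.ofReal_le_ofReal ((pow_le_pow_left₀ (norm_nonneg _) (norm_add_le z w) 2).trans ?_)
  exact add_sq_le

theorem energy_add_le (a : ℝ) {u : ℝ → ℂ} (hu : Measurable u) (v : ℝ → ℂ) :
    energy a (fun k => u k + v k) ≤ 2 * (energy a u + energy a v) :=
  calc energy a (fun k => u k + v k)
      ≤ ∫⁻ k, 2 * (ENNReal.ofReal (weight a k) * ‖u k‖ₑ ^ 2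
          + ENNReal.ofReal (weight a k) * ‖v k‖ₑ ^ 2) := by
        refine lintegral_mono fun k => ?_
        rw [← mul_add, mul_left_comm]
        gcongr
        exact enorm_add_sq_le _ _
    _ = 2 * (energy a u + energy a v) := by
        rw [lintegral_const_mul' _ _ ENNReal.ofNat_ne_top, lintegral_add_left (by fun_prop), energy,
          energy]

theorem energy_mono_ae {a : ℝ} {u v : ℝ → ℂ} (h : ∀ᵐ k, ‖u k‖ ≤ ‖v k‖) :
    energy a u ≤ energy a v := by
  refine lintegral_mono_ae (h.mono fun k hk => ?_)
  have := enorm_le_iff_norm_le.2 hk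
  gcongr

theorem energy_congr_ae {a : ℝ} {u v : ℝ → ℂ} (h : u =ᵐ[volume] v) : energy a u = energy a v :=
  lintegral_congr_ae (h.mono fun k hk => by simp only [hk])

theorem energy_const_mul (a : ℝ) (c : ℂ) (u : ℝ → ℂ) :
    energy a (fun k => c * u k) = ‖c‖ₑ ^ 2 * energy a u := by
  simp only [energy, enorm_mul, mul_pow, mul_left_comm _ (‖c‖ₑ ^ 2)]
  exact lintegral_const_mul' _ _ (by finiteness)

theorem energy_neg (a : ℝ) (u : ℝ → ℂ) : energy a (fun k => -u k) = energy a u := by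
  simp only [energy, enorm_neg]

theorem energy_const (a : ℝ) (z : ℂ) :
    energy a (fun _ => z) = (∫⁻ k, ENNReal.ofReal (weight a k)) * ‖z‖ₑ ^ 2 :=
  lintegral_mul_const _ (by fun_prop)

theorem lintegral_weight_lt_top {a : ℝ} (ha : a ≤ -1) : ∫⁻ k, ENNReal.ofReal (weight a k) < ∞ := by
  refine lt_of_le_of_lt (lintegral_mono fun k => ENNReal.ofReal_le_ofReal ?_)
    integrable_inv_one_add_sq.lintegral_lt_top
  exact (weight_mono ha k).trans_eq (by rw [weight, Real.rpow_neg_one])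

theorem weight_two (k : ℝ) : weight 2 k = (1 + k ^ 2) ^ 2 := Real.rpow_ofNat _ 2

theorem one_add_omega_sq_le_weight_two (k : ℝ) : 1 + omega k ^ 2 ≤ weight 2 k := by
  rw [omega_sq, weight_two]
  nlinarith [sq_nonneg k]

theorem weight_two_le_omega_sq_add (k : ℝ) : weight 2 k ≤ 4 * omega k ^ 2 + weight (-2) k := by
  have h_neg : weight (-2) k * (1 + k ^ 2) ^ 2 = 1 := by
    rw [← weight_two, ← weight_add, neg_add_cancel, weight_zero]
  have hk : 0 < (1 + k ^ 2) ^ 2 := by positivity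
  rw [weight_two, omega_sq, ← sub_nonneg]
  refine nonneg_of_mul_nonneg_left ?_ hk
  have h_factor : (4 * (k ^ 2 * (1 + k ^ 2)) + weight (-2) k - (1 + k ^ 2) ^ 2) * (1 + k ^ 2) ^ 2
      = (k ^ 2) ^ 2 * (3 * (1 + k ^ 2) ^ 2 + 2 * (1 + k ^ 2) + 1) := by
    linear_combination h_neg
  rw [h_factor]
  positivity

theorem energy_one_add_omega_sq_mul_le (a : ℝ) (u : ℝ → ℂ) :
    energy a (fun k => (1 + omega k ^ 2) * u k) ≤ energy (a + 4) u := by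
  have h_energy := energy_weight_mul a 2 u
  rw [show a + 2 * 2 = a + 4 by ring] at h_energy
  rw [← h_energy]
  refine energy_mono_ae (.of_forall fun k => ?_)
  rw [norm_mul, norm_mul, ← ofReal_pow, ← ofReal_one, ← ofReal_add, norm_real, norm_real,
    Real.norm_of_nonneg (by positivity), Real.norm_of_nonneg (weight_pos _ _).le]
  gcongr
  exact one_add_omega_sq_le_weight_two k

theorem energy_add_two_le (a : ℝ) {u : ℝ → ℂ} (hu : Measurable u) :
    energy (a + 2) u ≤ 4 * energy a (fun k => omega k * u k) + energy (a - 2) u := by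
  unfold energy
  rw [← lintegral_const_mul' _ _ ENNReal.ofNat_ne_top, ← lintegral_add_left (by fun_prop)]
  refine lintegral_mono fun k => ?_
  simp only [enorm_sq_eq_ofReal, norm_mul, mul_pow, norm_real, Real.norm_eq_abs, sq_abs]
  have := (weight_pos (a + 2) k).le
  have := (weight_pos (a - 2) k).le
  have := (weight_pos a k).le
  rw [← ENNReal.ofReal_mul (by positivity), ← ENNReal.ofReal_mul (by positivity),
    ← ENNReal.ofReal_mul (by positivity), ← ENNReal.ofReal_ofNat,
    ← ENNReal.ofReal_mul (by positivity), ← ENNReal.ofReal_add (by positivity) (by positivity)]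
  refine ENNReal.ofReal_le_ofReal ?_
  rw [weight_add, sub_eq_add_neg a 2, weight_add]
  calc weight a k * weight 2 k * ‖u k‖ ^ 2
      ≤ weight a k * (4 * omega k ^ 2 + weight (-2) k) * ‖u k‖ ^ 2 := by
        gcongr
        exact weight_two_le_omega_sq_add k
    _ = _ := by ring

/-! ### Oscillatory integrals over an interval -/

/-- The kernel `sin(ωτ) / ω` of the forced problem, with value `0` instead of `τ` at `k = 0`. -/
def sineKernel (k τ : ℝ) : ℝ := Real.sin (omega k * τ) / omega k

/-- `∫_a^b sin(ω(t - a)) / ω ψ(t) dt` as a function of the frequency `k`. -/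
def sineTransform (ψ : ℝ → ℂ) (a b k : ℝ) : ℂ :=
  ∫ t in Ioc a b, (sineKernel k (t - a) : ℂ) * ψ t

/-- `∫_a^b cos(ω(t - a)) ψ(t) dt` as a function of the frequency `k`. -/
def cosineTransform (ψ : ℝ → ℂ) (a b k : ℝ) : ℂ :=
  ∫ t in Ioc a b, (Real.cos (omega k * (t - a)) : ℂ) * ψ t

@[fun_prop]
theorem measurable_sineKernel : Measurable fun p : ℝ × ℝ => sineKernel p.1 p.2 := by
  unfold sineKernel
  fun_prop

@[fun_prop]
theorem continuous_sineKernel (k : ℝ) : Continuous (sineKernel k) := by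
  unfold sineKernel
  fun_prop

theorem omega_mul_sineKernel (k τ : ℝ) : omega k * sineKernel k τ = Real.sin (omega k * τ) := by
  rcases eq_or_ne k 0 with rfl | hk
  · simp [sineKernel, omega]
  · exact mul_div_cancel₀ _ (omega_pos hk).ne'

theorem abs_sineKernel_le (k τ : ℝ) : |sineKernel k τ| ≤ |τ| := by
  rcases eq_or_ne k 0 with rfl | hk
  · simp [sineKernel, omega]
  rw [sineKernel, abs_div, div_le_iff₀ (abs_pos.2 (omega_pos hk).ne'), ← abs_mul, mul_comm τ]
  exact Real.abs_sin_le_abs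

theorem abs_sineKernel_le_inv (k τ : ℝ) : |sineKernel k τ| ≤ (omega k)⁻¹ := by
  rw [sineKernel, abs_div, abs_of_nonneg (omega_nonneg k), div_eq_mul_inv]
  exact mul_le_of_le_one_left (inv_nonneg.2 (omega_nonneg k)) (Real.abs_sin_le_one _)

theorem measurable_sineTransform {ψ : ℝ → ℂ} (hψ : Measurable ψ) (b : ℝ) :
    Measurable fun p : ℝ × ℝ => sineTransform ψ p.1 b p.2 := by
  have : Measurable fun q : (ℝ × ℝ) × ℝ => sineKernel q.1.2 (q.2 - q.1.1) :=
    measurable_sineKernel.comp (f := fun q : (ℝ × ℝ) × ℝ => (q.1.2, q.2 - q.1.1)) (by fun_prop)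
  have h_set : MeasurableSet {q : (ℝ × ℝ) × ℝ | q.1.1 < q.2 ∧ q.2 ≤ b} :=
    (measurableSet_lt (by fun_prop) measurable_snd).inter
      (measurableSet_le measurable_snd measurable_const)
  have h_integrand : Measurable fun q : (ℝ × ℝ) × ℝ =>
      (Ioc q.1.1 b).indicator (fun t => (sineKernel q.1.2 (t - q.1.1) : ℂ) * ψ t) q.2 :=
    Measurable.indicator (by fun_prop) h_set
  simp only [sineTransform, ← integral_indicator measurableSet_Ioc]
  exact h_integrand.stronglyMeasurable.integral_prod_right.measurable

theorem measurable_sineTransform_right {ψ : ℝ → ℂ} (hψ : Measurable ψ) (a b : ℝ) :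
    Measurable (sineTransform ψ a b) :=
  (measurable_sineTransform hψ b).comp measurable_prodMk_left

theorem sineTransform_add {p q : ℝ → ℂ} (hp : Continuous p) (hq : Continuous q) (a b k : ℝ) :
    sineTransform (fun t => p t + q t) a b k = sineTransform p a b k + sineTransform q a b k := by
  simp only [sineTransform, mul_add]
  exact integral_add (Continuous.integrableOn_Ioc (by fun_prop))
    (Continuous.integrableOn_Ioc (by fun_prop))

theorem sineTransform_neg (p : ℝ → ℂ) (a b k : ℝ) :
    sineTransform (fun t => -p t) a b k = -sineTransform p a b k := by
  simp only [sineTransform, mul_neg, integral_neg]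

theorem cosineTransform_add {p q : ℝ → ℂ} (hp : Continuous p) (hq : Continuous q) (a b k : ℝ) :
    cosineTransform (fun t => p t + q t) a b k
      = cosineTransform p a b k + cosineTransform q a b k := by
  simp only [cosineTransform, mul_add]
  exact integral_add (Continuous.integrableOn_Ioc (by fun_prop))
    (Continuous.integrableOn_Ioc (by fun_prop))

theorem memLp_indicator_Ioc {E : Type*} [NormedAddCommGroup E] {ψ : ℝ → E} (hψ : Continuous ψ)
    (a b : ℝ) (p : ℝ≥0∞) : MemLp ((Ioc a b).indicator ψ) p := by
  rw [memLp_indicator_iff_restrict measurableSet_Ioc]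
  obtain ⟨C, hC⟩ := isCompact_Icc.exists_bound_of_continuousOn (s := Icc a b) hψ.continuousOn
  refine MemLp.of_bound hψ.aestronglyMeasurable C ?_
  filter_upwards [ae_restrict_mem measurableSet_Ioc] with t ht
  exact hC t (Ioc_subset_Icc_self ht)

theorem cexp_mul_hat_indicator_Ioc (ψ : ℝ → ℂ) (a b τ : ℝ) :
    cexp (I * τ * a) * hat ((Ioc a b).indicator ψ) τ
      = ∫ t in Ioc a b, cexp (-(I * τ * (t - a))) * ψ t := by
  have h_hat : hat ((Ioc a b).indicator ψ) τ = ∫ t in Ioc a b, cexp (-(I * τ * t)) * ψ t := by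
    rw [hat, ← integral_indicator measurableSet_Ioc]
    refine integral_congr_ae (.of_forall fun t => ?_)
    by_cases ht : t ∈ Ioc a b <;> simp [ht]
  rw [h_hat, ← integral_const_mul]
  simp_rw [← mul_assoc (cexp _), ← Complex.exp_add]
  congr! 4
  ring

theorem lintegral_hat_indicator_Ioc_sq {ψ : ℝ → ℂ} (hψ : Continuous ψ) (a b : ℝ) :
    ∫⁻ τ, ‖hat ((Ioc a b).indicator ψ) τ‖ₑ ^ 2
      = ENNReal.ofReal (2 * Real.pi) * ∫⁻ t in Ioc a b, ‖ψ t‖ₑ ^ 2 := by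
  rw [lintegral_hat_sq (memLp_one_iff_integrable.1 (memLp_indicator_Ioc hψ a b 1))
    (memLp_indicator_Ioc hψ a b 2), ← lintegral_indicator measurableSet_Ioc]
  congr 1
  refine lintegral_congr fun t => ?_
  by_cases ht : t ∈ Ioc a b <;> simp [ht]

theorem cosineTransform_eq_hat {ψ : ℝ → ℂ} (hψ : Continuous ψ) (a b k : ℝ) :
    cosineTransform ψ a b k = 1 / 2 * cexp (I * omega k * a) * hat ((Ioc a b).indicator ψ) (omega k)
      + 1 / 2 * cexp (I * (-omega k : ℝ) * a) * hat ((Ioc a b).indicator ψ) (-omega k) := by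
  rw [mul_assoc (1 / 2), mul_assoc (1 / 2), cexp_mul_hat_indicator_Ioc, cexp_mul_hat_indicator_Ioc,
    ← integral_const_mul, ← integral_const_mul, ← integral_add, cosineTransform]
  · refine integral_congr_ae (.of_forall fun t => ?_)
    push_cast
    rw [Complex.cos]
    ring_nf
  all_goals exact Continuous.integrableOn_Ioc (by fun_prop)

theorem omega_mul_sineTransform_eq_hat {ψ : ℝ → ℂ} (hψ : Continuous ψ) (a b k : ℝ) :
    omega k * sineTransform ψ a b k
      = I / 2 * cexp (I * omega k * a) * hat ((Ioc a b).indicator ψ) (omega k)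
        + -I / 2 * cexp (I * (-omega k : ℝ) * a) * hat ((Ioc a b).indicator ψ) (-omega k) := by
  rw [mul_assoc (I / 2), mul_assoc (-I / 2), cexp_mul_hat_indicator_Ioc, cexp_mul_hat_indicator_Ioc,
    sineTransform, ← integral_const_mul, ← integral_const_mul, ← integral_const_mul,
    ← integral_add]
  · refine integral_congr_ae (.of_forall fun t => ?_)
    simp only [← mul_assoc, ← ofReal_mul, omega_mul_sineKernel]
    push_cast
    rw [Complex.sin]
    ring_nf
  all_goals exact Continuous.integrableOn_Ioc (by fun_prop)

theorem norm_cexp_I_mul (x y : ℝ) : ‖cexp (I * x * y)‖ = 1 := by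
  rw [mul_assoc, ← ofReal_mul, Complex.norm_exp_I_mul_ofReal]

/-- The change of variables `τ = ω(k)` turns Plancherel in `t` into a bound with a gain of
`(1 + k²)^{1/4}`. -/
theorem energy_half_le_of_eq_hat {ψ : ℝ → ℂ} (hψ : Continuous ψ) (a b : ℝ) {c₁ c₂ V : ℝ → ℂ}
    (hc₁ : Measurable c₁) (h₁ : ∀ k, ‖c₁ k‖ ≤ 1) (h₂ : ∀ k, ‖c₂ k‖ ≤ 1)
    (hV : ∀ k, V k = c₁ k * hat ((Ioc a b).indicator ψ) (omega k)
      + c₂ k * hat ((Ioc a b).indicator ψ) (-omega k)) :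
    energy (1 / 2) V ≤ ENNReal.ofReal (16 * Real.pi) * ∫⁻ t in Ioc a b, ‖ψ t‖ₑ ^ 2 := by
  have h_sq := lintegral_hat_indicator_Ioc_sq hψ a b
  have h_cont : Continuous (hat ((Ioc a b).indicator ψ)) :=
    continuous_hat (memLp_one_iff_integrable.1 (memLp_indicator_Ioc hψ a b 1))
  set H := hat ((Ioc a b).indicator ψ)
  have h_bound : ∀ {c : ℝ → ℂ} {G : ℝ → ℂ}, (∀ k, ‖c k‖ ≤ 1) →
      energy (1 / 2) (fun k => c k * G (omega k)) ≤ 2 * ∫⁻ τ, ‖G τ‖ₑ ^ 2 := fun {c G} hc =>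
    (energy_mono_ae (.of_forall fun k => by
      rw [norm_mul]; exact mul_le_of_le_one_left (norm_nonneg _) (hc k))).trans
      (lintegral_comp_omega_le fun τ => ‖G τ‖ₑ ^ 2)
  calc energy (1 / 2) V
      ≤ 2 * (energy (1 / 2) (fun k => c₁ k * H (omega k))
          + energy (1 / 2) (fun k => c₂ k * H (-omega k))) := by
        rw [funext hV]
        exact energy_add_le _ (by fun_prop) _
    _ ≤ 2 * (2 * (∫⁻ τ, ‖H τ‖ₑ ^ 2) + 2 * ∫⁻ τ, ‖H (-τ)‖ₑ ^ 2) := by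
        gcongr
        exacts [h_bound h₁, h_bound (G := fun τ => H (-τ)) h₂]
    _ = 8 * (ENNReal.ofReal (2 * Real.pi) * ∫⁻ t in Ioc a b, ‖ψ t‖ₑ ^ 2) := by
        rw [lintegral_neg_eq_self fun τ => ‖H τ‖ₑ ^ 2, h_sq]
        ring
    _ = ENNReal.ofReal (16 * Real.pi) * ∫⁻ t in Ioc a b, ‖ψ t‖ₑ ^ 2 := by
        rw [← mul_assoc, ← ENNReal.ofReal_ofNat, ← ENNReal.ofReal_mul (by positivity)]
        ring_nf

theorem energy_cosineTransform_le {ψ : ℝ → ℂ} (hψ : Continuous ψ) (a b : ℝ) :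
    energy (1 / 2) (cosineTransform ψ a b)
      ≤ ENNReal.ofReal (16 * Real.pi) * ∫⁻ t in Ioc a b, ‖ψ t‖ₑ ^ 2 :=
  energy_half_le_of_eq_hat hψ a b (by fun_prop)
    (fun k => by rw [norm_mul, norm_cexp_I_mul]; norm_num)
    (fun k => by rw [norm_mul, norm_cexp_I_mul]; norm_num) (cosineTransform_eq_hat hψ a b)

theorem energy_omega_mul_sineTransform_le {ψ : ℝ → ℂ} (hψ : Continuous ψ) (a b : ℝ) :
    energy (1 / 2) (fun k => omega k * sineTransform ψ a b k)
      ≤ ENNReal.ofReal (16 * Real.pi) * ∫⁻ t in Ioc a b, ‖ψ t‖ₑ ^ 2 :=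
  energy_half_le_of_eq_hat hψ a b (by fun_prop)
    (fun k => by rw [norm_mul, norm_cexp_I_mul]; norm_num)
    (fun k => by rw [norm_mul, norm_cexp_I_mul]; norm_num) (omega_mul_sineTransform_eq_hat hψ a b)

theorem enorm_sineTransform_sq_le {ψ : ℝ → ℂ} (hψ : Continuous ψ) (a b k : ℝ) :
    ‖sineTransform ψ a b k‖ₑ ^ 2 ≤ ENNReal.ofReal (b - a) ^ 3 * ∫⁻ t in Ioc a b, ‖ψ t‖ₑ ^ 2 := by
  have h_kernel : ∀ t ∈ Ioc a b, ‖(sineKernel k (t - a) : ℂ)‖ₑ ≤ ENNReal.ofReal (b - a) :=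
    fun t ht => by
      rw [← ofReal_norm, norm_real, Real.norm_eq_abs]
      refine ENNReal.ofReal_le_ofReal ((abs_sineKernel_le _ _).trans ?_)
      rw [abs_of_nonneg (by linarith [ht.1])]
      linarith [ht.2]
  calc ‖sineTransform ψ a b k‖ₑ ^ 2
      ≤ (∫⁻ t in Ioc a b, ‖(sineKernel k (t - a) : ℂ) * ψ t‖ₑ) ^ 2 := by
        gcongr
        exact enorm_integral_le_lintegral_enorm _
    _ ≤ (∫⁻ t in Ioc a b, ENNReal.ofReal (b - a) * ‖ψ t‖ₑ) ^ 2 := by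
        gcongr 1
        refine setLIntegral_mono' measurableSet_Ioc fun t ht => ?_
        rw [enorm_mul]
        gcongr
        exact h_kernel t ht
    _ ≤ (∫⁻ _ in Ioc a b, ENNReal.ofReal (b - a) ^ 2) * ∫⁻ t in Ioc a b, ‖ψ t‖ₑ ^ 2 :=
        sq_lintegral_mul_le (by fun_prop) (by fun_prop)
    _ = ENNReal.ofReal (b - a) ^ 3 * ∫⁻ t in Ioc a b, ‖ψ t‖ₑ ^ 2 := by
        rw [setLIntegral_const, Real.volume_Ioc]
        ring

theorem exists_energy_sineTransform_le (b : ℝ) : ∃ K : ℝ≥0, ∀ ψ, Continuous ψ → ∀ a, 0 ≤ a →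
    energy (5 / 2) (sineTransform ψ a b) ≤ K * ∫⁻ t in Ioc a b, ‖ψ t‖ₑ ^ 2 := by
  obtain ⟨D, hD⟩ :=
    ENNReal.lt_iff_exists_coe.1 (lintegral_weight_lt_top (a := -3 / 2) (by norm_num))
  refine ⟨4 * (16 * Real.pi).toNNReal + D * b.toNNReal ^ 3, fun ψ hψ a ha => ?_⟩
  have h_low : energy (-3 / 2) (sineTransform ψ a b)
      ≤ D * (ENNReal.ofReal b ^ 3 * ∫⁻ t in Ioc a b, ‖ψ t‖ₑ ^ 2) := by
    rw [← hD.1, ← lintegral_mul_const _ (by fun_prop)]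
    refine lintegral_mono fun k => ?_
    gcongr
    refine (enorm_sineTransform_sq_le hψ a b k).trans ?_
    gcongr
    linarith
  have h_split := energy_add_two_le (1 / 2) (measurable_sineTransform_right hψ.measurable a b)
  norm_num only at h_split h_low ⊢
  calc _ ≤ _ := h_split
    _ ≤ 4 * (ENNReal.ofReal (16 * Real.pi) * ∫⁻ t in Ioc a b, ‖ψ t‖ₑ ^ 2)
        + D * (ENNReal.ofReal b ^ 3 * ∫⁻ t in Ioc a b, ‖ψ t‖ₑ ^ 2) := by
        gcongr
        exact energy_omega_mul_sineTransform_le hψ a b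
    _ = _ := by
        push_cast [ENNReal.ofReal]
        ring

theorem hasDerivAt_cos_omega_mul (a k t : ℝ) :
    HasDerivAt (fun t => Real.cos (omega k * (t - a)))
      (-(omega k ^ 2 * sineKernel k (t - a))) t := by
  refine (((hasDerivAt_id' t).sub_const a).const_mul (omega k)).cos.congr_deriv ?_
  rw [← omega_mul_sineKernel]
  ring

theorem hasDerivAt_sineKernel {k : ℝ} (hk : k ≠ 0) (τ : ℝ) :
    HasDerivAt (sineKernel k) (Real.cos (omega k * τ)) τ := by
  refine (((hasDerivAt_id' τ).const_mul (omega k)).sin.div_const (omega k)).congr_deriv ?_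
  field_simp [(omega_pos hk).ne']

theorem sineTransform_deriv {p : ℝ → ℂ} (hp : ContDiff ℝ 1 p) {a b k : ℝ} (hab : a ≤ b)
    (hb : p b = 0) (hk : k ≠ 0) : sineTransform (deriv p) a b k = -cosineTransform p a b k := by
  have : Continuous (deriv p) := hp.continuous_deriv le_rfl
  have h_deriv : ∀ t, HasDerivAt (fun t => (sineKernel k (t - a) : ℂ) * p t)
      ((Real.cos (omega k * (t - a)) : ℂ) * p t + (sineKernel k (t - a) : ℂ) * deriv p t) t :=
    fun t => ((hasDerivAt_sineKernel hk (t - a)).comp_sub_const t a).ofReal_comp.mul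
      (hp.differentiable one_ne_zero t).hasDerivAt
  have h_ftc := intervalIntegral.integral_eq_sub_of_hasDerivAt (a := a) (b := b)
    (fun t _ => h_deriv t) (by apply Continuous.intervalIntegrable; fun_prop)
  rw [hb, mul_zero, sub_self, intervalIntegral.integral_of_le hab,
    integral_add (Continuous.integrableOn_Ioc (by fun_prop))
      (Continuous.integrableOn_Ioc (by fun_prop))] at h_ftc
  simp only [sineKernel, mul_zero, Real.sin_zero, zero_div, ofReal_zero, zero_mul,
    sub_zero] at h_ftc
  exact eq_neg_of_add_eq_zero_right h_ftc

theorem cosineTransform_deriv {p : ℝ → ℂ} (hp : ContDiff ℝ 1 p) {a b : ℝ} (hab : a ≤ b)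
    (hb : p b = 0) (k : ℝ) :
    cosineTransform (deriv p) a b k = -p a + omega k ^ 2 * sineTransform p a b k := by
  have : Continuous (deriv p) := hp.continuous_deriv le_rfl
  have h_deriv : ∀ t, HasDerivAt (fun t => (Real.cos (omega k * (t - a)) : ℂ) * p t)
      (-((omega k ^ 2 : ℂ) * ((sineKernel k (t - a) : ℂ) * p t))
        + (Real.cos (omega k * (t - a)) : ℂ) * deriv p t) t := fun t => by
    refine ((hasDerivAt_cos_omega_mul a k t).ofReal_comp.mul
      (hp.differentiable one_ne_zero t).hasDerivAt).congr_deriv ?_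
    push_cast
    ring
  have h_ftc := intervalIntegral.integral_eq_sub_of_hasDerivAt (a := a) (b := b)
    (fun t _ => h_deriv t) (by apply Continuous.intervalIntegrable; fun_prop)
  rw [hb, mul_zero, sub_self, mul_zero, Real.cos_zero, intervalIntegral.integral_of_le hab,
    integral_add (Continuous.integrableOn_Ioc (by fun_prop))
      (Continuous.integrableOn_Ioc (by fun_prop)), integral_neg, integral_const_mul,
    ofReal_one] at h_ftc
  rw [cosineTransform, sineTransform]
  linear_combination h_ftc

section Product

variable {χ ψ : ℝ → ℂ} (hχ : ContDiff ℝ 1 χ) (hψ : ContDiff ℝ 1 ψ) {a b : ℝ} (hab : a ≤ b)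
  (hb : χ b = 0)
include hχ hψ

theorem deriv_mul_eq : deriv (fun t => χ t * ψ t) = fun t => deriv χ t * ψ t + χ t * deriv ψ t :=
  funext fun t => deriv_fun_mul (hχ.differentiable one_ne_zero t) (hψ.differentiable one_ne_zero t)

include hab hb

theorem sineTransform_mul_deriv {k : ℝ} (hk : k ≠ 0) :
    sineTransform (fun t => χ t * deriv ψ t) a b k
      = -cosineTransform (fun t => χ t * ψ t) a b k
        - sineTransform (fun t => deriv χ t * ψ t) a b k := by
  have : Continuous (deriv χ) := hχ.continuous_deriv le_rfl
  have : Continuous (deriv ψ) := hψ.continuous_deriv le_rfl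
  have h_parts := sineTransform_deriv (hχ.mul hψ) hab (by simp [hb]) hk
  rw [deriv_mul_eq hχ hψ, sineTransform_add (by fun_prop) (by fun_prop)] at h_parts
  linear_combination h_parts

theorem cosineTransform_mul_deriv (k : ℝ) :
    cosineTransform (fun t => χ t * deriv ψ t) a b k
      = -(χ a * ψ a) + omega k ^ 2 * sineTransform (fun t => χ t * ψ t) a b k
        - cosineTransform (fun t => deriv χ t * ψ t) a b k := by
  have : Continuous (deriv χ) := hχ.continuous_deriv le_rfl
  have : Continuous (deriv ψ) := hψ.continuous_deriv le_rfl
  have h_parts := cosineTransform_deriv (hχ.mul hψ) hab (by simp [hb]) k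
  rw [deriv_mul_eq hχ hψ, cosineTransform_add (by fun_prop) (by fun_prop)] at h_parts
  linear_combination h_parts

end Product

theorem exists_setLIntegral_mul_sq_le {q : ℝ → ℂ} (hq : Continuous q) (b : ℝ) :
    ∃ K : ℝ≥0, ∀ (ψ : ℝ → ℂ) (a : ℝ), 0 ≤ a →
      ∫⁻ t in Ioc a b, ‖q t * ψ t‖ₑ ^ 2 ≤ K * ∫⁻ t, ‖ψ t‖ₑ ^ 2 := by
  obtain ⟨M, hM⟩ := isCompact_Icc.exists_bound_of_continuousOn (s := Icc 0 b) hq.continuousOn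
  refine ⟨M.toNNReal ^ 2, fun ψ a ha => ?_⟩
  calc ∫⁻ t in Ioc a b, ‖q t * ψ t‖ₑ ^ 2
      ≤ ∫⁻ t in Ioc a b, (M.toNNReal ^ 2 : ℝ≥0) * ‖ψ t‖ₑ ^ 2 := by
        refine setLIntegral_mono' measurableSet_Ioc fun t ht => ?_
        rw [enorm_mul, mul_pow, ENNReal.coe_pow]
        gcongr
        rw [← ofReal_norm]
        exact ENNReal.ofReal_le_ofReal (hM t ⟨ha.trans ht.1.le, ht.2⟩)
    _ ≤ ∫⁻ t, (M.toNNReal ^ 2 : ℝ≥0) * ‖ψ t‖ₑ ^ 2 := setLIntegral_le_lintegral _ _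
    _ = _ := lintegral_const_mul' _ _ ENNReal.coe_ne_top

theorem exists_energy_sineTransform_mul_le {q : ℝ → ℂ} (hq : Continuous q) (b : ℝ) :
    ∃ K : ℝ≥0, ∀ ψ : ℝ → ℂ, Continuous ψ → ∀ a, 0 ≤ a →
      energy (5 / 2) (sineTransform (fun t => q t * ψ t) a b) ≤ K * ∫⁻ t, ‖ψ t‖ₑ ^ 2 := by
  obtain ⟨K, hK⟩ := exists_energy_sineTransform_le b
  obtain ⟨M, hM⟩ := exists_setLIntegral_mul_sq_le hq b
  refine ⟨K * M, fun ψ hψ a ha => (hK _ (hq.mul hψ) a ha).trans ?_⟩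
  rw [ENNReal.coe_mul, mul_assoc]
  gcongr
  exact hM ψ a ha

theorem exists_energy_cosineTransform_mul_le {q : ℝ → ℂ} (hq : Continuous q) (b : ℝ) :
    ∃ K : ℝ≥0, ∀ ψ : ℝ → ℂ, Continuous ψ → ∀ a, 0 ≤ a →
      energy (1 / 2) (cosineTransform (fun t => q t * ψ t) a b) ≤ K * ∫⁻ t, ‖ψ t‖ₑ ^ 2 := by
  obtain ⟨M, hM⟩ := exists_setLIntegral_mul_sq_le hq b
  refine ⟨(16 * Real.pi).toNNReal * M, fun ψ hψ a ha =>
    (energy_cosineTransform_le (hq.mul hψ) a b).trans ?_⟩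
  rw [ENNReal.coe_mul, mul_assoc, ENNReal.ofReal]
  gcongr
  exact hM ψ a ha

/-! ### The transpose of the solution operator -/

/-- A smooth cutoff in time, equal to `1` on `(-∞, T]` and to `0` on `[T + 1, ∞)`. -/
def cutoff (T t : ℝ) : ℂ := (Real.smoothTransition (T + 1 - t) : ℂ)

theorem contDiff_cutoff (T : ℝ) (n : ℕ∞) : ContDiff ℝ n (cutoff T) :=
  ofRealCLM.contDiff.comp (Real.smoothTransition.contDiff.comp (by fun_prop))

@[fun_prop]
theorem continuous_cutoff (T : ℝ) : Continuous (cutoff T) := (contDiff_cutoff T 0).continuous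

theorem contDiff_deriv_cutoff (T : ℝ) (n : ℕ) : ContDiff ℝ n (deriv (cutoff T)) :=
  ((contDiff_succ_iff_deriv (n := n)).1 (contDiff_cutoff T (n + 1))).2.2

theorem cutoff_eq_one {T t : ℝ} (ht : t ≤ T) : cutoff T t = 1 := by
  rw [cutoff, Real.smoothTransition.one_of_one_le (by linarith), ofReal_one]

theorem cutoff_eventuallyEq_zero (T : ℝ) : cutoff T =ᶠ[nhds (T + 2)] fun _ => 0 := by
  filter_upwards [lt_mem_nhds (show T + 1 < T + 2 by linarith)] with t ht
  rw [cutoff, Real.smoothTransition.zero_of_nonpos (by linarith), ofReal_zero]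

theorem cutoff_add_two (T : ℝ) : cutoff T (T + 2) = 0 := (cutoff_eventuallyEq_zero T).eq_of_nhds

theorem deriv_cutoff_add_two (T : ℝ) : deriv (cutoff T) (T + 2) = 0 := by
  rw [(cutoff_eventuallyEq_zero T).deriv_eq, deriv_const]

theorem sineTransform_cutoff_mul_add_deriv {T : ℝ} {ψ : ℝ → ℂ} (hψ : ContDiff ℝ 1 ψ)
    {a k : ℝ} (ha : a ∈ Icc 0 T) (hk : k ≠ 0) :
    sineTransform (fun t => cutoff T t * (ψ t + deriv ψ t)) a (T + 2) k
      = sineTransform (fun t => cutoff T t * ψ t) a (T + 2) k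
        + (-sineTransform (fun t => deriv (cutoff T) t * ψ t) a (T + 2) k
        + -cosineTransform (fun t => cutoff T t * ψ t) a (T + 2) k) := by
  have : Continuous (deriv ψ) := hψ.continuous_deriv le_rfl
  simp only [mul_add]
  rw [sineTransform_add (by fun_prop) (by fun_prop),
    sineTransform_mul_deriv (contDiff_cutoff T 1) hψ (by linarith [ha.2]) (cutoff_add_two T) hk]
  ring

theorem exists_energy_sineTransform_cutoff_mul_add_deriv_le (T : ℝ) :
    ∃ K : ℝ≥0, ∀ ψ : ℝ → ℂ, ContDiff ℝ 1 ψ → ∀ a ∈ Icc 0 T,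
      energy (1 / 2) (sineTransform (fun t => cutoff T t * (ψ t + deriv ψ t)) a (T + 2))
        ≤ K * ∫⁻ t, ‖ψ t‖ₑ ^ 2 := by
  have hχ := contDiff_cutoff T 1
  have hχ' : Continuous (deriv (cutoff T)) := hχ.continuous_deriv le_rfl
  obtain ⟨K₁, hK₁⟩ := exists_energy_sineTransform_mul_le hχ.continuous (T + 2)
  obtain ⟨K₂, hK₂⟩ := exists_energy_cosineTransform_mul_le hχ.continuous (T + 2)
  obtain ⟨K₃, hK₃⟩ := exists_energy_sineTransform_mul_le hχ' (T + 2)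
  refine ⟨2 * (K₁ + 2 * (K₃ + K₂)), fun ψ hψ a ha => ?_⟩
  set S := sineTransform (fun t => cutoff T t * ψ t) a (T + 2)
  set S' := sineTransform (fun t => deriv (cutoff T) t * ψ t) a (T + 2)
  set C := cosineTransform (fun t => cutoff T t * ψ t) a (T + 2)
  have hS : Measurable S :=
    measurable_sineTransform_right (hχ.continuous.mul hψ.continuous).measurable _ _
  have hS' : Measurable S' :=
    measurable_sineTransform_right (hχ'.mul hψ.continuous).measurable _ _
  calc _ = energy (1 / 2) fun k => S k + (-S' k + -C k) := by
        refine energy_congr_ae ?_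
        filter_upwards [Measure.ae_ne volume (0 : ℝ)] with k hk
        exact sineTransform_cutoff_mul_add_deriv hψ ha hk
    _ ≤ 2 * (energy (1 / 2) S + 2 * (energy (1 / 2) S' + energy (1 / 2) C)) := by
        refine (energy_add_le _ hS _).trans ?_
        gcongr
        refine (energy_add_le _ (by fun_prop) _).trans_eq ?_
        rw [energy_neg, energy_neg]
    _ ≤ 2 * (K₁ * (∫⁻ t, ‖ψ t‖ₑ ^ 2)
          + 2 * (K₃ * (∫⁻ t, ‖ψ t‖ₑ ^ 2) + K₂ * ∫⁻ t, ‖ψ t‖ₑ ^ 2)) := by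
        gcongr
        · exact (energy_mono (by norm_num) _).trans (hK₁ ψ hψ.continuous a ha.1)
        · exact (energy_mono (by norm_num) _).trans (hK₃ ψ hψ.continuous a ha.1)
        · exact hK₂ ψ hψ.continuous a ha.1
    _ = _ := by
        push_cast
        ring

theorem sineTransform_cutoff_mul_sub_deriv_deriv {T : ℝ} {ψ : ℝ → ℂ} (hψ : ContDiff ℝ 2 ψ)
    {a k : ℝ} (ha : a ∈ Icc 0 T) (hk : k ≠ 0) :
    sineTransform (fun t => cutoff T t * (ψ t + -deriv (deriv ψ) t)) a (T + 2) k
      = (1 + omega k ^ 2) * sineTransform (fun t => cutoff T t * ψ t) a (T + 2) k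
        + (-sineTransform (fun t => deriv (deriv (cutoff T)) t * ψ t) a (T + 2) k
        + (-ψ a + -2 * cosineTransform (fun t => deriv (cutoff T) t * ψ t) a (T + 2) k)) := by
  have hψ' : ContDiff ℝ 1 (deriv ψ) := ((contDiff_succ_iff_deriv (n := 1)).1 hψ).2.2
  have : Continuous (deriv (deriv ψ)) := hψ'.continuous_deriv le_rfl
  have hψ₁ : ContDiff ℝ 1 ψ := hψ.of_le (by norm_num)
  have hχ := contDiff_cutoff T 1
  have hab : a ≤ T + 2 := by linarith [ha.2]
  simp only [mul_add, mul_neg]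
  rw [sineTransform_add (by fun_prop) (by fun_prop), sineTransform_neg,
    sineTransform_mul_deriv hχ hψ' hab (cutoff_add_two T) hk,
    cosineTransform_mul_deriv hχ hψ₁ hab (cutoff_add_two T),
    sineTransform_mul_deriv (contDiff_deriv_cutoff T 1) hψ₁ hab (deriv_cutoff_add_two T) hk,
    cutoff_eq_one ha.2]
  ring

theorem exists_energy_boundary_add_cutoff_deriv_le (T : ℝ) :
    ∃ K : ℝ≥0, ∀ ψ : ℝ → ℂ, Continuous ψ → ∀ a ∈ Icc 0 T,
      energy (-3 / 2) (fun k =>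
          -sineTransform (fun t => deriv (deriv (cutoff T)) t * ψ t) a (T + 2) k
          + (-ψ a + -2 * cosineTransform (fun t => deriv (cutoff T) t * ψ t) a (T + 2) k))
        ≤ K * ((∫⁻ t, ‖ψ t‖ₑ ^ 2) + ‖ψ a‖ₑ ^ 2) := by
  have hχ' := contDiff_deriv_cutoff T 1
  have hχ'' : Continuous (deriv (deriv (cutoff T))) := hχ'.continuous_deriv le_rfl
  obtain ⟨K₂, hK₂⟩ := exists_energy_sineTransform_mul_le hχ'' (T + 2)
  obtain ⟨K₃, hK₃⟩ := exists_energy_cosineTransform_mul_le hχ'.continuous (T + 2)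
  obtain ⟨D, hD⟩ :=
    ENNReal.lt_iff_exists_coe.1 (lintegral_weight_lt_top (a := -3 / 2) (by norm_num))
  refine ⟨2 * (K₂ + 2 * (D + 4 * K₃)), fun ψ hψ a ha => ?_⟩
  set N := ∫⁻ t, ‖ψ t‖ₑ ^ 2
  set S'' := sineTransform (fun t => deriv (deriv (cutoff T)) t * ψ t) a (T + 2)
  set C := cosineTransform (fun t => deriv (cutoff T) t * ψ t) a (T + 2)
  have hS'' : Measurable S'' := measurable_sineTransform_right (hχ''.mul hψ).measurable _ _
  have h_C : energy (-3 / 2) (fun k => -2 * C k) ≤ 4 * (K₃ * N) := by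
    rw [energy_const_mul, show ‖(-2 : ℂ)‖ₑ ^ 2 = 4 by rw [enorm_sq_eq_ofReal]; norm_num]
    gcongr
    exact (energy_mono (by norm_num) _).trans (hK₃ ψ hψ a ha.1)
  calc _ ≤ 2 * (energy (-3 / 2) (fun k => -S'' k)
          + energy (-3 / 2) (fun k => -ψ a + -2 * C k)) := energy_add_le _ (by fun_prop) _
    _ ≤ 2 * (energy (-3 / 2) S''
          + 2 * (energy (-3 / 2) (fun _ => -ψ a) + energy (-3 / 2) (fun k => -2 * C k))) := by
        rw [energy_neg]
        gcongr
        exact energy_add_le _ measurable_const _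
    _ ≤ 2 * (K₂ * N + 2 * (D * ‖ψ a‖ₑ ^ 2 + 4 * (K₃ * N))) := by
        rw [energy_const, hD.1, enorm_neg]
        gcongr
        exact (energy_mono (by norm_num) _).trans (hK₂ ψ hψ a ha.1)
    _ ≤ 2 * (K₂ * (N + ‖ψ a‖ₑ ^ 2) + 2 * (D * (N + ‖ψ a‖ₑ ^ 2)
          + 4 * (K₃ * (N + ‖ψ a‖ₑ ^ 2)))) := by
        gcongr
        exacts [le_self_add, le_add_self, le_self_add]
    _ = _ := by
        push_cast
        ring

theorem exists_energy_sineTransform_cutoff_mul_sub_deriv_deriv_le (T : ℝ) :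
    ∃ K : ℝ≥0, ∀ ψ : ℝ → ℂ, ContDiff ℝ 2 ψ → ∀ a ∈ Icc 0 T,
      energy (-3 / 2) (sineTransform (fun t => cutoff T t * (ψ t + -deriv (deriv ψ) t)) a (T + 2))
        ≤ K * ((∫⁻ t, ‖ψ t‖ₑ ^ 2) + ‖ψ a‖ₑ ^ 2) := by
  obtain ⟨K₁, hK₁⟩ := exists_energy_sineTransform_mul_le (continuous_cutoff T) (T + 2)
  obtain ⟨K₂, hK₂⟩ := exists_energy_boundary_add_cutoff_deriv_le T
  refine ⟨2 * (K₁ + K₂), fun ψ hψ a ha => ?_⟩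
  set S := sineTransform (fun t => cutoff T t * ψ t) a (T + 2)
  have hS : Measurable S :=
    measurable_sineTransform_right ((continuous_cutoff T).mul hψ.continuous).measurable _ _
  have h_S : energy (-3 / 2) (fun k => (1 + omega k ^ 2) * S k) ≤ K₁ * ∫⁻ t, ‖ψ t‖ₑ ^ 2 := by
    refine (energy_one_add_omega_sq_mul_le _ _).trans ?_
    norm_num only
    exact hK₁ ψ hψ.continuous a ha.1
  calc _ = energy (-3 / 2) fun k => (1 + omega k ^ 2) * S k
          + (-sineTransform (fun t => deriv (deriv (cutoff T)) t * ψ t) a (T + 2) k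
          + (-ψ a + -2 * cosineTransform (fun t => deriv (cutoff T) t * ψ t) a (T + 2) k)) := by
        refine energy_congr_ae ?_
        filter_upwards [Measure.ae_ne volume (0 : ℝ)] with k hk
        exact sineTransform_cutoff_mul_sub_deriv_deriv hψ ha hk
    _ ≤ 2 * (K₁ * ((∫⁻ t, ‖ψ t‖ₑ ^ 2) + ‖ψ a‖ₑ ^ 2)
          + K₂ * ((∫⁻ t, ‖ψ t‖ₑ ^ 2) + ‖ψ a‖ₑ ^ 2)) := by
        refine (energy_add_le _ (by fun_prop) _).trans ?_
        gcongr
        · refine h_S.trans ?_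
          gcongr
          exact le_self_add
        · exact hK₂ ψ hψ.continuous a ha
    _ = _ := by
        push_cast
        ring

theorem hasDerivAt_hat {g : ℝ → ℂ} (hg : Integrable g) (hg' : Integrable fun x : ℝ => x * g x)
    (t : ℝ) : HasDerivAt (hat g) (hat (fun x : ℝ => -(I * x) * g x) t) t := by
  have h_scale : HasDerivAt (fun t : ℝ => (2 * Real.pi)⁻¹ * t) (2 * Real.pi)⁻¹ t := by
    simpa using (hasDerivAt_id t).const_mul (2 * Real.pi)⁻¹
  have h_fourier := (Real.hasDerivAt_fourier hg (by simpa using hg') _).scomp t h_scale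
  rw [show hat g = 𝓕 g ∘ fun t : ℝ => (2 * Real.pi)⁻¹ * t from funext (hat_eq_fourier g)]
  refine h_fourier.congr_deriv ?_
  rw [hat_eq_fourier, Real.fourier_real_eq_integral_exp_smul,
    Real.fourier_real_eq_integral_exp_smul, ← integral_smul]
  refine integral_congr_ae (.of_forall fun x => ?_)
  have : (Real.pi : ℂ) ≠ 0 := by exact_mod_cast Real.pi_ne_zero
  simp only [smul_eq_mul, Complex.real_smul]
  push_cast
  field_simp

theorem deriv_hat {g : ℝ → ℂ} (hg : Integrable g) (hg' : Integrable fun x : ℝ => x * g x) :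
    deriv (hat g) = hat fun x : ℝ => -(I * x) * g x :=
  funext fun t => (hasDerivAt_hat hg hg' t).deriv

theorem contDiff_one_hat {g : ℝ → ℂ} (hg : Integrable g)
    (hg' : Integrable fun x : ℝ => x * g x) : ContDiff ℝ 1 (hat g) := by
  refine contDiff_one_iff_deriv.2
    ⟨fun t => (hasDerivAt_hat hg hg' t).differentiableAt, ?_⟩
  rw [deriv_hat hg hg']
  exact continuous_hat ((hg'.const_mul (-I)).congr (.of_forall fun x => by ring))

theorem hat_add {f g : ℝ → ℂ} (hf : Integrable f) (hg : Integrable g) (t : ℝ) :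
    hat (fun x => f x + g x) t = hat f t + hat g t := by
  have h_int : ∀ {u : ℝ → ℂ}, Integrable u → Integrable fun x : ℝ => cexp (-(I * t * x)) * u x :=
    fun hu => hu.bdd_mul (c := 1) (by fun_prop) (.of_forall fun x => by
      simpa using (norm_cexp_I_mul t (-x)).le)
  simp only [hat, mul_add]
  exact integral_add (h_int hf) (h_int hg)

theorem hat_neg (f : ℝ → ℂ) (t : ℝ) : hat (fun x => -f x) t = -hat f t := by
  simp only [hat, mul_neg, integral_neg]

/-- The class of test functions for the estimates of the transpose: measurable functions in
`L¹ ∩ L²`. -/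
structure IsAdmissible (f : ℝ → ℂ) : Prop where
  measurable : Measurable f
  integrable : Integrable f
  memLp : MemLp f 2

theorem IsAdmissible.mono {f u : ℝ → ℂ} (hf : IsAdmissible f) (hu : Measurable u)
    (h : ∀ x, ‖u x‖ ≤ ‖f x‖) : IsAdmissible u where
  measurable := hu
  integrable := hf.integrable.mono hu.aestronglyMeasurable (.of_forall h)
  memLp := hf.memLp.mono hu.aestronglyMeasurable (.of_forall h)

theorem IsAdmissible.real_mul {f : ℝ → ℂ} (hf : IsAdmissible f) {c : ℝ → ℝ} (hc : Measurable c)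
    (h : ∀ x, c x ∈ Icc 0 1) : IsAdmissible fun x => c x * f x :=
  have := hf.measurable
  hf.mono (by fun_prop) fun x => by
    rw [norm_mul, norm_real, Real.norm_of_nonneg (h x).1]
    exact mul_le_of_le_one_left (norm_nonneg _) (h x).2

theorem IsAdmissible.split {f : ℝ → ℂ} (hf : IsAdmissible f) {Q : ℝ → ℝ} (hQ : Measurable Q)
    (hQ_pos : ∀ x, 0 < Q x) {t : ℝ} (ht : 0 < t) :
    IsAdmissible (fun x => (Q x / (Q x + t) : ℝ) * f x) ∧
      IsAdmissible (fun x => (t / (Q x + t) : ℝ) * f x) ∧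
      f = fun x => (Q x / (Q x + t) : ℝ) * f x + (t / (Q x + t) : ℝ) * f x := by
  refine ⟨hf.real_mul (by fun_prop) fun x => ?_, hf.real_mul (by fun_prop) fun x => ?_,
    funext fun x => ?_⟩ <;> have := hQ_pos x
  · exact ⟨by positivity, div_le_one_of_le₀ (by linarith) (by linarith)⟩
  · exact ⟨by positivity, div_le_one_of_le₀ (by linarith) (by linarith)⟩
  · rw [← add_mul, ← ofReal_add, ← add_div, div_self (by positivity), ofReal_one, one_mul]

theorem energy_congr_norm {u v : ℝ → ℂ} (a : ℝ) (h : ∀ k, ‖u k‖ = ‖v k‖) :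
    energy a u = energy a v := by
  simp only [energy, ← ofReal_norm, h]

theorem norm_weight_mul (a k : ℝ) (z : ℂ) : ‖(weight a k : ℂ) * z‖ = weight a k * ‖z‖ := by
  rw [norm_mul, norm_real, Real.norm_of_nonneg (weight_pos a k).le]

theorem abs_pow_le_weight (j : ℕ) (k : ℝ) : |k| ^ j ≤ weight (j / 2) k :=
  calc |k| ^ j ≤ √(1 + k ^ 2) ^ j := by
        gcongr
        exact Real.abs_le_sqrt (by linarith)
    _ = weight (j / 2) k := by
        rw [Real.sqrt_eq_rpow, ← Real.rpow_mul_natCast (by positivity), weight]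
        ring_nf

theorem abs_pow_mul_weight_le_one {j : ℕ} {a : ℝ} (h : j / 2 + a ≤ 0) (k : ℝ) :
    |k| ^ j * weight a k ≤ 1 :=
  calc |k| ^ j * weight a k ≤ weight (j / 2) k * weight a k := by
        gcongr
        exacts [(weight_pos a k).le, abs_pow_le_weight j k]
    _ = weight (j / 2 + a) k := (weight_add _ _ k).symm
    _ ≤ weight 0 k := weight_mono h k
    _ = 1 := weight_zero k

theorem norm_one_sub_I_mul (x : ℝ) : ‖(1 - I * x : ℂ)‖ = weight (1 / 2) x := by
  rw [← Real.sqrt_sq (norm_nonneg _), ← Complex.normSq_eq_norm_sq, Complex.normSq_apply, weight,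
    ← Real.sqrt_eq_rpow]
  simp [sq]

theorem one_sub_I_mul_ne_zero (x : ℝ) : (1 - I * x : ℂ) ≠ 0 :=
  norm_ne_zero_iff.1 ((norm_one_sub_I_mul x).trans_ne (weight_pos _ _).ne')

theorem norm_one_sub_I_mul_inv_mul (x : ℝ) (z : ℂ) :
    ‖(1 - I * x : ℂ)⁻¹ * z‖ = weight (-1 / 2) x * ‖z‖ := by
  rw [norm_mul, norm_inv, norm_one_sub_I_mul, weight, weight, neg_div,
    Real.rpow_neg (by positivity)]

theorem IsAdmissible.exists_hat_eq_add_deriv {f : ℝ → ℂ} (hf : IsAdmissible f) :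
    ∃ ψ, ContDiff ℝ 1 ψ ∧ (∀ t, hat f t = ψ t + deriv ψ t) ∧
      ∫⁻ t, ‖ψ t‖ₑ ^ 2 = ENNReal.ofReal (2 * Real.pi) * energy (-1) f := by
  have := hf.measurable
  set g : ℝ → ℂ := fun x => (1 - I * x)⁻¹ * f x with hg_def
  have hg : IsAdmissible g := hf.mono (by fun_prop) fun x => by
    rw [norm_one_sub_I_mul_inv_mul]
    refine mul_le_of_le_one_left (norm_nonneg _) ?_
    simpa using abs_pow_mul_weight_le_one (j := 0) (a := -1 / 2) (by norm_num) x
  have hg' : IsAdmissible fun x : ℝ => x * g x := hf.mono (by fun_prop) fun x => by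
    rw [norm_mul, norm_one_sub_I_mul_inv_mul, norm_real, Real.norm_eq_abs, ← mul_assoc]
    refine mul_le_of_le_one_left (norm_nonneg _) ?_
    simpa using abs_pow_mul_weight_le_one (j := 1) (a := -1 / 2) (by norm_num) x
  refine ⟨hat g, contDiff_one_hat hg.integrable hg'.integrable, fun t => ?_, ?_⟩
  · rw [deriv_hat hg.integrable hg'.integrable, ← hat_add hg.integrable
      ((hg'.integrable.const_mul (-I)).congr (.of_forall fun x => by ring))]
    congr 1
    ext x
    have := one_sub_I_mul_ne_zero x
    simp only [hg_def]
    field_simp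
    ring
  · have h_norm : ∀ x, ‖g x‖ = ‖(weight (-1 / 2) x : ℂ) * f x‖ := fun x => by
      rw [norm_one_sub_I_mul_inv_mul, norm_weight_mul]
    rw [lintegral_hat_sq hg.integrable hg.memLp, ← energy_zero, energy_congr_norm 0 h_norm,
      energy_weight_mul]
    norm_num

theorem IsAdmissible.exists_hat_eq_sub_deriv_deriv {f : ℝ → ℂ} (hf : IsAdmissible f) :
    ∃ ψ, ContDiff ℝ 2 ψ ∧ (∀ t, hat f t = ψ t + -deriv (deriv ψ) t) ∧
      ∫⁻ t, ‖ψ t‖ₑ ^ 2 = ENNReal.ofReal (2 * Real.pi) * energy (-2) f := by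
  have := hf.measurable
  set g : ℝ → ℂ := fun x => weight (-1) x * f x with hg_def
  have h_adm : ∀ j ≤ 2, IsAdmissible fun x : ℝ => (x : ℂ) ^ j * g x := fun j hj =>
    hf.mono (by fun_prop) fun x => by
      rw [norm_mul, norm_weight_mul, norm_pow, norm_real, Real.norm_eq_abs, ← mul_assoc]
      refine mul_le_of_le_one_left (norm_nonneg _) (abs_pow_mul_weight_le_one ?_ x)
      have : (j : ℝ) ≤ 2 := by exact_mod_cast hj
      linarith
  have hg : IsAdmissible g := by simpa using h_adm 0 zero_le_two
  have hg' : Integrable fun x : ℝ => x * g x := by simpa using (h_adm 1 one_le_two).integrable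
  have h_deriv : deriv (hat g) = hat fun x : ℝ => -(I * x) * g x := deriv_hat hg.integrable hg'
  have hg₁ : Integrable fun x : ℝ => -(I * x) * g x :=
    (hg'.const_mul (-I)).congr (.of_forall fun x => by ring)
  have hg₁' : Integrable fun x : ℝ => x * (-(I * x) * g x) :=
    ((h_adm 2 le_rfl).integrable.const_mul (-I)).congr (.of_forall fun x => by ring)
  refine ⟨hat g, (contDiff_succ_iff_deriv (n := 1)).2
    ⟨(contDiff_one_hat hg.integrable hg').differentiable one_ne_zero, by simp, ?_⟩,
    fun t => ?_, ?_⟩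
  · rw [h_deriv]
    exact contDiff_one_hat hg₁ hg₁'
  · rw [h_deriv, deriv_hat hg₁ hg₁', ← hat_neg, ← hat_add hg.integrable
      ((hg₁'.const_mul I).congr (.of_forall fun x => by ring))]
    congr 1
    ext x
    have h_weight : (weight (-1) x : ℂ) * (1 + x ^ 2) = 1 := by
      rw [weight, Real.rpow_neg_one, ofReal_inv]
      push_cast
      exact inv_mul_cancel₀ (by exact_mod_cast (by positivity : (1 + x ^ 2 : ℝ) ≠ 0))
    simp only [hg_def]
    linear_combination (-f x) * h_weight + (weight (-1) x * x ^ 2 * f x) * I_sq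
  · rw [lintegral_hat_sq hg.integrable hg.memLp, ← energy_zero, energy_weight_mul]
    norm_num

/-- The transpose of the solution operator, applied to the test function `hat f` and cut off in
time. -/
def adjointDuhamel (T : ℝ) (f : ℝ → ℂ) (a k : ℝ) : ℂ :=
  sineTransform (fun t => cutoff T t * hat f t) a (T + 2) k

section adjointDuhamel

variable (T : ℝ)

theorem measurable_adjointDuhamel {f : ℝ → ℂ} (hf : Integrable f) :
    Measurable (Function.uncurry (adjointDuhamel T f)) :=
  measurable_sineTransform ((continuous_cutoff T).mul (continuous_hat hf)).measurable _

theorem adjointDuhamel_add {f g : ℝ → ℂ} (hf : Integrable f) (hg : Integrable g) (a k : ℝ) :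
    adjointDuhamel T (fun x => f x + g x) a k
      = adjointDuhamel T f a k + adjointDuhamel T g a k := by
  simp only [adjointDuhamel, hat_add hf hg, mul_add]
  exact sineTransform_add ((continuous_cutoff T).mul (continuous_hat hf))
    ((continuous_cutoff T).mul (continuous_hat hg)) a (T + 2) k

theorem exists_energy_adjointDuhamel_le_energy_zero : ∃ K : ℝ≥0, ∀ f, IsAdmissible f →
    ∀ a ∈ Icc 0 T, energy (5 / 2) (adjointDuhamel T f a) ≤ K * energy 0 f := by
  obtain ⟨K, hK⟩ := exists_energy_sineTransform_mul_le (continuous_cutoff T) (T + 2)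
  refine ⟨K * (2 * Real.pi).toNNReal, fun f hf a ha => ?_⟩
  refine (hK _ (continuous_hat hf.integrable) a ha.1).trans_eq ?_
  rw [lintegral_hat_sq hf.integrable hf.memLp, energy_zero, ENNReal.coe_mul, mul_assoc,
    ENNReal.ofReal]

theorem exists_energy_adjointDuhamel_le_energy_neg_one : ∃ K : ℝ≥0, ∀ f, IsAdmissible f →
    ∀ a ∈ Icc 0 T, energy (1 / 2) (adjointDuhamel T f a) ≤ K * energy (-1) f := by
  obtain ⟨K, hK⟩ := exists_energy_sineTransform_cutoff_mul_add_deriv_le T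
  refine ⟨K * (2 * Real.pi).toNNReal, fun f hf a ha => ?_⟩
  obtain ⟨ψ, hψ, h_hat, h_norm⟩ := hf.exists_hat_eq_add_deriv
  unfold adjointDuhamel
  simp only [h_hat]
  refine (hK ψ hψ a ha).trans_eq ?_
  rw [h_norm, ENNReal.coe_mul, mul_assoc, ENNReal.ofReal]

theorem exists_lintegral_energy_adjointDuhamel_le_energy_neg_two : ∃ K : ℝ≥0, ∀ f, IsAdmissible f →
    ∫⁻ a in Ioo 0 T, energy (-3 / 2) (adjointDuhamel T f a) ≤ K * energy (-2) f := by
  obtain ⟨K, hK⟩ := exists_energy_sineTransform_cutoff_mul_sub_deriv_deriv_le T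
  refine ⟨K * (T.toNNReal + 1) * (2 * Real.pi).toNNReal, fun f hf => ?_⟩
  obtain ⟨ψ, hψ, h_hat, h_norm⟩ := hf.exists_hat_eq_sub_deriv_deriv
  have := hψ.continuous
  set N := ∫⁻ t, ‖ψ t‖ₑ ^ 2
  calc ∫⁻ a in Ioo 0 T, energy (-3 / 2) (adjointDuhamel T f a)
      ≤ ∫⁻ a in Ioo 0 T, K * (N + ‖ψ a‖ₑ ^ 2) := by
        refine setLIntegral_mono' measurableSet_Ioo fun a ha => ?_
        unfold adjointDuhamel
        simp only [h_hat]
        exact hK ψ hψ a (Ioo_subset_Icc_self ha)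
    _ = K * (N * ENNReal.ofReal T + ∫⁻ a in Ioo 0 T, ‖ψ a‖ₑ ^ 2) := by
        rw [lintegral_const_mul' _ _ ENNReal.coe_ne_top, lintegral_add_left measurable_const,
          setLIntegral_const, Real.volume_Ioo, sub_zero]
    _ ≤ K * (N * ENNReal.ofReal T + N) := by
        gcongr
        exact setLIntegral_le_lintegral _ _
    _ = _ := by
        rw [h_norm]
        push_cast [ENNReal.ofReal]
        ring

end adjointDuhamel

/-! ### Interpolation -/

section Interpolation

variable {α : Type*} [MeasurableSpace α] {μ : Measure α}

theorem lintegral_energy_eq_lintegral_prod (p : ℝ) {V : α → ℝ → ℂ}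
    (hV : Measurable (Function.uncurry V)) :
    ∫⁻ a, energy p (V a) ∂μ
      = ∫⁻ z, ENNReal.ofReal (weight p z.2) * ‖V z.1 z.2‖ₑ ^ 2 ∂μ.prod volume :=
  (lintegral_prod (fun z => ENNReal.ofReal (weight p z.2) * ‖Function.uncurry V z‖ₑ ^ 2)
    (by fun_prop)).symm

theorem lintegral_energy_le_of_energy_le [SFinite μ] {Φ : (ℝ → ℂ) → α → ℝ → ℂ}
    (hΦ_meas : ∀ f, IsAdmissible f → Measurable (Function.uncurry (Φ f)))
    (hΦ_add : ∀ f g, IsAdmissible f → IsAdmissible g →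
      ∀ a k, Φ (fun x => f x + g x) a k = Φ f a k + Φ g a k)
    {p₀ p₁ q₀ q₁ : ℝ} {K : ℝ≥0∞}
    (h₀ : ∀ f, IsAdmissible f → ∫⁻ a, energy p₀ (Φ f a) ∂μ ≤ K * energy q₀ f)
    (h₁ : ∀ f, IsAdmissible f → ∫⁻ a, energy p₁ (Φ f a) ∂μ ≤ K * energy q₁ f)
    {θ : ℝ} (hθ : θ ∈ Icc (0 : ℝ) 1) {f : ℝ → ℂ} (hf : IsAdmissible f) :
    ∫⁻ a, energy ((1 - θ) * p₀ + θ * p₁) (Φ f a) ∂μ ≤ K * energy ((1 - θ) * q₀ + θ * q₁) f := by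
  rcases hθ.1.eq_or_lt with rfl | hθ₀
  · simpa using h₀ f hf
  rcases hθ.2.eq_or_lt with rfl | hθ₁
  · simpa using h₁ f hf
  have hf_meas := hf.measurable
  have hΦ_f : Measurable fun z : α × ℝ => Φ f z.1 z.2 := hΦ_meas f hf
  have h_decomp := lintegral_rpow_mul_sq_le_of_decomposition (μ := μ.prod volume) (ν := volume)
    ⟨hθ₀, hθ₁⟩ (P := fun z : α × ℝ => weight (p₁ - p₀) z.2) (Q := weight (q₁ - q₀))
    (by fun_prop) (by fun_prop) (fun _ => weight_pos _ _) (weight_pos _)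
    (U := fun z => weight (p₀ / 2) z.2 * Φ f z.1 z.2) (by fun_prop)
    (f := fun x => weight (q₀ / 2) x * f x) (by fun_prop) (K := K) fun t ht => by
      obtain ⟨hf₀, hf₁, h_sum⟩ :=
        hf.split (Q := weight (q₁ - q₀)) (by fun_prop) (weight_pos _) ht
      set f₀ : ℝ → ℂ := fun x => (weight (q₁ - q₀) x / (weight (q₁ - q₀) x + t) : ℝ) * f x
      set f₁ : ℝ → ℂ := fun x => (t / (weight (q₁ - q₀) x + t) : ℝ) * f x
      have hΦ₀ : Measurable fun z : α × ℝ => Φ f₀ z.1 z.2 := hΦ_meas f₀ hf₀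
      refine ⟨fun z => weight (p₀ / 2) z.2 * Φ f₀ z.1 z.2,
        fun z => weight (p₀ / 2) z.2 * Φ f₁ z.1 z.2, by fun_prop, .of_forall fun z => ?_, ?_, ?_⟩
      · rw [← mul_add, ← hΦ_add f₀ f₁ hf₀ hf₁, ← h_sum]
      · have := h₀ f₀ hf₀
        rw [lintegral_energy_eq_lintegral_prod _ hΦ₀] at this
        simpa only [energy, mul_left_comm _ (weight _ _ : ℂ), enorm_weight_mul_sq,
          mul_div_cancel₀ _ (two_ne_zero' ℝ)] using this
      · have := h₁ f₁ hf₁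
        rw [lintegral_energy_eq_lintegral_prod _ (hΦ_meas f₁ hf₁)] at this
        simpa only [energy, mul_left_comm _ (weight _ _ : ℂ), enorm_weight_mul_sq,
          ofReal_weight_mul_weight, mul_div_cancel₀ _ (two_ne_zero' ℝ), sub_add_cancel] using this
  simp_rw [enorm_weight_mul_sq, weight_rpow, ofReal_weight_mul_weight] at h_decomp
  rw [lintegral_energy_eq_lintegral_prod _ hΦ_f]
  refine (Eq.trans_le ?_ h_decomp).trans_eq ?_
  · ring_nf
  · rw [energy]
    ring_nf

end Interpolation

theorem exists_energy_adjointDuhamel_le (T : ℝ) {m : ℝ} (hm : m ∈ Icc (0 : ℝ) 1) :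
    ∃ K : ℝ≥0, ∀ f, IsAdmissible f → ∀ a ∈ Icc 0 T,
      energy (5 / 2 - 2 * m) (adjointDuhamel T f a) ≤ K * energy (-m) f := by
  obtain ⟨K₀, hK₀⟩ := exists_energy_adjointDuhamel_le_energy_zero T
  obtain ⟨K₁, hK₁⟩ := exists_energy_adjointDuhamel_le_energy_neg_one T
  refine ⟨max K₀ K₁, fun f hf a ha => ?_⟩
  have h := lintegral_energy_le_of_energy_le (μ := Measure.dirac ())
    (Φ := fun f _ => adjointDuhamel T f a) (p₀ := 5 / 2) (p₁ := 1 / 2) (q₀ := 0) (q₁ := -1)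
    (K := (max K₀ K₁ : ℝ≥0))
    (fun f hf => (measurable_adjointDuhamel T hf.integrable).comp
      (measurable_const.prodMk measurable_snd))
    (fun f g hf hg _ => adjointDuhamel_add T hf.integrable hg.integrable a)
    (fun f hf => by
      rw [lintegral_dirac]
      refine (hK₀ f hf a ha).trans ?_
      gcongr
      exact le_max_left _ _)
    (fun f hf => by
      rw [lintegral_dirac]
      refine (hK₁ f hf a ha).trans ?_
      gcongr
      exact le_max_right _ _) hm hf
  rw [lintegral_dirac] at h
  convert h using 2 <;> ring_nf

theorem exists_lintegral_energy_adjointDuhamel_le (T : ℝ) {m : ℝ} (hm : m ∈ Icc (1 : ℝ) 2) :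
    ∃ K : ℝ≥0, ∀ f, IsAdmissible f →
      ∫⁻ a in Ioo 0 T, energy (5 / 2 - 2 * m) (adjointDuhamel T f a) ≤ K * energy (-m) f := by
  obtain ⟨K₀, hK₀⟩ := exists_energy_adjointDuhamel_le_energy_neg_one T
  obtain ⟨K₁, hK₁⟩ := exists_lintegral_energy_adjointDuhamel_le_energy_neg_two T
  have h_neg_one : ∀ f, IsAdmissible f →
      ∫⁻ a in Ioo 0 T, energy (1 / 2) (adjointDuhamel T f a)
        ≤ (K₀ * T.toNNReal : ℝ≥0) * energy (-1) f := fun f hf =>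
    calc ∫⁻ a in Ioo 0 T, energy (1 / 2) (adjointDuhamel T f a)
        ≤ ∫⁻ _ in Ioo 0 T, K₀ * energy (-1) f :=
          setLIntegral_mono' measurableSet_Ioo fun a ha => hK₀ f hf a (Ioo_subset_Icc_self ha)
      _ = (K₀ * T.toNNReal : ℝ≥0) * energy (-1) f := by
          rw [setLIntegral_const, Real.volume_Ioo, sub_zero, ENNReal.coe_mul]
          exact mul_right_comm _ _ _
  refine ⟨max (K₀ * T.toNNReal) K₁, fun f hf => ?_⟩
  have h := lintegral_energy_le_of_energy_le (μ := volume.restrict (Ioo 0 T))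
    (Φ := adjointDuhamel T) (p₀ := 1 / 2) (p₁ := -3 / 2) (q₀ := -1) (q₁ := -2)
    (K := (max (K₀ * T.toNNReal) K₁ : ℝ≥0)) (θ := m - 1)
    (fun f hf => measurable_adjointDuhamel T hf.integrable)
    (fun f g hf hg => adjointDuhamel_add T hf.integrable hg.integrable)
    (fun f hf => (h_neg_one f hf).trans (by
      gcongr
      exact le_max_left _ _))
    (fun f hf => (hK₁ f hf).trans (by
      gcongr
      exact le_max_right _ _))
    ⟨sub_nonneg.2 hm.1, by linarith [hm.2]⟩ hf
  convert h using 3 <;> ring_nf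

/-! ### Pairing with the forcing term -/

theorem measurable_energy (σ : ℝ) {Fhat : ℝ → ℝ → ℂ} (hF : Measurable (Function.uncurry Fhat)) :
    Measurable fun t => energy σ fun k => Fhat k t :=
  Measurable.lintegral_prod_left'
    (f := fun p : ℝ × ℝ => ENNReal.ofReal (weight σ p.1) * ‖Function.uncurry Fhat p‖ₑ ^ 2)
    (by fun_prop)

theorem measurable_hatENorm (σ : ℝ) {Fhat : ℝ → ℝ → ℂ} (hF : Measurable (Function.uncurry Fhat)) :
    Measurable fun t => hatENorm σ fun k => Fhat k t :=
  (measurable_energy σ hF).pow_const _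

theorem hatENorm_le_of_energy_le {a b : ℝ} {u v : ℝ → ℂ} {K : ℝ≥0}
    (h : energy a u ≤ K * energy b v) :
    hatENorm a u ≤ (K ^ (1 / 2 : ℝ) : ℝ≥0) * hatENorm b v := by
  rw [hatENorm, hatENorm, ENNReal.coe_rpow_of_nonneg _ (by norm_num),
    ← ENNReal.mul_rpow_of_nonneg _ _ (by norm_num)]
  gcongr

theorem lintegral_pow_mul_le (j : ℕ) (σ : ℝ) {u w : ℝ → ℂ} (hu : Measurable u)
    (hw : Measurable w) :
    ∫⁻ k, ‖(I * k) ^ j * (u k * w k)‖ₑ ≤ hatENorm (j - σ) u * hatENorm σ w := by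
  calc ∫⁻ k, ‖(I * k) ^ j * (u k * w k)‖ₑ
      ≤ ∫⁻ k, ‖(weight ((j - σ) / 2) k : ℂ) * u k‖ₑ * ‖(weight (σ / 2) k : ℂ) * w k‖ₑ := by
        refine lintegral_mono fun k => ?_
        rw [← enorm_mul, enorm_le_iff_norm_le]
        calc ‖(I * k) ^ j * (u k * w k)‖ = |k| ^ j * (‖u k‖ * ‖w k‖) := by simp
          _ ≤ weight (j / 2) k * (‖u k‖ * ‖w k‖) := by
              gcongr
              exact abs_pow_le_weight j k
          _ = ‖(weight ((j - σ) / 2) k : ℂ) * u k * ((weight (σ / 2) k : ℂ) * w k)‖ := by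
              rw [norm_mul, norm_weight_mul, norm_weight_mul, mul_mul_mul_comm, ← weight_add]
              ring_nf
    _ ≤ _ := lintegral_mul_le_sqrt (by fun_prop) (by fun_prop)
    _ = _ := by simp only [hatENorm_eq_eLpNorm, eLpNorm_two_eq]

/-- The Fourier transform in space of a forcing term in `L¹((0, T); H^σ(ℝ))`. -/
structure IsForcing (T σ : ℝ) (Fhat : ℝ → ℝ → ℂ) : Prop where
  measurable : Measurable (Function.uncurry Fhat)
  lintegral_lt_top : ∫⁻ a in Ioo 0 T, hatENorm σ (fun k => Fhat k a) < ∞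

/-- The pairing of `(ik)^j Fhat` with the transpose of the solution operator is bounded, by `L`, on
the test functions `hat f` normed by `H^{-m}`. -/
structure TraceBound (T : ℝ) (j : ℕ) (m : ℝ) (Fhat : ℝ → ℝ → ℂ) (L : ℝ≥0∞) : Prop where
  measurable : Measurable (Function.uncurry Fhat)
  lt_top : L < ∞
  lintegral_le : ∀ f, IsAdmissible f →
    ∫⁻ a in Ioo 0 T, ∫⁻ k, ‖(I * k) ^ j * (adjointDuhamel T f a k * Fhat k a)‖ₑ
      ≤ L * hatENorm (-m) f

theorem exists_traceBound_one (T : ℝ) (j : ℕ) {σ m : ℝ} (hm : m ∈ Icc (0 : ℝ) 1)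
    (hσ : j - σ = 5 / 2 - 2 * m) :
    ∃ C : ℝ≥0, ∀ Fhat, IsForcing T σ Fhat →
      TraceBound T j m Fhat (C * ∫⁻ a in Ioo 0 T, hatENorm σ fun k => Fhat k a) := by
  obtain ⟨K, hK⟩ := exists_energy_adjointDuhamel_le T hm
  refine ⟨K ^ (1 / 2 : ℝ), fun Fhat hF => ⟨hF.measurable,
    ENNReal.mul_lt_top ENNReal.coe_lt_top hF.lintegral_lt_top, fun f hf => ?_⟩⟩
  calc ∫⁻ a in Ioo 0 T, ∫⁻ k, ‖(I * k) ^ j * (adjointDuhamel T f a k * Fhat k a)‖ₑ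
      ≤ ∫⁻ a in Ioo 0 T, ((K ^ (1 / 2 : ℝ) : ℝ≥0) * hatENorm (-m) f)
          * hatENorm σ fun k => Fhat k a := by
        refine setLIntegral_mono' measurableSet_Ioo fun a ha => ?_
        refine (lintegral_pow_mul_le j σ (measurable_adjointDuhamel T hf.integrable).of_uncurry_left
          hF.measurable.of_uncurry_right).trans ?_
        gcongr
        rw [hσ]
        exact hatENorm_le_of_energy_le (hK f hf a (Ioo_subset_Icc_self ha))
    _ = _ := by
        rw [lintegral_const_mul _ (measurable_hatENorm _ hF.measurable)]
        ring

theorem exists_traceBound_two (T : ℝ) (j : ℕ) {σ m : ℝ} (hm : m ∈ Icc (1 : ℝ) 2)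
    (hσ : j - σ = 5 / 2 - 2 * m) :
    ∃ C : ℝ≥0, ∀ Fhat : ℝ → ℝ → ℂ, Measurable (Function.uncurry Fhat) →
      (∫⁻ a in Ioo 0 T, (hatENorm σ fun k => Fhat k a) ^ 2) ^ (1 / 2 : ℝ) < ∞ →
      TraceBound T j m Fhat
        (C * (∫⁻ a in Ioo 0 T, (hatENorm σ fun k => Fhat k a) ^ 2) ^ (1 / 2 : ℝ)) := by
  obtain ⟨K, hK⟩ := exists_lintegral_energy_adjointDuhamel_le T hm
  refine ⟨K ^ (1 / 2 : ℝ), fun Fhat hF hN =>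
    ⟨hF, ENNReal.mul_lt_top ENNReal.coe_lt_top hN, fun f hf => ?_⟩⟩
  have h_meas := measurable_adjointDuhamel T hf.integrable
  calc ∫⁻ a in Ioo 0 T, ∫⁻ k, ‖(I * k) ^ j * (adjointDuhamel T f a k * Fhat k a)‖ₑ
      ≤ ∫⁻ a in Ioo 0 T,
          hatENorm (j - σ) (adjointDuhamel T f a) * hatENorm σ fun k => Fhat k a :=
        lintegral_mono fun a =>
          lintegral_pow_mul_le j σ h_meas.of_uncurry_left hF.of_uncurry_right
    _ ≤ (∫⁻ a in Ioo 0 T, hatENorm (j - σ) (adjointDuhamel T f a) ^ 2) ^ (1 / 2 : ℝ)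
        * (∫⁻ a in Ioo 0 T, (hatENorm σ fun k => Fhat k a) ^ 2) ^ (1 / 2 : ℝ) :=
        lintegral_mul_le_sqrt
          (measurable_hatENorm (Fhat := fun k a => adjointDuhamel T f a k) _
            (h_meas.comp measurable_swap)).aemeasurable
          (measurable_hatENorm _ hF).aemeasurable
    _ ≤ (K * energy (-m) f) ^ (1 / 2 : ℝ)
        * (∫⁻ a in Ioo 0 T, (hatENorm σ fun k => Fhat k a) ^ 2) ^ (1 / 2 : ℝ) := by
        gcongr
        simp only [hatENorm_sq, hσ]
        exact hK f hf
    _ = _ := by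
        rw [ENNReal.coe_rpow_of_nonneg _ (by norm_num),
          ENNReal.mul_rpow_of_nonneg _ _ (by norm_num), ← hatENorm]
        ring

/-! ### The Duhamel integral -/

theorem exists_lintegral_weight_mul_le_hatENorm (σ : ℝ) : ∃ C : ℝ≥0, ∀ u : ℝ → ℂ, Measurable u →
    ∫⁻ k, ENNReal.ofReal (weight (σ / 2 - 1) k) * ‖u k‖ₑ ≤ C * hatENorm σ u := by
  obtain ⟨D, hD⟩ := ENNReal.lt_iff_exists_coe.1 (lintegral_weight_lt_top (a := -2) (by norm_num))
  refine ⟨D ^ (1 / 2 : ℝ), fun u hu => ?_⟩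
  calc ∫⁻ k, ENNReal.ofReal (weight (σ / 2 - 1) k) * ‖u k‖ₑ
      = ∫⁻ k, ENNReal.ofReal (weight (-1) k) * ‖(weight (σ / 2) k : ℂ) * u k‖ₑ := by
        refine lintegral_congr fun k => ?_
        rw [enorm_weight_mul, ofReal_weight_mul_weight, neg_add_eq_sub]
    _ ≤ (∫⁻ k, ENNReal.ofReal (weight (-1) k) ^ 2) ^ (1 / 2 : ℝ)
        * (∫⁻ k, ‖(weight (σ / 2) k : ℂ) * u k‖ₑ ^ 2) ^ (1 / 2 : ℝ) :=
        lintegral_mul_le_sqrt (by fun_prop) (by fun_prop)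
    _ = (∫⁻ k, ENNReal.ofReal (weight (-2) k)) ^ (1 / 2 : ℝ) * hatENorm σ u := by
        rw [← eLpNorm_two_eq, ← hatENorm_eq_eLpNorm]
        simp only [← ENNReal.ofReal_pow (weight_pos _ _).le, ← Real.rpow_natCast, weight_rpow]
        norm_num
    _ = _ := by rw [hD.1, ENNReal.coe_rpow_of_nonneg _ (by norm_num)]

theorem IsForcing.lintegral_weight_mul_lt_top {T σ : ℝ} {Fhat : ℝ → ℝ → ℂ}
    (hF : IsForcing T σ Fhat) :
    ∫⁻ k, ENNReal.ofReal (weight (σ / 2 - 1) k) * ∫⁻ a in Ioo 0 T, ‖Fhat k a‖ₑ < ∞ := by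
  obtain ⟨C, hC⟩ := exists_lintegral_weight_mul_le_hatENorm σ
  have h_meas : Measurable fun p : ℝ × ℝ => Fhat p.1 p.2 := hF.measurable
  calc ∫⁻ k, ENNReal.ofReal (weight (σ / 2 - 1) k) * ∫⁻ a in Ioo 0 T, ‖Fhat k a‖ₑ
      = ∫⁻ k, ∫⁻ a in Ioo 0 T, ENNReal.ofReal (weight (σ / 2 - 1) k) * ‖Fhat k a‖ₑ :=
        lintegral_congr fun k => (lintegral_const_mul' _ _ ENNReal.ofReal_ne_top).symm
    _ = ∫⁻ a in Ioo 0 T, ∫⁻ k, ENNReal.ofReal (weight (σ / 2 - 1) k) * ‖Fhat k a‖ₑ :=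
        lintegral_lintegral_swap (by fun_prop)
    _ ≤ ∫⁻ a in Ioo 0 T, C * hatENorm σ (fun k => Fhat k a) :=
        lintegral_mono fun a => hC _ hF.measurable.of_uncurry_right
    _ < ∞ := by
        rw [lintegral_const_mul' _ _ ENNReal.coe_ne_top]
        exact ENNReal.mul_lt_top ENNReal.coe_lt_top hF.lintegral_lt_top

theorem IsForcing.ae_integrableOn {T σ : ℝ} {Fhat : ℝ → ℝ → ℂ} (hF : IsForcing T σ Fhat) :
    ∀ᵐ k, IntegrableOn (Fhat k) (Ioo 0 T) := by
  have h_meas : Measurable fun k => ∫⁻ a in Ioo 0 T, ‖Fhat k a‖ₑ :=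
    Measurable.lintegral_prod_right' (f := fun p : ℝ × ℝ => ‖Fhat p.1 p.2‖ₑ) hF.measurable.enorm
  filter_upwards [ae_lt_top (by fun_prop) hF.lintegral_weight_mul_lt_top.ne] with k hk
  exact ⟨hF.measurable.of_uncurry_left.aestronglyMeasurable, ENNReal.lt_top_of_mul_ne_top_right
    hk.ne (ENNReal.ofReal_pos.2 (weight_pos _ _)).ne'⟩

/-- The Duhamel integral `∫_{(0, T) ∩ (-∞, t)} sin(ω(t - a)) / ω Fhat(k, a) da`; the truncation
`max (t - a) 0` restricts the integration to `a < t` because the kernel vanishes at `0`. -/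
def duhamel (T : ℝ) (Fhat : ℝ → ℝ → ℂ) (t k : ℝ) : ℂ :=
  ∫ a in Ioo 0 T, (sineKernel k (max (t - a) 0) : ℂ) * Fhat k a

theorem sineKernel_zero (k : ℝ) : sineKernel k 0 = 0 := by
  simp [sineKernel]

theorem solutionHat_eq_setIntegral {Fhat : ℝ → ℝ → ℂ} {t k : ℝ} (ht : 0 ≤ t)
    (hF : IntegrableOn (Fhat k) (Ioc 0 t)) :
    solutionHat Fhat t k = ∫ a in Ioc 0 t, (sineKernel k (t - a) : ℂ) * Fhat k a := by
  have h_int : ∀ y : ℝ, IntegrableOn (fun a : ℝ => cexp (I * y * a) * Fhat k a) (Ioc 0 t) :=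
    fun y => hF.bdd_mul (c := 1) (by fun_prop) (.of_forall fun a => (norm_cexp_I_mul y a).le)
  have h_euler : ∀ a : ℝ, (sineKernel k (t - a) : ℂ) = 1 / (2 * I * omega k) *
      (cexp (I * omega k * t) * cexp (-(I * omega k * a))
        - cexp (-(I * omega k * t)) * cexp (I * omega k * a)) := fun a => by
    rw [← Complex.exp_add, ← Complex.exp_add, sineKernel, ofReal_div, ofReal_sin, Complex.sin,
      one_div, mul_inv, mul_inv, inv_I]
    push_cast
    ring_nf
  rw [solutionHat, intervalIntegral.integral_of_le ht, intervalIntegral.integral_of_le ht,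
    ← integral_const_mul, ← integral_const_mul, ← integral_sub, ← integral_const_mul]
  · refine integral_congr_ae (.of_forall fun a => ?_)
    simp only [h_euler]
    ring
  · simpa using (h_int (-omega k)).const_mul (cexp (I * omega k * t))
  · exact (h_int (omega k)).const_mul _

theorem solutionHat_eq_duhamel {T : ℝ} {Fhat : ℝ → ℝ → ℂ} {t k : ℝ} (ht : t ∈ Icc 0 T)
    (hF : IntegrableOn (Fhat k) (Ioo 0 T)) : solutionHat Fhat t k = duhamel T Fhat t k := by
  have h_sub : Ioo 0 t ⊆ Ioo 0 T := Ioo_subset_Ioo_right ht.2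
  rw [solutionHat_eq_setIntegral ht.1 ((hF.mono_set h_sub).congr_set_ae Ioo_ae_eq_Ioc.symm),
    integral_Ioc_eq_integral_Ioo, duhamel, setIntegral_congr_fun measurableSet_Ioo fun a ha => by
      rw [← max_eq_left (sub_nonneg.2 ha.2.le)]]
  refine (setIntegral_eq_of_subset_of_forall_sdiff_eq_zero measurableSet_Ioo h_sub
    fun a ha => ?_).symm
  have : t ≤ a := not_lt.1 fun h => ha.2 ⟨ha.1.1, h⟩
  rw [max_eq_right (sub_nonpos.2 this), sineKernel_zero, ofReal_zero, zero_mul]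

theorem measurable_duhamel {Fhat : ℝ → ℝ → ℂ} (T : ℝ) (hF : Measurable (Function.uncurry Fhat)) :
    Measurable (Function.uncurry (duhamel T Fhat)) := by
  have h_meas : Measurable fun p : ℝ × ℝ => Fhat p.1 p.2 := hF
  exact (StronglyMeasurable.integral_prod_right (f := fun (p : ℝ × ℝ) (a : ℝ) =>
    (sineKernel p.2 (max (p.1 - a) 0) : ℂ) * Fhat p.2 a) (ν := volume.restrict (Ioo 0 T))
      (Measurable.stronglyMeasurable (by fun_prop))).measurable

theorem abs_max_sub_le {T t a : ℝ} (ht : t ∈ Icc 0 T) (ha : 0 < a) : |max (t - a) 0| ≤ T := by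
  rw [abs_of_nonneg (le_max_right _ _)]
  exact max_le (by linarith [ht.2]) (ht.1.trans ht.2)

theorem enorm_duhamel_le {T t : ℝ} (Fhat : ℝ → ℝ → ℂ) (k : ℝ) (ht : t ∈ Icc 0 T) :
    ‖duhamel T Fhat t k‖ₑ ≤ ENNReal.ofReal T * ∫⁻ a in Ioo 0 T, ‖Fhat k a‖ₑ := by
  refine (enorm_integral_le_lintegral_enorm _).trans ?_
  rw [← lintegral_const_mul' _ _ ENNReal.ofReal_ne_top]
  refine setLIntegral_mono' measurableSet_Ioo fun a ha => ?_
  rw [enorm_mul]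
  gcongr
  rw [← ofReal_norm, norm_real]
  exact ENNReal.ofReal_le_ofReal ((abs_sineKernel_le _ _).trans (abs_max_sub_le ht ha.1))

/-! ### The trace functional -/

theorem IsTestOn.eq_zero {T : ℝ} {η : 𝓢(ℝ, ℂ)} (hη : IsTestOn T η) {t : ℝ} (ht : t ∉ Ioo 0 T) :
    η t = 0 :=
  image_eq_zero_of_notMem_tsupport fun h => ht (hη h)

theorem IsTestOn.isCompact_tsupport {T : ℝ} {η : 𝓢(ℝ, ℂ)} (hη : IsTestOn T η) :
    IsCompact (tsupport (η : ℝ → ℂ)) :=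
  isCompact_Icc.of_isClosed_subset (isClosed_tsupport _) (hη.trans Ioo_subset_Icc_self)

theorem IsTestOn.integrableOn_mul {T : ℝ} {η : 𝓢(ℝ, ℂ)} (hη : IsTestOn T η) {v : ℝ → ℂ}
    (hv : LocallyIntegrableOn v (Ioo 0 T)) : IntegrableOn (fun t => v t * η t) (Ioo 0 T) := by
  have h_supp : IntegrableOn (fun t => v t * η t) (tsupport (η : ℝ → ℂ)) :=
    (hv.integrableOn_compact_subset hη hη.isCompact_tsupport).mul_continuousOn
      η.continuous.continuousOn hη.isCompact_tsupport
  refine h_supp.of_forall_sdiff_eq_zero measurableSet_Ioo fun t ht => ?_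
  rw [image_eq_zero_of_notMem_tsupport ht.2, mul_zero]

theorem IsTestOn.setIntegral_mul_eq {T : ℝ} {η : 𝓢(ℝ, ℂ)} (hη : IsTestOn T η) (v : ℝ → ℂ) :
    ∫ t in Ioo 0 T, v t * η t = ∫ t, v t * η t :=
  setIntegral_eq_integral_of_forall_compl_eq_zero fun t ht => by rw [hη.eq_zero ht, mul_zero]

theorem hat_fourierSchwartzInv (η : 𝓢(ℝ, ℂ)) : hat (fourierSchwartzInv η) = η := by
  rw [← fourierSchwartz_eq_hat, fourierSchwartz_fourierSchwartzInv]

theorem adjointDuhamel_eq_of_isTestOn {T : ℝ} {η : 𝓢(ℝ, ℂ)} (hη : IsTestOn T η) (a k : ℝ) :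
    adjointDuhamel T (fourierSchwartzInv η) a k
      = ∫ t in Ioo 0 T, (sineKernel k (max (t - a) 0) : ℂ) * η t := by
  rw [adjointDuhamel, sineTransform, hat_fourierSchwartzInv, ← integral_indicator measurableSet_Ioo,
    ← integral_indicator measurableSet_Ioc]
  congr 1
  ext t
  by_cases ht : t ∈ Ioo 0 T
  · rw [indicator_of_mem ht]
    rcases lt_or_ge a t with hat | hta
    · rw [indicator_of_mem (show t ∈ Ioc a (T + 2) from ⟨hat, by linarith [ht.2]⟩),
        cutoff_eq_one ht.2.le, one_mul, max_eq_left (sub_nonneg.2 hat.le)]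
    · rw [indicator_of_notMem fun h => hta.not_gt h.1, max_eq_right (sub_nonpos.2 hta),
        sineKernel_zero, ofReal_zero, zero_mul]
  · simp [indicator_apply, ht, hη.eq_zero ht]

theorem integral_duhamel_mul {T : ℝ} {Fhat : ℝ → ℝ → ℂ} {k : ℝ}
    (hF : IntegrableOn (Fhat k) (Ioo 0 T)) {η : 𝓢(ℝ, ℂ)} (hη : IsTestOn T η) :
    ∫ t in Ioo 0 T, duhamel T Fhat t k * η t
      = ∫ a in Ioo 0 T, adjointDuhamel T (fourierSchwartzInv η) a k * Fhat k a := by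
  have h_int : Integrable
      (fun q : ℝ × ℝ => (sineKernel k (max (q.1 - q.2) 0) : ℂ) * (η q.1 * Fhat k q.2))
      ((volume.restrict (Ioo 0 T)).prod (volume.restrict (Ioo 0 T))) := by
    refine (Integrable.mul_prod (η.integrable.restrict (s := Ioo 0 T)) hF).bdd_mul
      (c := (omega k)⁻¹) (Measurable.aestronglyMeasurable (by fun_prop)) (.of_forall fun q => ?_)
    rw [norm_real, Real.norm_eq_abs]
    exact abs_sineKernel_le_inv _ _
  calc ∫ t in Ioo 0 T, duhamel T Fhat t k * η t
      = ∫ t in Ioo 0 T, ∫ a in Ioo 0 T,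
          (sineKernel k (max (t - a) 0) : ℂ) * (η t * Fhat k a) := by
        simp only [duhamel, ← integral_mul_const, mul_assoc, mul_comm (η _)]
    _ = ∫ a in Ioo 0 T, ∫ t in Ioo 0 T,
          (sineKernel k (max (t - a) 0) : ℂ) * (η t * Fhat k a) := integral_integral_swap h_int
    _ = _ := by
        simp only [adjointDuhamel_eq_of_isTestOn hη, ← integral_mul_const, mul_assoc]

theorem IsAdmissible.of_schwartz (φ : 𝓢(ℝ, ℂ)) : IsAdmissible φ :=
  ⟨φ.continuous.measurable, φ.integrable, φ.memLp 2⟩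

theorem adjointDuhamel_const_mul (T : ℝ) (z : ℂ) (f : ℝ → ℂ) (a k : ℝ) :
    adjointDuhamel T (fun x => z * f x) a k = z * adjointDuhamel T f a k := by
  have h_hat : ∀ t, hat (fun x => z * f x) t = z * hat f t := fun t => by
    simp only [hat, ← integral_const_mul, mul_left_comm z]
  simp only [adjointDuhamel, sineTransform, h_hat, ← integral_const_mul, mul_left_comm z]

theorem hatENorm_schwartz_lt_top (σ : ℝ) (φ : 𝓢(ℝ, ℂ)) : hatENorm σ φ < ∞ := by
  have h := ((weightMul (σ / 2) φ).memLp 2).2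
  rwa [show ⇑(weightMul (σ / 2) φ) = _ from funext (weightMul_apply _ φ),
    ← hatENorm_eq_eLpNorm] at h

theorem integrable_schwartz_comp_mul {α : Type*} [MeasurableSpace α] {μ : Measure α} {f : α → ℂ}
    (hf : Integrable f μ) {g : α → ℝ} (hg : Measurable g) (φ : 𝓢(ℝ, ℂ)) :
    Integrable (fun p => φ (g p) * f p) μ :=
  hf.bdd_mul (c := ‖φ.toBoundedContinuousFunction‖)
    (φ.continuous.measurable.comp hg).aestronglyMeasurable
    (.of_forall fun p => φ.toBoundedContinuousFunction.norm_coe_le_norm (g p))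

theorem integral_integral_exp_mul_schwartz {α : Type*} [MeasurableSpace α] {μ : Measure α}
    [SFinite μ] {κ : α → ℝ} (hκ : Measurable κ) {g : α → ℂ} (hg : Integrable g μ)
    (ψ : 𝓢(ℝ, ℂ)) :
    ∫ x : ℝ, ((2 * Real.pi : ℂ)⁻¹ * ∫ p, cexp (I * κ p * x) * g p ∂μ) * ψ x
      = ∫ p, fourierSchwartzInv ψ (κ p) * g p ∂μ := by
  have h_int : Integrable (fun q : ℝ × α => cexp (I * κ q.2 * q.1) * (ψ q.1 * g q.2))
      (volume.prod μ) :=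
    (ψ.integrable.mul_prod hg).bdd_mul (c := 1) (Measurable.aestronglyMeasurable (by fun_prop))
      (.of_forall fun p => (norm_cexp_I_mul _ _).le)
  calc ∫ x : ℝ, ((2 * Real.pi : ℂ)⁻¹ * ∫ p, cexp (I * κ p * x) * g p ∂μ) * ψ x
      = (2 * Real.pi : ℂ)⁻¹ * ∫ x : ℝ, ∫ p, cexp (I * κ p * x) * (ψ x * g p) ∂μ := by
        simp only [← integral_const_mul, ← integral_mul_const, mul_assoc, mul_comm (g _)]
    _ = (2 * Real.pi : ℂ)⁻¹ * ∫ p, (∫ x : ℝ, cexp (I * κ p * x) * (ψ x * g p)) ∂μ := by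
        rw [integral_integral_swap h_int]
    _ = _ := by
        simp only [fourierSchwartzInv_apply, ← integral_const_mul, ← integral_mul_const, mul_assoc]

section

variable (T : ℝ) (j : ℕ) (Fhat : ℝ → ℝ → ℂ)

/-- Lebesgue measure on the slab `(0, T) × ℝ` of pairs of a time and a frequency. -/
abbrev slabMeasure : Measure (ℝ × ℝ) := (volume.restrict (Ioo 0 T)).prod volume

/-- The density, in the time `a` and the frequency `k`, of the trace functional at the test function
`hat f`. -/
def traceDensity (f : ℝ → ℂ) (p : ℝ × ℝ) : ℂ :=
  (I * p.2) ^ j * (adjointDuhamel T f p.1 p.2 * Fhat p.2 p.1)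

/-- The value at the test function `hat f` of the distribution `∂_x^j Z(x, ·)` on `(0, T)`. -/
def traceFunctional (x : ℝ) (f : ℝ → ℂ) : ℂ :=
  (2 * Real.pi : ℂ)⁻¹ *
    ∫ p : ℝ × ℝ, cexp (I * p.2 * x) * traceDensity T j Fhat f p ∂slabMeasure T

end

namespace TraceBound

variable {T : ℝ} {j : ℕ} {m : ℝ} {Fhat : ℝ → ℝ → ℂ} {L : ℝ≥0∞} (h : TraceBound T j m Fhat L)
include h

theorem measurable_traceDensity {f : ℝ → ℂ} (hf : Integrable f) :
    Measurable (traceDensity T j Fhat f) :=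
  Measurable.mul (by fun_prop)
    ((measurable_adjointDuhamel T hf).mul (h.measurable.comp measurable_swap))

theorem lintegral_traceDensity_le {f : ℝ → ℂ} (hf : IsAdmissible f) :
    ∫⁻ p, ‖traceDensity T j Fhat f p‖ₑ ∂slabMeasure T ≤ L * hatENorm (-m) f := by
  rw [lintegral_prod _ (h.measurable_traceDensity hf.integrable).enorm.aemeasurable]
  exact h.lintegral_le f hf

theorem integrable_traceDensity (φ : 𝓢(ℝ, ℂ)) :
    Integrable (traceDensity T j Fhat φ) (slabMeasure T) :=
  ⟨(h.measurable_traceDensity φ.integrable).aestronglyMeasurable,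
    (h.lintegral_traceDensity_le (.of_schwartz φ)).trans_lt
      (ENNReal.mul_lt_top h.lt_top (hatENorm_schwartz_lt_top _ φ))⟩

theorem integrable_exp_mul_traceDensity (φ : 𝓢(ℝ, ℂ)) (x : ℝ) :
    Integrable (fun p : ℝ × ℝ => cexp (I * p.2 * x) * traceDensity T j Fhat φ p)
      (slabMeasure T) :=
  (h.integrable_traceDensity φ).bdd_mul (c := 1) (by fun_prop)
    (.of_forall fun p => (norm_cexp_I_mul _ _).le)

/-- The trace functional as a linear map. -/
def linearMap (x : ℝ) : 𝓢(ℝ, ℂ) →ₗ[ℂ] ℂ where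
  toFun φ := traceFunctional T j Fhat x φ
  map_add' φ ψ := by
    have h_add : traceDensity T j Fhat ⇑(φ + ψ)
        = traceDensity T j Fhat φ + traceDensity T j Fhat ψ := funext fun p => by
      have : adjointDuhamel T ⇑(φ + ψ) p.1 p.2 = _ :=
        adjointDuhamel_add T φ.integrable ψ.integrable p.1 p.2
      simp only [traceDensity, Pi.add_apply, this]
      ring
    simp only [traceFunctional, h_add, Pi.add_apply, mul_add]
    rw [integral_add (h.integrable_exp_mul_traceDensity φ x)
      (h.integrable_exp_mul_traceDensity ψ x), mul_add]
  map_smul' z φ := by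
    have h_smul : traceDensity T j Fhat ⇑(z • φ) = fun p => z * traceDensity T j Fhat φ p :=
      funext fun p => by
        have : adjointDuhamel T ⇑(z • φ) p.1 p.2 = _ := adjointDuhamel_const_mul T z φ p.1 p.2
        simp only [traceDensity, this]
        ring
    simp only [traceFunctional, h_smul, mul_left_comm _ z, integral_const_mul, RingHom.id_apply,
      smul_eq_mul]

theorem enorm_traceFunctional_le (x : ℝ) {f : ℝ → ℂ} (hf : IsAdmissible f) :
    ‖traceFunctional T j Fhat x f‖ₑ ≤ L * hatENorm (-m) f := by
  have h_pi : ‖(2 * Real.pi : ℂ)⁻¹‖ₑ ≤ 1 := by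
    rw [← ofReal_norm, norm_inv, norm_mul, norm_real, Real.norm_of_nonneg Real.pi_pos.le,
      Complex.norm_ofNat]
    exact ENNReal.ofReal_le_one.2 (inv_le_one_of_one_le₀ (by linarith [Real.pi_gt_three]))
  calc ‖traceFunctional T j Fhat x f‖ₑ
      ≤ 1 * ∫⁻ p, ‖cexp (I * p.2 * x) * traceDensity T j Fhat f p‖ₑ ∂slabMeasure T := by
        rw [traceFunctional, enorm_mul]
        gcongr
        exact enorm_integral_le_lintegral_enorm _
    _ = ∫⁻ p, ‖traceDensity T j Fhat f p‖ₑ ∂slabMeasure T := by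
        simp only [enorm_mul, ← ofReal_norm (cexp _), norm_cexp_I_mul, ENNReal.ofReal_one, one_mul]
    _ ≤ L * hatENorm (-m) f := h.lintegral_traceDensity_le hf

theorem continuous_traceFunctional (φ : 𝓢(ℝ, ℂ)) :
    Continuous fun x => traceFunctional T j Fhat x φ := by
  refine continuous_const.mul (continuous_of_dominated
    (bound := fun p => ‖traceDensity T j Fhat φ p‖)
    (fun x => (h.integrable_exp_mul_traceDensity φ x).aestronglyMeasurable)
    (fun x => .of_forall fun p => ?_) (h.integrable_traceDensity φ).norm
    (.of_forall fun p => by fun_prop))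
  rw [norm_mul, norm_cexp_I_mul, one_mul]

theorem exists_extension (x : ℝ) : ∃ G : 𝓢'(ℝ, ℂ), sobolevENorm m G ≤ L ∧
    ∀ η, G η = traceFunctional T j Fhat x (fourierSchwartzInv η) := by
  lift L to ℝ≥0 using h.lt_top.ne
  let ι : 𝓢(ℝ, ℂ) →ₗ[ℂ] ℝ → ℂ :=
    { toFun := fun φ => weightMul (-m / 2) φ
      map_add' := fun φ ψ => by rw [map_add]; rfl
      map_smul' := fun z φ => by rw [map_smul]; rfl }
  have hι : ∀ φ, ι φ = fun k => (weight (-m / 2) k : ℂ) * φ k := fun φ =>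
    funext (weightMul_apply _ φ)
  obtain ⟨u, hu, huL, h_repr⟩ := exists_memLp_repr ι (fun φ => (weightMul (-m / 2) φ).memLp 2)
    (h.linearMap x) L fun φ => by
      rw [hι, ← hatENorm_eq_eLpNorm]
      exact h.enorm_traceFunctional_le x (.of_schwartz φ)
  have h_weight : (fun k => (weight (m / 2) k : ℂ) * ((weight (-m / 2) k : ℂ) * u k)) = u := by
    ext k
    rw [← mul_assoc, ← ofReal_mul, ← weight_add, neg_div, add_neg_cancel, weight_zero, ofReal_one,
      one_mul]
  obtain ⟨G, hG⟩ := exists_isFourierDensity (a := m / 2)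
    (g := fun k => (weight (-m / 2) k : ℂ) * u k) (by rwa [h_weight])
  refine ⟨G, ?_, fun η => ?_⟩
  · rwa [sobolevENorm_eq_hatENorm hG, hatENorm_eq_eLpNorm, h_weight]
  · rw [hG.apply_eq]
    refine Eq.trans ?_ (h_repr _).symm
    simp only [hι, mul_assoc, mul_left_comm (u _)]

end TraceBound

theorem exists_hatENorm_fourierSchwartzInv_le : ∃ C : ℝ≥0, ∀ η : 𝓢(ℝ, ℂ),
    hatENorm 0 (fourierSchwartzInv η) ≤ C * eLpNorm η 2 := by
  refine ⟨(Real.toNNReal (2 * Real.pi)⁻¹) ^ (1 / 2 : ℝ), fun η => ?_⟩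
  have h := lintegral_hat_sq (fourierSchwartzInv η).integrable ((fourierSchwartzInv η).memLp 2)
  rw [hat_fourierSchwartzInv] at h
  rw [hatENorm, energy_zero, eLpNorm_two_eq, ENNReal.coe_rpow_of_nonneg _ (by norm_num),
    ← ENNReal.mul_rpow_of_nonneg _ _ (by norm_num), h, ← mul_assoc]
  rw [← ENNReal.ofReal, ← ENNReal.ofReal_mul (by positivity), inv_mul_cancel₀ (by positivity),
    ENNReal.ofReal_one, one_mul]

namespace TraceBound

variable {T : ℝ} {j : ℕ} {m : ℝ} {Fhat : ℝ → ℝ → ℂ} {L : ℝ≥0∞} (h : TraceBound T j m Fhat L)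
include h

theorem exists_memLp_trace (hm : 0 ≤ m) (x : ℝ) : ∃ v : ℝ → ℂ, MemLp v 2 ∧
    ∀ η, ∫ t, v t * η t = traceFunctional T j Fhat x (fourierSchwartzInv η) := by
  lift L to ℝ≥0 using h.lt_top.ne
  obtain ⟨C, hC⟩ := exists_hatENorm_fourierSchwartzInv_le
  let ι : 𝓢(ℝ, ℂ) →ₗ[ℂ] ℝ → ℂ :=
    { toFun := fun φ => φ
      map_add' := fun φ ψ => rfl
      map_smul' := fun z φ => rfl }
  have h_bound (η : 𝓢(ℝ, ℂ)) :=
    calc ‖traceFunctional T j Fhat x (fourierSchwartzInv η)‖ₑ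
        ≤ L * hatENorm (-m) (fourierSchwartzInv η) :=
          h.enorm_traceFunctional_le x (.of_schwartz _)
      _ ≤ L * (C * eLpNorm η 2) := by
          gcongr
          exact (hatENorm_mono (neg_nonpos.2 hm) _).trans (hC η)
      _ = (L * C : ℝ≥0) * eLpNorm η 2 := by rw [ENNReal.coe_mul, mul_assoc]
  obtain ⟨u, hu, -, h_repr⟩ := exists_memLp_repr ι (fun φ => φ.memLp 2)
    ((h.linearMap x).comp fourierSchwartzInv.toLinearMap) (L * C) h_bound
  exact ⟨u, hu, fun η => (h_repr η).symm⟩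

theorem integral_traceFunctional_mul (φ ψ : 𝓢(ℝ, ℂ)) :
    ∫ x, traceFunctional T j Fhat x φ * ψ x = ∫ k, fourierSchwartzInv ψ k *
      ((I * k) ^ j * ∫ a in Ioo 0 T, adjointDuhamel T φ a k * Fhat k a) := by
  have h_int := h.integrable_traceDensity φ
  calc ∫ x, traceFunctional T j Fhat x φ * ψ x
      = ∫ p, fourierSchwartzInv ψ p.2 * traceDensity T j Fhat φ p ∂slabMeasure T :=
        integral_integral_exp_mul_schwartz measurable_snd h_int ψ
    _ = ∫ k, ∫ a in Ioo 0 T, fourierSchwartzInv ψ k * traceDensity T j Fhat φ (a, k) :=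
        integral_prod_symm _ (integrable_schwartz_comp_mul h_int measurable_snd _)
    _ = _ := by simp only [traceDensity, integral_const_mul]

end TraceBound

/-! ### The time trace of the solution -/

theorem exists_enorm_schwartz_le (a : ℝ) (φ : 𝓢(ℝ, ℂ)) :
    ∃ M : ℝ≥0, ∀ k, ‖φ k‖ₑ ≤ M * ENNReal.ofReal (weight a k) := by
  refine ⟨‖(weightMul (-a) φ).toBoundedContinuousFunction‖₊, fun k => ?_⟩
  have h_eq : φ k = (weight a k : ℂ) * weightMul (-a) φ k := by
    rw [weightMul_apply, ← mul_assoc, ← ofReal_mul, ← weight_add, add_neg_cancel, weight_zero,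
      ofReal_one, one_mul]
  rw [h_eq, enorm_weight_mul, mul_comm]
  gcongr
  exact ENNReal.coe_le_coe.2 <|
    (weightMul (-a) φ).toBoundedContinuousFunction.nnnorm_coe_le_nnnorm k

namespace IsForcing

variable {T σ : ℝ} {Fhat : ℝ → ℝ → ℂ} (hF : IsForcing T σ Fhat)
include hF

theorem lintegral_mul_schwartz_lt_top (φ : 𝓢(ℝ, ℂ)) :
    ∫⁻ k, (∫⁻ a in Ioo 0 T, ‖Fhat k a‖ₑ) * ‖φ k‖ₑ < ∞ := by
  obtain ⟨M, hM⟩ := exists_enorm_schwartz_le (σ / 2 - 1) φ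
  calc ∫⁻ k, (∫⁻ a in Ioo 0 T, ‖Fhat k a‖ₑ) * ‖φ k‖ₑ
      ≤ ∫⁻ k, M * (ENNReal.ofReal (weight (σ / 2 - 1) k) * ∫⁻ a in Ioo 0 T, ‖Fhat k a‖ₑ) := by
        refine lintegral_mono fun k => ?_
        rw [← mul_assoc, mul_comm]
        gcongr
        exact hM k
    _ = M * ∫⁻ k, ENNReal.ofReal (weight (σ / 2 - 1) k) * ∫⁻ a in Ioo 0 T, ‖Fhat k a‖ₑ :=
        lintegral_const_mul' _ _ ENNReal.coe_ne_top
    _ < ∞ := ENNReal.mul_lt_top ENNReal.coe_lt_top hF.lintegral_weight_mul_lt_top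

theorem integrable_duhamel_mul (φ : 𝓢(ℝ, ℂ)) :
    Integrable (fun p : ℝ × ℝ => duhamel T Fhat p.1 p.2 * φ p.2) (slabMeasure T) := by
  have h_meas : Measurable fun p : ℝ × ℝ => duhamel T Fhat p.1 p.2 * φ p.2 :=
    (measurable_duhamel T hF.measurable).mul (φ.continuous.measurable.comp measurable_snd)
  refine ⟨h_meas.aestronglyMeasurable, ?_⟩
  rw [HasFiniteIntegral, lintegral_prod _ h_meas.enorm.aemeasurable]
  calc ∫⁻ t in Ioo 0 T, ∫⁻ k, ‖duhamel T Fhat t k * φ k‖ₑ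
      ≤ ∫⁻ _ in Ioo 0 T, ENNReal.ofReal T * ∫⁻ k, (∫⁻ a in Ioo 0 T, ‖Fhat k a‖ₑ) * ‖φ k‖ₑ := by
        refine setLIntegral_mono' measurableSet_Ioo fun t ht => ?_
        rw [← lintegral_const_mul' _ _ ENNReal.ofReal_ne_top]
        refine lintegral_mono fun k => ?_
        rw [enorm_mul, ← mul_assoc]
        gcongr
        exact enorm_duhamel_le Fhat k (Ioo_subset_Icc_self ht)
    _ < ∞ := by
        rw [setLIntegral_const, Real.volume_Ioo]
        exact ENNReal.mul_lt_top (ENNReal.mul_lt_top ENNReal.ofReal_lt_top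
          (hF.lintegral_mul_schwartz_lt_top φ)) ENNReal.ofReal_lt_top

theorem isFourierDensity_solutionHat_iff {f : 𝓢'(ℝ, ℂ)} {t : ℝ} (ht : t ∈ Icc 0 T) :
    IsFourierDensity f (solutionHat Fhat t) ↔ IsFourierDensity f (duhamel T Fhat t) := by
  have h_ae : solutionHat Fhat t =ᵐ[volume] duhamel T Fhat t := by
    filter_upwards [hF.ae_integrableOn] with k hk using solutionHat_eq_duhamel ht hk
  exact ⟨fun hf => hf.congr_ae h_ae, fun hf => hf.congr_ae h_ae.symm⟩

theorem setIntegral_solution_mul {Z : ℝ → 𝓢'(ℝ, ℂ)}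
    (hZ : ∀ t ∈ Icc 0 T, IsFourierDensity (Z t) (solutionHat Fhat t)) {η : 𝓢(ℝ, ℂ)}
    (hη : IsTestOn T η) (ψ : 𝓢(ℝ, ℂ)) :
    ∫ t in Ioo 0 T, Z t ψ * η t = ∫ k, fourierSchwartzInv ψ k *
      ∫ a in Ioo 0 T, adjointDuhamel T (fourierSchwartzInv η) a k * Fhat k a := by
  calc ∫ t in Ioo 0 T, Z t ψ * η t
      = ∫ t in Ioo 0 T, ∫ k, η t * (duhamel T Fhat t k * fourierSchwartzInv ψ k) := by
        refine setIntegral_congr_fun measurableSet_Ioo fun t ht => ?_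
        have ht' := Ioo_subset_Icc_self ht
        rw [((hF.isFourierDensity_solutionHat_iff ht').1 (hZ t ht')).apply_eq,
          integral_const_mul (η t), mul_comm]
    _ = ∫ k, ∫ t in Ioo 0 T, η t * (duhamel T Fhat t k * fourierSchwartzInv ψ k) :=
        integral_integral_swap
          (integrable_schwartz_comp_mul (hF.integrable_duhamel_mul _) measurable_fst η)
    _ = _ := by
        refine integral_congr_ae ?_
        filter_upwards [hF.ae_integrableOn] with k hk
        rw [← integral_duhamel_mul hk hη, ← integral_const_mul (fourierSchwartzInv ψ k)]
        congr 1
        ext t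
        ring

end IsForcing

theorem fourierSchwartzInv_deriv (ψ : 𝓢(ℝ, ℂ)) (k : ℝ) :
    fourierSchwartzInv (SchwartzMap.derivCLM ℂ ℂ ψ) k = -(I * k) * fourierSchwartzInv ψ k := by
  have h_exp (x : ℝ) : HasDerivAt (fun x : ℝ => cexp (I * k * x)) (I * k * cexp (I * k * x)) x := by
    simpa [mul_comm] using (((hasDerivAt_id (x : ℂ)).const_mul (I * k)).cexp).comp_ofReal
  have h_int (φ : 𝓢(ℝ, ℂ)) : Integrable fun x : ℝ => cexp (I * k * x) * φ x :=
    φ.integrable.bdd_mul (c := 1) (by fun_prop) (.of_forall fun x => (norm_cexp_I_mul _ _).le)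
  have h_parts := integral_mul_deriv_eq_deriv_mul_of_integrable (fun x _ => h_exp x)
    (fun x _ => ψ.differentiableAt.hasDerivAt) (h_int (SchwartzMap.derivCLM ℂ ℂ ψ))
    (by simpa [Pi.mul_def, mul_assoc] using (h_int ψ).const_mul (I * k)) (h_int ψ)
  rw [fourierSchwartzInv_apply, fourierSchwartzInv_apply]
  refine (congrArg _ h_parts).trans ?_
  simp only [mul_assoc (I * k : ℂ), integral_const_mul (I * k : ℂ)]
  ring

theorem fourierSchwartzInv_iterate_deriv (j : ℕ) (ψ : 𝓢(ℝ, ℂ)) (k : ℝ) :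
    fourierSchwartzInv ((SchwartzMap.derivCLM ℂ ℂ)^[j] ψ) k
      = (-(I * k)) ^ j * fourierSchwartzInv ψ k := by
  induction j with
  | zero => simp
  | succ j ih =>
    rw [Function.iterate_succ_apply', fourierSchwartzInv_deriv, ih]
    ring

namespace TraceBound

variable {T σ m : ℝ} {j : ℕ} {Fhat : ℝ → ℝ → ℂ} {L : ℝ≥0∞} (h : TraceBound T j m Fhat L)
  (hF : IsForcing T σ Fhat) {Z : ℝ → 𝓢'(ℝ, ℂ)}
  (hZ : ∀ t ∈ Icc 0 T, IsFourierDensity (Z t) (solutionHat Fhat t))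
include h hF hZ

theorem integral_traceFunctional_mul_eq {η : 𝓢(ℝ, ℂ)} (hη : IsTestOn T η) (ψ : 𝓢(ℝ, ℂ)) :
    ∫ x, traceFunctional T j Fhat x (fourierSchwartzInv η) * ψ x
      = (-1) ^ j * ∫ t in Ioo 0 T, Z t ((SchwartzMap.derivCLM ℂ ℂ)^[j] ψ) * η t := by
  rw [hF.setIntegral_solution_mul hZ hη, h.integral_traceFunctional_mul,
    ← integral_const_mul ((-1 : ℂ) ^ j)]
  congr 1
  ext k
  have h_sign : (-1 : ℂ) ^ j * (-(I * k)) ^ j = (I * k) ^ j := by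
    rw [← mul_pow, neg_one_mul, neg_neg]
  rw [fourierSchwartzInv_iterate_deriv, ← h_sign]
  ring

theorem exists_isTimeTrace (hm : 0 ≤ m) : ∃ v : ℝ → ℝ → ℂ, IsTimeTrace j T Z v := by
  choose v hv h_repr using h.exists_memLp_trace hm
  refine ⟨v, fun x => ((hv x).locallyIntegrable one_le_two).locallyIntegrableOn _, fun η hη => ?_⟩
  have h_trace (x : ℝ) : ∫ t in Ioo 0 T, v x t * η t
      = traceFunctional T j Fhat x (fourierSchwartzInv η) := by
    rw [hη.setIntegral_mul_eq, h_repr]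
  simp only [h_trace]
  exact ⟨h.continuous_traceFunctional _, fun ψ _ => h.integral_traceFunctional_mul_eq hF hZ hη ψ⟩

theorem sobolevENormOn_le {v : ℝ → ℝ → ℂ} (hv : IsTimeTrace j T Z v) (x : ℝ) :
    sobolevENormOn m T (v x) ≤ L := by
  obtain ⟨G, hGL, hG⟩ := h.exists_extension x
  refine (iInf₂_le G fun η hη => ⟨hη.integrableOn_mul (hv.1 x), ?_⟩).trans hGL
  obtain ⟨h_cont, h_dist⟩ := hv.2 η hη
  have h_cont' := h.continuous_traceFunctional (fourierSchwartzInv η)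
  rw [hG]
  refine congrFun ((Continuous.ae_eq_iff_eq volume h_cont' h_cont).1 ?_) x
  exact ae_eq_of_integral_mul_schwartz_eq h_cont'.locallyIntegrable h_cont.locallyIntegrable
    fun ψ hψ => (h.integral_traceFunctional_mul_eq hF hZ hη ψ).trans (h_dist ψ hψ).symm

end TraceBound

/-! ### Kernel bounds and the space estimate -/

section KernelBound

variable {T δ : ℝ} {C : ℝ≥0} {K : ℝ → ℝ → ℝ} {Fhat : ℝ → ℝ → ℂ}

theorem enorm_weight_mul_setIntegral_le {k : ℝ} (hK : ∀ a ∈ Ioo 0 T, weight δ k * |K k a| ≤ C)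
    (σ : ℝ) :
    ‖(weight (δ + σ) k : ℂ) * ∫ a in Ioo 0 T, (K k a : ℂ) * Fhat k a‖ₑ
      ≤ C * ∫⁻ a in Ioo 0 T, ‖(weight σ k : ℂ) * Fhat k a‖ₑ := by
  rw [← integral_const_mul (weight (δ + σ) k : ℂ), ← lintegral_const_mul' _ _ ENNReal.coe_ne_top]
  refine (enorm_integral_le_lintegral_enorm _).trans
    (setLIntegral_mono' measurableSet_Ioo fun a ha => ?_)
  rw [enorm_weight_mul, enorm_weight_mul, enorm_mul, weight_add,
    ENNReal.ofReal_mul (weight_pos _ _).le, mul_mul_mul_comm, ← ofReal_norm (K k a : ℂ), norm_real,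
    ← ENNReal.ofReal_mul (weight_pos _ _).le]
  gcongr
  exact ENNReal.ofReal_le_coe.2 (hK a ha)

theorem hatENorm_setIntegral_mul_le (hF : Measurable (Function.uncurry Fhat))
    (hK : ∀ k, ∀ a ∈ Ioo 0 T, weight δ k * |K k a| ≤ C) (σ : ℝ) :
    hatENorm (σ + 2 * δ) (fun k => ∫ a in Ioo 0 T, (K k a : ℂ) * Fhat k a)
      ≤ C * ∫⁻ a in Ioo 0 T, hatENorm σ fun k => Fhat k a := by
  have h_meas : Measurable fun p : ℝ × ℝ => Fhat p.1 p.2 := hF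
  simp only [hatENorm_eq_eLpNorm, eLpNorm_two_eq, show (σ + 2 * δ) / 2 = δ + σ / 2 by ring]
  calc (∫⁻ k, ‖(weight (δ + σ / 2) k : ℂ) * ∫ a in Ioo 0 T, (K k a : ℂ) * Fhat k a‖ₑ ^ 2)
        ^ (1 / 2 : ℝ)
      ≤ (∫⁻ k, (C * ∫⁻ a in Ioo 0 T, ‖(weight (σ / 2) k : ℂ) * Fhat k a‖ₑ) ^ 2) ^ (1 / 2 : ℝ) := by
        gcongr with k
        exact enorm_weight_mul_setIntegral_le (hK k) _
    _ = C * (∫⁻ k, (∫⁻ a in Ioo 0 T, ‖(weight (σ / 2) k : ℂ) * Fhat k a‖ₑ) ^ 2) ^ (1 / 2 : ℝ) := by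
        simp only [mul_pow]
        rw [lintegral_const_mul' _ _ (by finiteness), ENNReal.mul_rpow_of_nonneg _ _ (by norm_num),
          sq_rpow_half]
    _ ≤ C * ((∫⁻ a in Ioo 0 T, (∫⁻ k, ‖(weight (σ / 2) k : ℂ) * Fhat k a‖ₑ ^ 2) ^ (1 / 2 : ℝ)) ^ 2)
          ^ (1 / 2 : ℝ) := by
        gcongr
        exact lintegral_sq_lintegral_le (Measurable.enorm (by fun_prop))
    _ = _ := by rw [sq_rpow_half]

end KernelBound

theorem one_add_sq_le_two_mul_omega {k : ℝ} (hk : 1 ≤ k ^ 2) : 1 + k ^ 2 ≤ 2 * omega k := by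
  have h_sqrt : √(1 + k ^ 2) ≤ 2 * |k| := by
    rw [Real.sqrt_le_left (by positivity), mul_pow, sq_abs]
    linarith
  calc 1 + k ^ 2 = √(1 + k ^ 2) * √(1 + k ^ 2) := (Real.mul_self_sqrt (by positivity)).symm
    _ ≤ 2 * |k| * √(1 + k ^ 2) := by gcongr
    _ = 2 * omega k := mul_assoc _ _ _

theorem weight_one_mul_abs_sineKernel_le {T τ : ℝ} (k : ℝ) (hτ : |τ| ≤ T) :
    weight 1 k * |sineKernel k τ| ≤ 2 * T + 2 := by
  have hT : 0 ≤ T := (abs_nonneg _).trans hτ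
  rw [weight_one]
  rcases le_total (k ^ 2) 1 with hk | hk
  · calc (1 + k ^ 2) * |sineKernel k τ| ≤ (1 + 1) * T := by
          gcongr
          exact (abs_sineKernel_le k τ).trans hτ
      _ ≤ 2 * T + 2 := by linarith
  · calc (1 + k ^ 2) * |sineKernel k τ| ≤ 2 * omega k * (omega k)⁻¹ := by
          gcongr
          · exact mul_nonneg zero_le_two (omega_nonneg k)
          · exact one_add_sq_le_two_mul_omega hk
          · exact abs_sineKernel_le_inv k τ
      _ ≤ 2 * 1 := by
          rw [mul_assoc]
          gcongr
          exact mul_inv_le_one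
      _ ≤ 2 * T + 2 := by linarith

/-- The time derivative of the truncated kernel `sineKernel k (max τ 0)`, away from `τ = 0`. -/
def truncatedCosine (k τ : ℝ) : ℝ := if 0 < τ then Real.cos (omega k * τ) else 0

@[fun_prop]
theorem measurable_truncatedCosine : Measurable fun p : ℝ × ℝ => truncatedCosine p.1 p.2 :=
  Measurable.ite (measurableSet_lt measurable_const measurable_snd) (by fun_prop) measurable_const

theorem abs_truncatedCosine_le_one (k τ : ℝ) : |truncatedCosine k τ| ≤ 1 := by
  unfold truncatedCosine
  split_ifs
  · exact Real.abs_cos_le_one _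
  · simp

theorem hasDerivAt_sineKernel_max {k τ : ℝ} (hk : k ≠ 0) (hτ : τ ≠ 0) :
    HasDerivAt (fun τ => sineKernel k (max τ 0)) (truncatedCosine k τ) τ := by
  rcases hτ.lt_or_gt with h | h
  · rw [truncatedCosine, if_neg h.not_gt]
    refine (hasDerivAt_const τ (sineKernel k 0)).congr_of_eventuallyEq ?_
    filter_upwards [gt_mem_nhds h] with τ' hτ'
    rw [max_eq_right (le_of_lt hτ')]
  · rw [truncatedCosine, if_pos h]
    refine (hasDerivAt_sineKernel hk τ).congr_of_eventuallyEq ?_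
    filter_upwards [lt_mem_nhds h] with τ' hτ'
    rw [max_eq_left (le_of_lt hτ')]

theorem abs_sineKernel_sub_le (k x y : ℝ) : |sineKernel k x - sineKernel k y| ≤ |x - y| := by
  rcases eq_or_ne k 0 with rfl | hk
  · simp [sineKernel, omega]
  have h_pos := omega_pos hk
  rw [sineKernel, sineKernel, ← sub_div, abs_div, abs_of_pos h_pos, div_le_iff₀ h_pos]
  refine (Real.abs_sin_sub_sin_le _ _).trans_eq ?_
  rw [← mul_sub, abs_mul, abs_of_pos h_pos, mul_comm]

/-- The time derivative of `duhamel`. -/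
def duhamelDeriv (T : ℝ) (Fhat : ℝ → ℝ → ℂ) (t k : ℝ) : ℂ :=
  ∫ a in Ioo 0 T, (truncatedCosine k (t - a) : ℂ) * Fhat k a

theorem measurable_duhamelDeriv {Fhat : ℝ → ℝ → ℂ} (T t : ℝ)
    (hF : Measurable (Function.uncurry Fhat)) : Measurable (duhamelDeriv T Fhat t) := by
  have h_meas : Measurable fun p : ℝ × ℝ => Fhat p.1 p.2 := hF
  exact (StronglyMeasurable.integral_prod_right (f := fun (k : ℝ) (a : ℝ) =>
    (truncatedCosine k (t - a) : ℂ) * Fhat k a) (ν := volume.restrict (Ioo 0 T))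
      (Measurable.stronglyMeasurable (by fun_prop))).measurable

theorem hatENorm_duhamel_le {T t : ℝ} {Fhat : ℝ → ℝ → ℂ} (hF : Measurable (Function.uncurry Fhat))
    (σ : ℝ) (ht : t ∈ Icc 0 T) :
    hatENorm (σ + 2) (duhamel T Fhat t)
      ≤ (2 * T + 2).toNNReal * ∫⁻ a in Ioo 0 T, hatENorm σ fun k => Fhat k a := by
  have h := hatENorm_setIntegral_mul_le (T := T) (K := fun k a => sineKernel k (max (t - a) 0)) hF
    (fun k a ha => (weight_one_mul_abs_sineKernel_le k (abs_max_sub_le ht ha.1)).trans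
      (Real.le_coe_toNNReal _)) σ
  rwa [mul_one] at h

theorem hatENorm_duhamelDeriv_le {T : ℝ} {Fhat : ℝ → ℝ → ℂ}
    (hF : Measurable (Function.uncurry Fhat)) (σ t : ℝ) :
    hatENorm σ (duhamelDeriv T Fhat t) ≤ ∫⁻ a in Ioo 0 T, hatENorm σ fun k => Fhat k a := by
  have h := hatENorm_setIntegral_mul_le (T := T) (δ := 0) (C := 1)
    (K := fun k a => truncatedCosine k (t - a)) hF (fun k a _ => by
      simpa [weight_zero] using abs_truncatedCosine_le_one k (t - a)) σ
  rwa [mul_zero, add_zero, ENNReal.coe_one, one_mul] at h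

theorem exists_isFourierDensity_of_hatENorm_lt_top {σ : ℝ} {u : ℝ → ℂ} (hu : Measurable u)
    (h : hatENorm σ u < ∞) : ∃ f : 𝓢'(ℝ, ℂ), IsFourierDensity f u :=
  exists_isFourierDensity (a := σ / 2) ⟨by fun_prop, by rwa [← hatENorm_eq_eLpNorm]⟩

theorem ae_slabMeasure_fst_ne_snd_ne (T t : ℝ) : ∀ᵐ p ∂slabMeasure T, t - p.1 ≠ 0 ∧ p.2 ≠ 0 := by
  have h_fst : ∀ᵐ a ∂volume.restrict (Ioo 0 T), a ≠ t := ae_restrict_of_ae (Measure.ae_ne volume t)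
  filter_upwards [Measure.quasiMeasurePreserving_fst.ae h_fst,
    Measure.quasiMeasurePreserving_snd.ae (Measure.ae_ne volume 0)] with p h_ne h_ne'
  exact ⟨sub_ne_zero.2 h_ne.symm, h_ne'⟩

theorem integral_slab_mul_eq {T : ℝ} {Fhat : ℝ → ℝ → ℂ} {K : ℝ × ℝ → ℂ} {φ : ℝ → ℂ}
    (hK : Integrable (fun p : ℝ × ℝ => K p * (Fhat p.2 p.1 * φ p.2)) (slabMeasure T)) :
    ∫ p, K p * (Fhat p.2 p.1 * φ p.2) ∂slabMeasure T
      = ∫ k, (∫ a in Ioo 0 T, K (a, k) * Fhat k a) * φ k := by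
  rw [integral_prod_symm _ hK]
  simp only [← integral_mul_const, mul_assoc]

namespace IsForcing

variable {T σ : ℝ} {Fhat : ℝ → ℝ → ℂ} (hF : IsForcing T σ Fhat)
include hF

theorem exists_isForcedSolution {F : ℝ → 𝓢'(ℝ, ℂ)} (hFhat : IsSpatialFourier T F Fhat) :
    ∃ Z : ℝ → 𝓢'(ℝ, ℂ), IsForcedSolution T F Z := by
  have h_exists (t : ℝ) :
      ∃ f : 𝓢'(ℝ, ℂ), t ∈ Icc 0 T → IsFourierDensity f (solutionHat Fhat t) := by
    by_cases ht : t ∈ Icc 0 T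
    · obtain ⟨f, hf⟩ := exists_isFourierDensity_of_hatENorm_lt_top
        (measurable_duhamel T hF.measurable).of_uncurry_left
        ((hatENorm_duhamel_le hF.measurable σ ht).trans_lt
          (ENNReal.mul_lt_top ENNReal.coe_lt_top hF.lintegral_lt_top))
      exact ⟨f, fun _ => (hF.isFourierDensity_solutionHat_iff ht).2 hf⟩
    · exact ⟨0, fun h => absurd h ht⟩
  choose Z hZ using h_exists
  exact ⟨Z, Fhat, hFhat, hZ⟩

theorem integrable_mul_schwartz (φ : 𝓢(ℝ, ℂ)) :
    Integrable (fun p : ℝ × ℝ => Fhat p.2 p.1 * φ p.2) (slabMeasure T) := by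
  have h_meas : Measurable fun p : ℝ × ℝ => Fhat p.2 p.1 * φ p.2 :=
    (hF.measurable.comp measurable_swap).mul (φ.continuous.measurable.comp measurable_snd)
  refine ⟨h_meas.aestronglyMeasurable, ?_⟩
  rw [HasFiniteIntegral, lintegral_prod_symm _ h_meas.enorm.aemeasurable]
  simp only [enorm_mul, lintegral_mul_const' _ _ enorm_ne_top]
  exact hF.lintegral_mul_schwartz_lt_top φ

theorem integrable_sineKernel_mul (φ : 𝓢(ℝ, ℂ)) (t : ℝ) :
    Integrable (fun p : ℝ × ℝ => (sineKernel p.2 (max (t - p.1) 0) : ℂ) * (Fhat p.2 p.1 * φ p.2))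
      (slabMeasure T) := by
  refine (hF.integrable_mul_schwartz φ).bdd_mul (c := |t|)
    (Measurable.aestronglyMeasurable (by fun_prop)) ?_
  filter_upwards [Measure.quasiMeasurePreserving_fst.ae (ae_restrict_mem measurableSet_Ioo)]
    with p hp
  rw [norm_real, Real.norm_eq_abs]
  refine (abs_sineKernel_le _ _).trans ?_
  rw [abs_of_nonneg (le_max_right _ _)]
  exact max_le (by linarith [hp.1, le_abs_self t]) (abs_nonneg t)

theorem hasDerivAt_integral_duhamel_mul (φ : 𝓢(ℝ, ℂ)) (t : ℝ) :
    HasDerivAt (fun τ => ∫ k, duhamel T Fhat τ k * φ k) (∫ k, duhamelDeriv T Fhat t k * φ k) t := by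
  have h_base := hF.integrable_mul_schwartz φ
  have h_meas : AEStronglyMeasurable
      (fun p : ℝ × ℝ => (truncatedCosine p.2 (t - p.1) : ℂ) * (Fhat p.2 p.1 * φ p.2))
      (slabMeasure T) :=
    .mul (Measurable.aestronglyMeasurable (by fun_prop)) h_base.aestronglyMeasurable
  have h_lip (p : ℝ × ℝ) : LipschitzOnWith (Real.nnabs ‖Fhat p.2 p.1 * φ p.2‖)
      (fun τ => (sineKernel p.2 (max (τ - p.1) 0) : ℂ) * (Fhat p.2 p.1 * φ p.2)) univ :=
    LipschitzOnWith.of_dist_le_mul fun x _ y _ => by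
      rw [dist_eq_norm, dist_eq_norm, ← sub_mul, norm_mul, ← ofReal_sub, norm_real, mul_comm,
        Real.coe_nnabs, abs_norm]
      gcongr
      refine (abs_sineKernel_sub_le _ _ _).trans ((abs_max_sub_max_le_abs _ _ _).trans_eq ?_)
      rw [Real.norm_eq_abs, sub_sub_sub_cancel_right]
  have h_kernel : ∀ᵐ p ∂slabMeasure T, HasDerivAt
      (fun τ => (sineKernel p.2 (max (τ - p.1) 0) : ℂ) * (Fhat p.2 p.1 * φ p.2))
      ((truncatedCosine p.2 (t - p.1) : ℂ) * (Fhat p.2 p.1 * φ p.2)) t := by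
    filter_upwards [ae_slabMeasure_fst_ne_snd_ne T t] with p hp
    exact ((hasDerivAt_sineKernel_max hp.2 hp.1).comp_sub_const t p.1).ofReal_comp.mul_const _
  obtain ⟨h_int, h_deriv⟩ := hasDerivAt_integral_of_dominated_loc_of_lip Filter.univ_mem
    (.of_forall fun τ => (hF.integrable_sineKernel_mul φ τ).aestronglyMeasurable)
    (hF.integrable_sineKernel_mul φ t) h_meas (.of_forall h_lip) h_base.norm h_kernel
  simp only [integral_slab_mul_eq h_int,
    integral_slab_mul_eq (hF.integrable_sineKernel_mul φ _)] at h_deriv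
  exact h_deriv

variable {Z : ℝ → 𝓢'(ℝ, ℂ)}
  (hZ : ∀ t ∈ Icc 0 T, IsFourierDensity (Z t) (solutionHat Fhat t))
include hZ

theorem exists_isTimeDerivative : ∃ Z' : ℝ → 𝓢'(ℝ, ℂ),
    IsTimeDerivative T Z Z' ∧ ∀ t, IsFourierDensity (Z' t) (duhamelDeriv T Fhat t) := by
  choose Z' hZ' using fun t => exists_isFourierDensity_of_hatENorm_lt_top
    (measurable_duhamelDeriv T t hF.measurable)
    ((hatENorm_duhamelDeriv_le hF.measurable σ t).trans_lt hF.lintegral_lt_top)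
  have h_apply (ψ : 𝓢(ℝ, ℂ)) (t : ℝ) (ht : t ∈ Icc 0 T) :
      Z t ψ = ∫ k, duhamel T Fhat t k * fourierSchwartzInv ψ k :=
    ((hF.isFourierDensity_solutionHat_iff ht).1 (hZ t ht)).apply_eq ψ
  refine ⟨Z', fun t ht ψ => ?_, hZ'⟩
  rw [(hZ' t).apply_eq]
  exact (hF.hasDerivAt_integral_duhamel_mul (fourierSchwartzInv ψ) t).hasDerivWithinAt.congr
    (h_apply ψ) (h_apply ψ t ht)

end IsForcing

theorem IsTimeDerivative.unique {T : ℝ} {Z Z₁ Z₂ : ℝ → 𝓢'(ℝ, ℂ)} (hT : 0 < T)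
    (h₁ : IsTimeDerivative T Z Z₁) (h₂ : IsTimeDerivative T Z Z₂) {t : ℝ} (ht : t ∈ Icc 0 T) :
    Z₁ t = Z₂ t :=
  DFunLike.ext _ _ fun ψ => (uniqueDiffOn_Icc hT t ht).eq_deriv _ (h₁ t ht ψ) (h₂ t ht ψ)

theorem IsForcing.space_estimate {T σ : ℝ} {Fhat : ℝ → ℝ → ℂ} {Z Z' : ℝ → 𝓢'(ℝ, ℂ)} (hT : 0 < T)
    (hF : IsForcing T σ Fhat)
    (hZ : ∀ t ∈ Icc 0 T, IsFourierDensity (Z t) (solutionHat Fhat t))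
    (hZ' : IsTimeDerivative T Z Z') {t : ℝ} (ht : t ∈ Icc 0 T) :
    sobolevENorm (σ + 2) (Z t) + sobolevENorm σ (Z' t)
      ≤ ((2 * T + 2).toNNReal + 1 : ℝ≥0) * ∫⁻ a in Ioo 0 T, hatENorm σ fun k => Fhat k a := by
  obtain ⟨W, hW, hW_hat⟩ := hF.exists_isTimeDerivative hZ
  rw [hZ'.unique hT hW ht, sobolevENorm_eq_hatENorm (hW_hat t),
    sobolevENorm_eq_hatENorm ((hF.isFourierDensity_solutionHat_iff ht).1 (hZ t ht)),
    ENNReal.coe_add, add_mul, ENNReal.coe_one, one_mul]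
  exact add_le_add (hatENorm_duhamel_le hF.measurable σ ht)
    (hatENorm_duhamelDeriv_le hF.measurable σ t)

/-! ### Forcing terms and the time estimates -/

namespace IsSpatialFourier

variable {T : ℝ} {F : ℝ → 𝓢'(ℝ, ℂ)} {Fhat : ℝ → ℝ → ℂ} (h : IsSpatialFourier T F Fhat) (σ : ℝ)
include h

theorem bochnerENorm_eq (p : ℝ≥0∞) : bochnerENorm p σ T F
    = eLpNorm (fun t => hatENorm σ fun k => Fhat k t) p (volume.restrict (Ioo 0 T)) := by
  refine eLpNorm_congr_ae ?_
  filter_upwards [h.2] with t ht using sobolevENorm_eq_hatENorm ht σ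

theorem bochnerENorm_one :
    bochnerENorm 1 σ T F = ∫⁻ t in Ioo 0 T, hatENorm σ fun k => Fhat k t := by
  rw [h.bochnerENorm_eq, eLpNorm_one_eq_lintegral_enorm]
  simp only [enorm_eq_self]

theorem bochnerENorm_two : bochnerENorm 2 σ T F
    = (∫⁻ t in Ioo 0 T, (hatENorm σ fun k => Fhat k t) ^ 2) ^ (1 / 2 : ℝ) := by
  rw [h.bochnerENorm_eq, eLpNorm_two_eq]
  simp only [enorm_eq_self]

variable {σ} in
theorem isForcing {p : ℝ≥0∞} (hp : 1 ≤ p) (hB : bochnerENorm p σ T F < ∞) :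
    IsForcing T σ Fhat := by
  have h_meas := measurable_hatENorm σ h.1
  rw [h.bochnerENorm_eq] at hB
  have h_mem : MemLp (fun t => hatENorm σ fun k => Fhat k t) p (volume.restrict (Ioo 0 T)) :=
    ⟨h_meas.aestronglyMeasurable, hB⟩
  refine ⟨h.1, ?_⟩
  rw [← h.bochnerENorm_one, h.bochnerENorm_eq]
  exact (h_mem.mono_exponent hp).2

end IsSpatialFourier

theorem MemBochner.exists_isForcedSolution {p : ℝ≥0∞} {σ T : ℝ} {F : ℝ → 𝓢'(ℝ, ℂ)}
    (hF : MemBochner p σ T F) (hp : 1 ≤ p) : ∃ Z : ℝ → 𝓢'(ℝ, ℂ), IsForcedSolution T F Z :=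
  hF.1.elim fun _ h => (h.isForcing hp hF.2).exists_isForcedSolution h

/-- The estimate of `∂_x^j Z(x, ·)` in `H^{(2s - 2j + 1)/4}(0, T)`, uniformly in `x` and with the
constant `C`, for all forcing terms in `L^p((0, T); H^{s - 2}(ℝ))`, together with the existence of
the solution and of its time traces. -/
def HasTimeEstimate (p : ℝ≥0∞) (j : ℕ) (s T : ℝ) (C : ℝ≥0) : Prop :=
  ∀ F : ℝ → 𝓢'(ℝ, ℂ), MemBochner p (s - 2) T F →
    (∃ Z : ℝ → 𝓢'(ℝ, ℂ), IsForcedSolution T F Z) ∧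
    ∀ Z : ℝ → 𝓢'(ℝ, ℂ), IsForcedSolution T F Z →
      (∃ v : ℝ → ℝ → ℂ, IsTimeTrace j T Z v) ∧
      ∀ v : ℝ → ℝ → ℂ, IsTimeTrace j T Z v → ∀ x : ℝ,
        sobolevENormOn ((2 * s - 2 * j + 1) / 4) T (v x) ≤ C * bochnerENorm p (s - 2) T F

theorem HasTimeEstimate.mono {p : ℝ≥0∞} {j : ℕ} {s T : ℝ} {C C' : ℝ≥0}
    (h : HasTimeEstimate p j s T C) (hC : C ≤ C') : HasTimeEstimate p j s T C' :=
  fun F hF => (h F hF).imp_right fun h_est Z hZ => (h_est Z hZ).imp_right fun h_le v hv x =>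
    (h_le v hv x).trans (by gcongr)

theorem hasTimeEstimate_of_traceBound {p : ℝ≥0∞} {j : ℕ} {s T : ℝ} {C : ℝ≥0} (hp : 1 ≤ p)
    (hs : 0 ≤ (2 * s - 2 * j + 1) / 4)
    (hC : ∀ F Fhat, IsSpatialFourier T F Fhat → bochnerENorm p (s - 2) T F < ∞ →
      TraceBound T j ((2 * s - 2 * j + 1) / 4) Fhat (C * bochnerENorm p (s - 2) T F)) :
    HasTimeEstimate p j s T C := by
  refine fun F hF => ⟨hF.exists_isForcedSolution hp, ?_⟩
  rintro Z ⟨Fhat, hFhat, hZ⟩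
  have h_bound := hC F Fhat hFhat hF.2
  have h_forcing := hFhat.isForcing hp hF.2
  exact ⟨h_bound.exists_isTimeTrace h_forcing hZ hs,
    fun v hv x => h_bound.sobolevENormOn_le h_forcing hZ hv x⟩

theorem exists_hasTimeEstimate_one (j : ℕ) (s T : ℝ) (h₁ : -1 / 2 + j ≤ s) (h₂ : s ≤ 3 / 2 + j) :
    ∃ C, HasTimeEstimate 1 j s T C := by
  obtain ⟨C, hC⟩ := exists_traceBound_one T j (σ := s - 2) (m := (2 * s - 2 * j + 1) / 4)
    ⟨by linarith, by linarith⟩ (by ring)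
  refine ⟨C, hasTimeEstimate_of_traceBound le_rfl (by linarith) fun F Fhat hF hB => ?_⟩
  rw [hF.bochnerENorm_one]
  exact hC Fhat (hF.isForcing le_rfl hB)

theorem exists_hasTimeEstimate_two (j : ℕ) (s T : ℝ) (h₁ : 3 / 2 + j ≤ s) (h₂ : s ≤ 7 / 2 + j) :
    ∃ C, HasTimeEstimate 2 j s T C := by
  obtain ⟨C, hC⟩ := exists_traceBound_two T j (σ := s - 2) (m := (2 * s - 2 * j + 1) / 4)
    ⟨by linarith, by linarith⟩ (by ring)
  refine ⟨C, hasTimeEstimate_of_traceBound one_le_two (by linarith) fun F Fhat hF hB => ?_⟩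
  rw [hF.bochnerENorm_two] at hB ⊢
  exact hC Fhat hF.1 hB

end Boussinesq

end

theorem theorem3p2 :
    -- the space estimate
    (∀ T : ℝ, 0 < T → ∃ c : ℝ≥0, ∀ (s : ℝ) (F : ℝ → 𝓢'(ℝ, ℂ)),
      Boussinesq.MemBochner 1 (s - 2) T F →
        (∃ Z : ℝ → 𝓢'(ℝ, ℂ), Boussinesq.IsForcedSolution T F Z) ∧
        ∀ Z : ℝ → 𝓢'(ℝ, ℂ), Boussinesq.IsForcedSolution T F Z →
          (∃ Z' : ℝ → 𝓢'(ℝ, ℂ), Boussinesq.IsTimeDerivative T Z Z') ∧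
          ∀ Z' : ℝ → 𝓢'(ℝ, ℂ), Boussinesq.IsTimeDerivative T Z Z' →
            ∀ t ∈ Set.Icc 0 T,
              Boussinesq.sobolevENorm s (Z t) + Boussinesq.sobolevENorm (s - 2) (Z' t)
                ≤ c * Boussinesq.bochnerENorm 1 (s - 2) T F) ∧
    -- the time estimates
    (∀ (j : ℕ) (s T : ℝ), 0 < T → ∃ c : ℝ≥0,
      (-1 / 2 + j ≤ s → s ≤ 3 / 2 + j → ∀ F : ℝ → 𝓢'(ℝ, ℂ),
        Boussinesq.MemBochner 1 (s - 2) T F →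
        (∃ Z : ℝ → 𝓢'(ℝ, ℂ), Boussinesq.IsForcedSolution T F Z) ∧
        ∀ Z : ℝ → 𝓢'(ℝ, ℂ), Boussinesq.IsForcedSolution T F Z →
          (∃ v : ℝ → ℝ → ℂ, Boussinesq.IsTimeTrace j T Z v) ∧
          ∀ v : ℝ → ℝ → ℂ, Boussinesq.IsTimeTrace j T Z v → ∀ x : ℝ,
            Boussinesq.sobolevENormOn ((2 * s - 2 * j + 1) / 4) T (v x)
              ≤ c * Boussinesq.bochnerENorm 1 (s - 2) T F) ∧
      (3 / 2 + j ≤ s → s ≤ 7 / 2 + j → ∀ F : ℝ → 𝓢'(ℝ, ℂ),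
        Boussinesq.MemBochner 2 (s - 2) T F →
        (∃ Z : ℝ → 𝓢'(ℝ, ℂ), Boussinesq.IsForcedSolution T F Z) ∧
        ∀ Z : ℝ → 𝓢'(ℝ, ℂ), Boussinesq.IsForcedSolution T F Z →
          (∃ v : ℝ → ℝ → ℂ, Boussinesq.IsTimeTrace j T Z v) ∧
          ∀ v : ℝ → ℝ → ℂ, Boussinesq.IsTimeTrace j T Z v → ∀ x : ℝ,
            Boussinesq.sobolevENormOn ((2 * s - 2 * j + 1) / 4) T (v x)
              ≤ c * Boussinesq.bochnerENorm 2 (s - 2) T F)) := by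
  refine ⟨fun T hT => ⟨(2 * T + 2).toNNReal + 1, fun s F hF =>
    ⟨hF.exists_isForcedSolution le_rfl, ?_⟩⟩, fun j s T _ => ?_⟩
  · rintro Z ⟨Fhat, hFhat, hZ⟩
    have h_forcing := hFhat.isForcing le_rfl hF.2
    refine ⟨(h_forcing.exists_isTimeDerivative hZ).imp fun _ h => h.1, fun Z' hZ' t ht => ?_⟩
    have h := h_forcing.space_estimate hT hZ hZ' ht
    rwa [sub_add_cancel, ← hFhat.bochnerENorm_one] at h
  · choose! C₁ h₁ using Boussinesq.exists_hasTimeEstimate_one j s T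
    choose! C₂ h₂ using Boussinesq.exists_hasTimeEstimate_two j s T
    exact ⟨C₁ + C₂, fun hs hs' => (h₁ hs hs').mono le_self_add,
      fun hs hs' => (h₂ hs hs').mono le_add_self⟩
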